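/- Let $n\in\mathbf N$ and write $\langle x\rangle=(1+|x|^2)^{1/2}$ and $\widehat f(\xi)=\int_{\mathbf R^n} f(x)e^{-ix\xi}\,dx$, extended to tempered distributions. For $1\le q<\infty$ and $s\in\mathbf R$ let $\mathcal FL^q_s(\mathbf R^n)$ be the space of all $f\in\mathcal S'(\mathbf R^n)$ with $$\|f\|_{\mathcal FL^q_s}=\Big(\int_{\mathbf R^n}\big(\langle\xi\rangle^s|\widehat f(\xi)|\big)^q\,d\xi\Big)^{1/q}<\infty .$$ Fix any $\varphi\in\mathcal S(\mathbf R^n)$ with $\operatorname{supp}\varphi\subset[-1,1]^n$ and $\sum_{k\in\mathbf Z^n}\varphi(\xi-k)=1$ for all $\xi\in\mathbf R^n$, and for $1\le p<\infty$ let $M^{p,q}_s(\mathbf R^n)$ be the space of all $f\in\mathcal S'(\mathbf R^n)$ with $$\|f\|_{M^{p,q}_s}=\Big(\sum_{k\in\mathbf Z^n}\langle k\rangle^{sq}\,\|\varphi(D-k)f\|_{L^p}^q\Big)^{1/q}<\infty ,\qquad \varphi(D-k)f=\mathcal F^{-1}\big(\varphi(\cdot-k)\widehat f\,\big).$$ For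 $X$ one of these spaces, an ideal in $X$ is a linear subspace $I\subset X$ such that $fg\in I$ for all $f\in X$, $g\in I$ (pointwise product); it is a closed ideal if it is closed in the norm of $X$. Let $\mathcal I_F$ and $\mathcal I_M$ be the sets of all closed ideals in $\mathcal FL^q_s(\mathbf R^n)$ and in $M^{p,q}_s(\mathbf R^n)$, respectively. **Theorem.** Let $1\le p\le 2$, let $p',q'$ be the conjugate exponents of $p,q$, and suppose that either $q=1$ and $s\ge 0$, or $1<q<\infty$, $q\le p'$ and $s>n/q'$. Then the map $$\iota:\mathcal I_F\to\mathcal I_M,\qquad \iota(I_F)=I_F\cap M^{p,q}_s(\mathbf R^n),$$ is well defined and bijective. More precisely, for every $I_M\in\mathcal I_M$ the closure $\overline{I_M}^{\|\cdot\|_{\mathcal FL^q_s}}$ of $I_M$ in $\mathcal FL^q_s(\mathbf R^n)$ is a closed ideal in $\mathcal FL^q_s(\mathbf R^n)$, one has $$\iota^{-1}(I_M)=\overline{I_M}^{\|\cdot\|_{\mathcal FL^q_s}}\qquad\text{and}\qquad I_M=\overline{I_M}^{\|\cdot\|_{\mathcal FL^q_s}}\cap M^{p,q}_s(\mathbf R^n),$$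 and $\overline{I_F\cap M^{p,q}_s(\mathbf R^n)}^{\|\cdot\|_{\mathcal FL^q_s}}=I_F$ for every $I_F\in\mathcal I_F$. -/

import Mathlib

open MeasureTheory
open scoped ENNReal SchwartzMap FourierTransform InnerProductSpace

noncomputable section

namespace ModulationIdeals

/-- Euclidean space `ℝⁿ`. -/
abbrev Rn (n : ℕ) : Type := EuclideanSpace ℝ (Fin n)

/-- The Japanese bracket `⟨x⟩ = (1 + |x|²)^{1/2}`. -/
def bracket {n : ℕ} (x : Rn n) : ℝ := Real.sqrt (1 + ‖x‖ ^ 2)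

/-! ### The Fourier transform in the normalisation `f̂(ξ) = ∫ f(x) e^{-i x·ξ} dx` -/

/-- The dilation `x ↦ c x` of `ℝⁿ`, for a nonzero real `c`. -/
def dilation (n : ℕ) (c : ℝˣ) : Rn n ≃L[ℝ] Rn n := ContinuousLinearEquiv.smulLeft c

/-- The unit `2π` of `ℝ`. -/
def twoPi : ℝˣ := Units.mk0 (2 * Real.pi) (by positivity)

/-- The Fourier transform `(𝓕 f)(ξ) = ∫ f(x) e^{-i x·ξ} dx` on the Schwartz space, obtained from
Mathlib's `∫ f(x) e^{-2π i x·ξ} dx` by a dilation; see `schwartzFourier_apply`. -/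
def schwartzFourier (n : ℕ) : 𝓢(Rn n, ℂ) →L[ℂ] 𝓢(Rn n, ℂ) :=
  (SchwartzMap.compCLMOfContinuousLinearEquiv ℂ (dilation n twoPi⁻¹)).comp
    (FourierTransform.fourierCLM ℂ 𝓢(Rn n, ℂ))

/-- The inverse Fourier transform `(𝓕⁻¹ h)(x) = (2π)⁻ⁿ ∫ h(ξ) e^{i x·ξ} dξ` on the Schwartz
space; see `schwartzFourierInv_apply`. -/
def schwartzFourierInv (n : ℕ) : 𝓢(Rn n, ℂ) →L[ℂ] 𝓢(Rn n, ℂ) :=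
  (FourierTransform.fourierInvCLM ℂ 𝓢(Rn n, ℂ)).comp
    (SchwartzMap.compCLMOfContinuousLinearEquiv ℂ (dilation n twoPi))

theorem schwartzFourier_apply (n : ℕ) (f : 𝓢(Rn n, ℂ)) (ξ : Rn n) :
    schwartzFourier n f ξ = ∫ x, Complex.exp (-(Complex.I * (⟪x, ξ⟫_ℝ : ℂ))) * f x := by
  have h1 : schwartzFourier n f ξ = (𝓕 f) ((2 * Real.pi)⁻¹ • ξ) := by
    rfl
  rw [h1, SchwartzMap.fourier_coe, Real.fourier_eq']
  refine integral_congr_ae (Filter.Eventually.of_forall fun x => ?_)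
  simp only [inner_smul_right, smul_eq_mul]
  congr 2
  have : (Real.pi : ℂ) ≠ 0 := by exact_mod_cast Real.pi_ne_zero
  push_cast
  field_simp

theorem schwartzFourierInv_apply (n : ℕ) (h : 𝓢(Rn n, ℂ)) (x : Rn n) :
    schwartzFourierInv n h x =
      ((2 * Real.pi : ℝ) ^ n : ℝ)⁻¹ •
        ∫ ξ, Complex.exp (Complex.I * (⟪x, ξ⟫_ℝ : ℂ)) * h ξ := by
  have h1 : schwartzFourierInv n h x =
      𝓕⁻ (fun ξ : Rn n => h ((2 * Real.pi) • ξ)) x := by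
    have : schwartzFourierInv n h x = (𝓕⁻
      (SchwartzMap.compCLMOfContinuousLinearEquiv ℂ (dilation n twoPi) h)) x := rfl
    rw [this, SchwartzMap.fourierInv_coe]
    rfl
  have h2 := Measure.integral_comp_smul (volume : Measure (Rn n))
    (fun ξ : Rn n => Complex.exp (Complex.I * (⟪x, ξ⟫_ℝ : ℂ)) * h ξ) (2 * Real.pi)
  have h3 : |((2 * Real.pi : ℝ) ^ n)⁻¹| = ((2 * Real.pi : ℝ) ^ n)⁻¹ :=
    abs_of_pos (by positivity)
  rw [finrank_euclideanSpace_fin, h3] at h2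
  rw [h1, ← h2, Real.fourierInv_eq']
  refine integral_congr_ae (Filter.Eventually.of_forall fun ξ => ?_)
  simp only [inner_smul_right, smul_eq_mul, real_inner_comm ξ x]
  congr 2
  push_cast
  ring

/-- The Fourier transform of a tempered distribution, by duality. -/
def distFourier {n : ℕ} : 𝓢'(Rn n, ℂ) →L[ℂ] 𝓢'(Rn n, ℂ) :=
  PointwiseConvergenceCLM.precomp ℂ (schwartzFourier n)

/-- The inverse Fourier transform of a tempered distribution, by duality. -/
def distFourierInv {n : ℕ} : 𝓢'(Rn n, ℂ) →L[ℂ] 𝓢'(Rn n, ℂ) :=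
  PointwiseConvergenceCLM.precomp ℂ (schwartzFourierInv n)

/-! ### Tempered distributions that are functions, and their weighted Lebesgue norms -/

/-- The tempered distribution `T` is (given by integration against) the measurable function `g`.
Such a `g` is unique up to equality almost everywhere. -/
def IsGivenBy {n : ℕ} (T : 𝓢'(Rn n, ℂ)) (g : Rn n → ℂ) : Prop :=
  AEStronglyMeasurable g volume ∧
    ∀ φ : 𝓢(Rn n, ℂ), Integrable (fun x => g x * φ x) volume ∧ T φ = ∫ x, g x * φ x

/-- The norm `‖T‖_{L^p_s} = ‖⟨·⟩^s T‖_{L^p}` of a tempered distribution `T`; it is `∞` if `T` is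
not a function. (The infimum ranges over the almost everywhere equal functions that give `T`.) -/
def weightedLpNorm {n : ℕ} (p : ℝ≥0∞) (s : ℝ) (T : 𝓢'(Rn n, ℂ)) : ℝ≥0∞ :=
  ⨅ (g : Rn n → ℂ) (_ : IsGivenBy T g), eLpNorm (fun x => (bracket x ^ s : ℝ) • g x) p volume

/-! ### The two families of spaces -/

/-- The norm `‖f‖_{𝓕L^q_s} = ‖⟨·⟩^s f̂‖_{L^q}`, with value `∞` outside of `𝓕L^q_s(ℝⁿ)`. -/
def flNorm {n : ℕ} (q : ℝ≥0∞) (s : ℝ) (f : 𝓢'(Rn n, ℂ)) : ℝ≥0∞ :=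
  weightedLpNorm q s (distFourier f)

/-- The lattice point `k ∈ ℤⁿ` as an element of `ℝⁿ`. -/
def latticePoint {n : ℕ} (k : Fin n → ℤ) : Rn n := WithLp.toLp 2 fun i => (k i : ℝ)

/-- `φ` is a Schwartz function with support in `[-1,1]ⁿ` whose integer translates sum to `1`. -/
structure IsWindow {n : ℕ} (φ : 𝓢(Rn n, ℂ)) : Prop where
  tsupport_subset : tsupport φ ⊆ {ξ | ∀ i, ξ i ∈ Set.Icc (-1 : ℝ) 1}
  hasSum_one : ∀ ξ, HasSum (fun k : Fin n → ℤ => φ (ξ - latticePoint k)) 1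

/-- The frequency localisation `φ(D - k) f = 𝓕⁻¹(φ(· - k) f̂)`. -/
def freqLocal {n : ℕ} (φ : 𝓢(Rn n, ℂ)) (k : Fin n → ℤ) (f : 𝓢'(Rn n, ℂ)) : 𝓢'(Rn n, ℂ) :=
  distFourierInv
    (TemperedDistribution.smulLeftCLM ℂ (fun ξ => φ (ξ - latticePoint k)) (distFourier f))

open Classical in
/-- The norm `‖f‖_{M^{p,q}_s} = (∑_k ⟨k⟩^{sq} ‖φ(D-k)f‖_{L^p}^q)^{1/q}` (a supremum if `q = ∞`)
with respect to the window `φ`, with value `∞` outside of `M^{p,q}_s(ℝⁿ)`. -/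
def modNorm {n : ℕ} (φ : 𝓢(Rn n, ℂ)) (p q : ℝ≥0∞) (s : ℝ) (f : 𝓢'(Rn n, ℂ)) : ℝ≥0∞ :=
  if q = ∞ then
    ⨆ k : Fin n → ℤ,
      ENNReal.ofReal (bracket (latticePoint k) ^ s) * weightedLpNorm p 0 (freqLocal φ k f)
  else
    (∑' k : Fin n → ℤ,
      ENNReal.ofReal (bracket (latticePoint k) ^ (s * q.toReal)) *
        weightedLpNorm p 0 (freqLocal φ k f) ^ q.toReal) ^ (1 / q.toReal)

/-- The space of all tempered distributions for which the norm `N` is finite; `space (flNorm q s)` is the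
Fourier--Wermer space `𝓕L^q_s(ℝⁿ)`. -/
def space {n : ℕ} (N : 𝓢'(Rn n, ℂ) → ℝ≥0∞) : Set 𝓢'(Rn n, ℂ) := {f | N f < ∞}

/-- The modulation space `M^{p,q}_s(ℝⁿ)`. -/
def Mod {n : ℕ} (φ : 𝓢(Rn n, ℂ)) (p q : ℝ≥0∞) (s : ℝ) : Set 𝓢'(Rn n, ℂ) :=
  space (modNorm φ p q s)

/-! ### Closed ideals -/

/-- `h` is the pointwise product of `f` and `g`, all three being functions. -/
def IsPointwiseProduct {n : ℕ} (f g h : 𝓢'(Rn n, ℂ)) : Prop :=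
  ∃ a b : Rn n → ℂ, IsGivenBy f a ∧ IsGivenBy g b ∧ IsGivenBy h (fun x => a x * b x)

/-- `I` is an ideal in `X`: a linear subspace of `X` such that for `f ∈ X` and `g ∈ I` the
pointwise product `f g` exists and belongs to `I`. -/
structure IsIdealIn {n : ℕ} (X I : Set 𝓢'(Rn n, ℂ)) : Prop where
  subset : I ⊆ X
  isLinearSubspace : ∃ V : Submodule ℂ 𝓢'(Rn n, ℂ), (V : Set 𝓢'(Rn n, ℂ)) = I
  mul_mem : ∀ f ∈ X, ∀ g ∈ I, ∃ h ∈ I, IsPointwiseProduct f g h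

/-- The closure of `S` in the space normed by `N`. -/
def normClosure {n : ℕ} (N : 𝓢'(Rn n, ℂ) → ℝ≥0∞) (S : Set 𝓢'(Rn n, ℂ)) : Set 𝓢'(Rn n, ℂ) :=
  {f | f ∈ space N ∧ ∀ ε : ℝ≥0∞, 0 < ε → ∃ g ∈ S, N (f - g) < ε}

/-- The set of all closed ideals in the space normed by `N`. -/
def closedIdeals {n : ℕ} (N : 𝓢'(Rn n, ℂ) → ℝ≥0∞) : Set (Set 𝓢'(Rn n, ℂ)) :=
  {I | IsIdealIn (space N) I ∧ normClosure N I ⊆ I}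

end ModulationIdeals

end

/-!
The theorem is an instance of a general fact about a commutative normed algebra `A` and a normed
`A`-module `M ⊆ A` which is continuously and densely embedded in `A` (compare the ideal theorem for
Segal algebras). Suppose that there are `u_m ∈ M` such that `u_m g → g` in `M` for `g ∈ M`, and such
that multiplication by `u_m` is bounded on `A` uniformly in `m`. Then intersection with `M` and
closure in `A` are mutually inverse maps between the closed ideals of `A` and those of `M`:

* if `g` in a closed ideal `J` of `M` tends to `f ∈ M` in the norm of `A`, then `u_m g ∈ J` tends to
  `u_m f` in the norm of `M`, because `M` is an `A`-module and `u_m ∈ M`; and `u_m f` tends to `f`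
  in `M`, so that `f ∈ J`;
* if `f` lies in a closed ideal `I` of `A`, then `u_m f ∈ I ∩ M` is close to `f` in `A`, as is seen
  by approximating `f` by an element `g` of `M`.

These hypotheses form the structure `IsSegalPair`, the general fact is proved from it in the
namespace of that name, and `isSegalPair` verifies them for `A = 𝓕L^q_s` and `M = M^{p,q}_s`.
Distributions are studied through their Fourier transforms, which are integrable functions: either
`q = 1` and `s ≥ 0`, or `s > n / q'`, and then `L^q_s ⊆ L¹` by Hölder's inequality (`Admissible`).
A pointwise product corresponds to a convolution of Fourier transforms.

* Embedding (`exists_fourier_of_modNorm`): the Hausdorff–Young inequality bounds the `L^{p'}` norm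
  of a localised piece `φ(· - k) f̂`; since the pieces live on balls of a fixed size, this bounds the
  `L^q` norm for `q ≤ p'`, and the pieces have bounded overlap. Hausdorff–Young is proved by
  Marcinkiewicz interpolation between `L¹ → L^∞` and `L² → L²`.
* Algebra (`exists_LN_conv_le`): Young's inequality for the weight `⟨ξ⟩^s`, which is subadditive up
  to a constant.
* Module (`exists_modNormHat_conv_le`): the localisation of `f g` at `k` is controlled by the
  discrete convolution of the localised norms of `g` with the masses of `f̂` near lattice points
  (`exists_eLpNorm_win_conv_le`), to which the weighted Young inequality on `ℤⁿ` applies.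
* Approximate units (`tendsto_modNormHat_mollifier`): the Fourier transform of `u_m` is a multiple
  of a mollifier `κ_m`, and `κ_m * F → F` in the modulation norm by dominated convergence, first in
  `ℝⁿ` for a single localisation and then over the lattice.
* Density (`exists_schwartz_approx`): compactly supported smooth functions are dense in `L^q_s`.
-/

namespace ModulationIdeals

/-! ### Weighted Lebesgue norms of nonnegative functions -/

theorem one_le_bracket {n : ℕ} (x : Rn n) : 1 ≤ bracket x := by
  rw [bracket, Real.one_le_sqrt]
  nlinarith [sq_nonneg ‖x‖]

theorem bracket_pos {n : ℕ} (x : Rn n) : 0 < bracket x :=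
  lt_of_lt_of_le one_pos (one_le_bracket x)

theorem continuous_bracket {n : ℕ} : Continuous (bracket : Rn n → ℝ) := by
  unfold bracket
  fun_prop

theorem bracket_add_le {n : ℕ} (x y : Rn n) : bracket (x + y) ≤ bracket x + bracket y := by
  have h1 : ‖y‖ ≤ bracket y := Real.le_sqrt_of_sq_le (by linarith)
  have h2 : ‖x‖ ≤ bracket x := Real.le_sqrt_of_sq_le (by linarith)
  have h3 : bracket x ^ 2 = 1 + ‖x‖ ^ 2 := Real.sq_sqrt (by positivity)
  have h4 := norm_add_le x y
  have hx := (bracket_pos x).le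
  have : bracket (x + y) ≤ bracket x + ‖y‖ := by
    refine Real.sqrt_le_iff.2 ⟨by positivity, ?_⟩
    have h5 : ‖x + y‖ ^ 2 ≤ (‖x‖ + ‖y‖) ^ 2 := by gcongr
    nlinarith [mul_le_mul_of_nonneg_right h2 (norm_nonneg y)]
  linarith

/-- The weight `⟨x⟩^s` as an extended nonnegative real. -/
noncomputable def wt {n : ℕ} (s : ℝ) (x : Rn n) : ℝ≥0∞ := ENNReal.ofReal (bracket x ^ s)

theorem one_le_wt {n : ℕ} {s : ℝ} (hs : 0 ≤ s) (x : Rn n) : 1 ≤ wt s x := by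
  rw [wt, ENNReal.one_le_ofReal]
  exact Real.one_le_rpow (one_le_bracket x) hs

theorem wt_ne_top {n : ℕ} (s : ℝ) (x : Rn n) : wt s x ≠ ∞ := ENNReal.ofReal_ne_top

theorem wt_ne_zero {n : ℕ} (s : ℝ) (x : Rn n) : wt s x ≠ 0 := by
  rw [wt, ne_eq, ENNReal.ofReal_eq_zero, not_le]
  exact Real.rpow_pos_of_pos (bracket_pos x) s

theorem continuous_bracket_rpow {n : ℕ} (s : ℝ) : Continuous (fun x : Rn n => bracket x ^ s) :=
  continuous_bracket.rpow_const fun x => Or.inl (bracket_pos x).ne'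

theorem measurable_wt {n : ℕ} (s : ℝ) : Measurable (wt s : Rn n → ℝ≥0∞) :=
  (continuous_bracket_rpow s).measurable.ennreal_ofReal

theorem wt_add_le {n : ℕ} {s : ℝ} (hs : 0 ≤ s) (x y : Rn n) :
    wt s (x + y) ≤ ENNReal.ofReal (2 ^ s) * (wt s x + wt s y) := by
  have hx := (bracket_pos x).le
  have hy := (bracket_pos y).le
  have hxs := Real.rpow_nonneg hx s
  have hys := Real.rpow_nonneg hy s
  simp only [wt]
  rw [← ENNReal.ofReal_add hxs hys, ← ENNReal.ofReal_mul (by positivity)]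
  apply ENNReal.ofReal_le_ofReal
  rcases le_total (bracket x) (bracket y) with h | h
  · calc bracket (x + y) ^ s ≤ (2 * bracket y) ^ s := by
          refine Real.rpow_le_rpow (bracket_pos _).le ?_ hs
          linarith [bracket_add_le x y]
      _ = 2 ^ s * bracket y ^ s := Real.mul_rpow (by norm_num) hy
      _ ≤ _ := by gcongr; linarith
  · calc bracket (x + y) ^ s ≤ (2 * bracket x) ^ s := by
          refine Real.rpow_le_rpow (bracket_pos _).le ?_ hs
          linarith [bracket_add_le x y]
      _ = 2 ^ s * bracket x ^ s := Real.mul_rpow (by norm_num) hx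
      _ ≤ _ := by gcongr; linarith

theorem wt_add_le_mul {n : ℕ} {s : ℝ} (hs : 0 ≤ s) (x y : Rn n) :
    wt s (x + y) ≤ ENNReal.ofReal (2 ^ s) * wt s x * wt s y := by
  have hx := one_le_bracket x
  have hy := one_le_bracket y
  simp only [wt]
  rw [← ENNReal.ofReal_mul (by positivity), ← ENNReal.ofReal_mul (by positivity),
    ← Real.mul_rpow (by norm_num) (by linarith), ← Real.mul_rpow (by nlinarith) (by linarith)]
  apply ENNReal.ofReal_le_ofReal
  refine Real.rpow_le_rpow (bracket_pos _).le ?_ hs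
  nlinarith [bracket_add_le x y]

/-- A weight varies by at most a constant factor on balls of a fixed radius. -/
theorem exists_wt_le {n : ℕ} {s : ℝ} (hs : 0 ≤ s) (R : ℝ) :
    ∃ C : ℝ≥0∞, C ≠ ∞ ∧ ∀ x y : Rn n, ‖x - y‖ ≤ R → wt s x ≤ C * wt s y := by
  refine ⟨ENNReal.ofReal (2 ^ s) * ENNReal.ofReal (Real.sqrt (1 + R ^ 2) ^ s),
    by finiteness, fun x y h => ?_⟩
  have h1 := wt_add_le_mul hs (x - y) y
  rw [sub_add_cancel] at h1
  refine h1.trans ?_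
  gcongr
  refine ENNReal.ofReal_le_ofReal (Real.rpow_le_rpow (bracket_pos _).le ?_ hs)
  unfold bracket
  gcongr

/-- The norm `(∫ f^r dμ)^{1/r}` of an extended nonnegative function. -/
noncomputable def LN {α : Type*} [MeasurableSpace α] (r : ℝ) (μ : Measure α) (f : α → ℝ≥0∞) :
    ℝ≥0∞ :=
  (∫⁻ x, f x ^ r ∂μ) ^ (1 / r)

section LN

variable {α : Type*} [MeasurableSpace α] {μ : Measure α} {r : ℝ}

theorem LN_rpow (hr : 1 ≤ r) (f : α → ℝ≥0∞) : LN r μ f ^ r = ∫⁻ x, f x ^ r ∂μ := by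
  rw [LN, ← ENNReal.rpow_mul, one_div, inv_mul_cancel₀ (by linarith), ENNReal.rpow_one]

theorem LN_mono_ae (hr : 1 ≤ r) {f g : α → ℝ≥0∞} (h : ∀ᵐ x ∂μ, f x ≤ g x) :
    LN r μ f ≤ LN r μ g := by
  unfold LN
  refine ENNReal.rpow_le_rpow (lintegral_mono_ae ?_) (by positivity)
  filter_upwards [h] with x hx
  exact ENNReal.rpow_le_rpow hx (by linarith)

theorem LN_mono (hr : 1 ≤ r) {f g : α → ℝ≥0∞} (h : ∀ x, f x ≤ g x) : LN r μ f ≤ LN r μ g :=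
  LN_mono_ae hr (.of_forall h)

theorem LN_add_le (hr : 1 ≤ r) {f g : α → ℝ≥0∞} (hf : AEMeasurable f μ) (hg : AEMeasurable g μ) :
    LN r μ (fun x => f x + g x) ≤ LN r μ f + LN r μ g :=
  ENNReal.lintegral_Lp_add_le hf hg hr

theorem LN_const_mul (hr : 1 ≤ r) {C : ℝ≥0∞} (hC : C ≠ ∞) (f : α → ℝ≥0∞) :
    LN r μ (fun x => C * f x) = C * LN r μ f := by
  have h0 : 0 ≤ r := by linarith
  unfold LN
  simp_rw [ENNReal.mul_rpow_of_nonneg _ _ h0]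
  rw [lintegral_const_mul' _ _ (by finiteness), ENNReal.mul_rpow_of_nonneg _ _ (by positivity),
    ← ENNReal.rpow_mul, mul_one_div_cancel (by linarith), ENNReal.rpow_one]

theorem LN_one (f : α → ℝ≥0∞) : LN 1 μ f = ∫⁻ x, f x ∂μ := by simp [LN]

theorem LN_lt_top_iff (hr : 1 ≤ r) {f : α → ℝ≥0∞} : LN r μ f < ∞ ↔ ∫⁻ x, f x ^ r ∂μ < ∞ := by
  rw [LN, ENNReal.rpow_lt_top_iff_of_pos (by positivity)]

theorem eLpNorm_eq_LN {E : Type*} [NormedAddCommGroup E] {q : ℝ≥0∞} (h1 : 1 ≤ q) (h2 : q ≠ ∞)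
    (f : α → E) : eLpNorm f q μ = LN q.toReal μ (fun x => ‖f x‖ₑ) :=
  eLpNorm_eq_lintegral_rpow_enorm_toReal (zero_lt_one.trans_le h1).ne' h2

/-- Jensen's inequality for the power `r`, on a measure space of arbitrary total mass. -/
theorem lintegral_rpow_le (hr : 1 ≤ r) {f : α → ℝ≥0∞} (hf : AEMeasurable f μ) :
    (∫⁻ x, f x ∂μ) ^ r ≤ μ Set.univ ^ (r - 1) * ∫⁻ x, f x ^ r ∂μ := by
  rcases hr.eq_or_lt with rfl | hr1
  · simp
  have hc := Real.HolderConjugate.conjExponent hr1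
  have h := ENNReal.lintegral_mul_le_Lp_mul_Lq μ hc hf (aemeasurable_const (b := (1 : ℝ≥0∞)))
  simp only [Pi.mul_apply, mul_one, ENNReal.one_rpow, lintegral_const, one_mul] at h
  refine (ENNReal.rpow_le_rpow h (by linarith)).trans_eq ?_
  rw [ENNReal.mul_rpow_of_nonneg _ _ (by linarith), ← ENNReal.rpow_mul, ← ENNReal.rpow_mul,
    one_div_mul_cancel (by linarith), ENNReal.rpow_one, mul_comm]
  congr 2
  have := hc.sub_one_mul_conj
  have := hc.symm.ne_zero
  field_simp
  linarith

end LN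

section Young

set_option linter.unusedSectionVars false

variable {G : Type*} [AddCommGroup G] [MeasurableSpace G] [MeasurableAdd₂ G] [MeasurableNeg G]
  {μ : Measure G} [SFinite μ] [μ.IsAddLeftInvariant] [μ.IsNegInvariant] {r : ℝ}

theorem aemeasurable_comp_sub_left {f : G → ℝ≥0∞} (hf : AEMeasurable f μ) (x : G) :
    AEMeasurable (fun y => f (x - y)) μ :=
  hf.comp_quasiMeasurePreserving (μ.measurePreserving_sub_left x).quasiMeasurePreserving

theorem aemeasurable_conv_integrand {f g : G → ℝ≥0∞} (hf : AEMeasurable f μ)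
    (hg : AEMeasurable g μ) :
    AEMeasurable (fun z : G × G => f z.2 * g (z.1 - z.2)) (μ.prod μ) :=
  (hf.comp_quasiMeasurePreserving Measure.quasiMeasurePreserving_snd).mul
    (hg.comp_quasiMeasurePreserving (quasiMeasurePreserving_sub_of_right_invariant μ μ))

theorem aemeasurable_conv {f g : G → ℝ≥0∞} (hf : AEMeasurable f μ) (hg : AEMeasurable g μ) :
    AEMeasurable (fun x => ∫⁻ y, f y * g (x - y) ∂μ) μ :=
  (aemeasurable_conv_integrand hf hg).lintegral_prod_right'

/-- Young's inequality `L¹ * L^r ⊆ L^r`. -/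
theorem LN_conv_le (hr : 1 ≤ r) {f g : G → ℝ≥0∞} (hf : AEMeasurable f μ) (hg : AEMeasurable g μ) :
    LN r μ (fun x => ∫⁻ y, f y * g (x - y) ∂μ) ≤ (∫⁻ y, f y ∂μ) * LN r μ g := by
  have h0 : 0 ≤ r := by linarith
  -- Jensen's inequality for the measure with density `f`
  have key : ∀ x, (∫⁻ y, f y * g (x - y) ∂μ) ^ r ≤
      (∫⁻ y, f y ∂μ) ^ (r - 1) * ∫⁻ y, f y * g (x - y) ^ r ∂μ := by
    intro x
    have hgx := aemeasurable_comp_sub_left hg x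
    have hac := withDensity_absolutelyContinuous μ f
    have h := lintegral_rpow_le hr (hgx.mono_ac hac)
    rwa [lintegral_withDensity_eq_lintegral_mul₀ hf hgx,
      lintegral_withDensity_eq_lintegral_mul₀ hf (hgx.pow_const r), withDensity_apply _ .univ,
      setLIntegral_univ] at h
  have h2 : ∫⁻ x, (∫⁻ y, f y * g (x - y) ∂μ) ^ r ∂μ ≤ (∫⁻ y, f y ∂μ) ^ r * ∫⁻ y, g y ^ r ∂μ := by
    refine (lintegral_mono key).trans ?_
    have hgr := hg.pow_const r
    rw [lintegral_const_mul'' _ (aemeasurable_conv hf hgr),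
      lintegral_lintegral_swap (aemeasurable_conv_integrand hf hgr)]
    have : ∀ y, ∫⁻ x, f y * g (x - y) ^ r ∂μ = f y * ∫⁻ x, g x ^ r ∂μ := by
      intro y
      rw [lintegral_const_mul'', lintegral_sub_right_eq_self (fun x => g x ^ r) y]
      exact hgr.comp_quasiMeasurePreserving (measurePreserving_sub_right μ y).quasiMeasurePreserving
    simp_rw [this]
    rw [lintegral_mul_const'' _ hf, ← mul_assoc]
    gcongr
    rcases eq_or_ne (∫⁻ y, f y ∂μ) 0 with h | h
    · simp [h]
    rcases eq_or_ne (∫⁻ y, f y ∂μ) ∞ with h' | h'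
    · rw [h', ENNReal.top_rpow_of_pos (y := r) (by linarith)]
      exact le_top
    · conv_lhs => rw [← ENNReal.rpow_one (∫⁻ y, f y ∂μ), ← ENNReal.rpow_mul,
        ← ENNReal.rpow_add _ _ h h']
      simp
  refine (ENNReal.rpow_le_rpow h2 (by positivity : 0 ≤ 1 / r)).trans_eq ?_
  rw [ENNReal.mul_rpow_of_nonneg _ _ (by positivity), ← ENNReal.rpow_mul,
    mul_one_div_cancel (by linarith), ENNReal.rpow_one, LN]

theorem lintegral_conv_comm (f g : G → ℝ≥0∞) (x : G) :
    ∫⁻ y, f y * g (x - y) ∂μ = ∫⁻ y, g y * f (x - y) ∂μ := by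
  rw [← lintegral_sub_left_eq_self (fun y => f y * g (x - y)) x]
  simp [mul_comm]

/-- A weight `W` with `W (x + y) ≤ C (W x + W y)` satisfies the weighted Young inequality that makes
a weighted Lebesgue space inside `L¹` a convolution algebra. -/
theorem LN_weight_conv_le (hr : 1 ≤ r) {W : G → ℝ≥0∞} {C : ℝ≥0∞} (hC : C ≠ ∞)
    (hW : ∀ x y, W (x + y) ≤ C * (W x + W y)) (hWm : Measurable W)
    (hWt : ∀ x, W x ≠ ∞) {f g : G → ℝ≥0∞}
    (hf : AEMeasurable f μ) (hg : AEMeasurable g μ) :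
    LN r μ (fun x => W x * ∫⁻ y, f y * g (x - y) ∂μ) ≤
      C * (LN r μ (fun x => W x * f x) * ∫⁻ x, g x ∂μ +
        (∫⁻ x, f x ∂μ) * LN r μ (fun x => W x * g x)) := by
  have hWf : AEMeasurable (fun x => W x * f x) μ := hWm.aemeasurable.mul hf
  have hWg : AEMeasurable (fun x => W x * g x) μ := hWm.aemeasurable.mul hg
  have key : ∀ x, W x * ∫⁻ y, f y * g (x - y) ∂μ ≤
      C * ((∫⁻ y, g y * (W (x - y) * f (x - y)) ∂μ) + ∫⁻ y, f y * (W (x - y) * g (x - y)) ∂μ) := by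
    intro x
    have hm : AEMeasurable (fun y => W y * f y * g (x - y)) μ :=
      hWf.mul (aemeasurable_comp_sub_left hg x)
    rw [← lintegral_conv_comm (fun z => W z * f z) g, ← lintegral_add_left' hm]
    rw [← lintegral_const_mul' C _ hC, ← lintegral_const_mul' _ _ (hWt x)]
    refine lintegral_mono fun y => ?_
    have := hW y (x - y)
    rw [add_sub_cancel] at this
    calc W x * (f y * g (x - y)) ≤ C * (W y + W (x - y)) * (f y * g (x - y)) := by gcongr
      _ = _ := by ring
  refine (LN_mono hr key).trans ?_
  rw [LN_const_mul hr hC]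
  gcongr
  refine (LN_add_le hr (aemeasurable_conv hg hWf) (aemeasurable_conv hf hWg)).trans ?_
  rw [mul_comm (LN r μ _)]
  exact add_le_add (LN_conv_le hr hg hWf) (LN_conv_le hr hf hWg)

end Young

end ModulationIdeals

namespace ModulationIdeals

/-! ### Bounded overlap of balls around lattice points -/

section Lattice

variable {n : ℕ}

theorem latticePoint_add (j k : Fin n → ℤ) :
    latticePoint (j + k) = latticePoint j + latticePoint k := by
  ext i
  simp [latticePoint]

theorem latticePoint_sub (j k : Fin n → ℤ) :
    latticePoint (j - k) = latticePoint j - latticePoint k := by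
  ext i
  simp [latticePoint]

/-- A finite box of lattice points that contains those in the ball of radius `R` around `0`. -/
noncomputable def latticeBox (n : ℕ) (R : ℝ) : Finset (Fin n → ℤ) :=
  Fintype.piFinset fun _ => Finset.Icc (-⌈R⌉) ⌈R⌉

theorem mem_latticeBox {R : ℝ} {j : Fin n → ℤ} (h : ‖latticePoint j‖ ≤ R) :
    j ∈ latticeBox n R := by
  simp only [latticeBox, Fintype.mem_piFinset, Finset.mem_Icc]
  intro i
  have h1 := (PiLp.norm_apply_le (latticePoint j) i).trans h
  rw [show (latticePoint j) i = (j i : ℝ) from rfl, Real.norm_eq_abs, abs_le] at h1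
  have h2 := Int.le_ceil R
  constructor
  · have : (-(⌈R⌉ : ℤ) : ℝ) ≤ j i := by linarith
    exact_mod_cast this
  · have : ((j i : ℤ) : ℝ) ≤ ⌈R⌉ := by linarith
    exact_mod_cast this

theorem norm_sub_latticePoint_floor_le (ξ : Rn n) :
    ‖ξ - latticePoint fun i => ⌊ξ i⌋‖ ≤ Real.sqrt n := by
  rw [EuclideanSpace.norm_eq]
  apply Real.sqrt_le_sqrt
  calc _ ≤ ∑ _i : Fin n, (1 : ℝ) := by
        refine Finset.sum_le_sum fun i _ => ?_
        have h : (ξ - latticePoint fun i => ⌊ξ i⌋) i = Int.fract (ξ i) := rfl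
        rw [h, Real.norm_eq_abs, sq_abs]
        nlinarith [Int.fract_nonneg (ξ i), Int.fract_lt_one (ξ i)]
    _ = n := by simp

/-- After translation by the integer parts of `ξ`, the lattice points near `ξ` lie in a fixed
box. -/
theorem encard_near_le (R : ℝ) (ξ : Rn n) :
    {k : Fin n → ℤ | ‖ξ - latticePoint k‖ ≤ R}.encard ≤
      (latticeBox n (R + Real.sqrt n)).card := by
  set m : Fin n → ℤ := fun i => ⌊ξ i⌋
  have hsub : {k : Fin n → ℤ | ‖ξ - latticePoint k‖ ≤ R} ⊆
      (fun j => j + m) '' (latticeBox n (R + Real.sqrt n) : Set (Fin n → ℤ)) := by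
    intro k hk
    refine ⟨k - m, ?_, sub_add_cancel k m⟩
    apply mem_latticeBox
    rw [latticePoint_sub]
    have h1 := norm_sub_le_norm_sub_add_norm_sub (latticePoint k) ξ (latticePoint m)
    exact h1.trans (add_le_add (norm_sub_rev ξ _ ▸ hk) (norm_sub_latticePoint_floor_le ξ))
  refine (Set.encard_le_encard hsub).trans ((Set.encard_image_le _ _).trans ?_)
  rw [Set.encard_coe_eq_coe_finsetCard]

/-- The bound of `encard_near_le` for the number of lattice points in a ball of radius `R`. -/
noncomputable def overlap (n : ℕ) (R : ℝ) : ℝ≥0∞ := (latticeBox n (R + Real.sqrt n)).card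

theorem overlap_ne_top (R : ℝ) : overlap n R ≠ ∞ := ENNReal.natCast_ne_top _

theorem count_near_le (R : ℝ) (ξ : Rn n) :
    Measure.count {k : Fin n → ℤ | ‖ξ - latticePoint k‖ ≤ R} ≤ overlap n R := by
  rw [Measure.count_apply (Set.to_countable _).measurableSet, overlap]
  exact_mod_cast ENat.toENNReal_le.2 (encard_near_le R ξ)

/-- A sum with boundedly many nonzero terms obeys Jensen's inequality up to a constant. -/
theorem tsum_rpow_le_of_near {r : ℝ} (hr : 1 ≤ r) (R : ℝ) (ξ : Rn n) {a : (Fin n → ℤ) → ℝ≥0∞}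
    (ha : ∀ k, a k ≠ 0 → ‖ξ - latticePoint k‖ ≤ R) :
    (∑' k, a k) ^ r ≤ overlap n R ^ (r - 1) * ∑' k, a k ^ r := by
  have h := lintegral_rpow_le (μ := Measure.count.restrict {k | ‖ξ - latticePoint k‖ ≤ R}) hr
    (Measurable.of_discrete (f := a)).aemeasurable
  have hms : MeasurableSet {k : Fin n → ℤ | ‖ξ - latticePoint k‖ ≤ R} :=
    (Set.to_countable _).measurableSet
  have h1 : ∫⁻ k in {k | ‖ξ - latticePoint k‖ ≤ R}, a k ∂Measure.count = ∑' k, a k := by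
    rw [setLIntegral_eq_of_support_subset, lintegral_count]
    exact fun k hk => ha k hk
  rw [h1, Measure.restrict_apply_univ] at h
  refine h.trans ?_
  gcongr
  · exact count_near_le R ξ
  · rw [← lintegral_count]
    exact setLIntegral_le_lintegral _ _

theorem tsum_indicator_closedBall_le (R : ℝ) (ξ : Rn n) (c : ℝ≥0∞) :
    ∑' k : Fin n → ℤ, (Metric.closedBall (latticePoint k) R).indicator (fun _ => c) ξ ≤
      overlap n R * c := by
  have h1 : ∀ k : Fin n → ℤ, (Metric.closedBall (latticePoint k) R).indicator (fun _ => c) ξ =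
      {k : Fin n → ℤ | ‖ξ - latticePoint k‖ ≤ R}.indicator (fun _ => c) k := by
    intro k
    by_cases h : ‖ξ - latticePoint k‖ ≤ R
    · rw [Set.indicator_of_mem (by rwa [mem_closedBall_iff_norm]),
        Set.indicator_of_mem (by exact h)]
    · rw [Set.indicator_of_notMem (by rwa [mem_closedBall_iff_norm]),
        Set.indicator_of_notMem (by exact h)]
  simp_rw [h1]
  rw [← lintegral_count, lintegral_indicator_const (Set.to_countable _).measurableSet, mul_comm]
  gcongr
  exact count_near_le R ξ

/-- Balls of a fixed radius around the lattice points have bounded overlap. -/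
theorem tsum_setLIntegral_closedBall_le (R : ℝ) {f : Rn n → ℝ≥0∞} (hf : AEMeasurable f) :
    ∑' k : Fin n → ℤ, ∫⁻ ξ in Metric.closedBall (latticePoint k) R, f ξ ≤
      overlap n R * ∫⁻ ξ, f ξ := by
  simp_rw [← lintegral_indicator (Metric.isClosed_closedBall.measurableSet)]
  rw [← lintegral_tsum fun k => hf.indicator Metric.isClosed_closedBall.measurableSet,
    ← lintegral_const_mul' _ _ (overlap_ne_top R)]
  refine lintegral_mono fun ξ => ?_
  refine le_trans (le_of_eq ?_) (tsum_indicator_closedBall_le R ξ (f ξ))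
  rfl

theorem volume_closedBall_latticePoint (R : ℝ) (k : Fin n → ℤ) :
    volume (Metric.closedBall (latticePoint k) R) = volume (Metric.closedBall (0 : Rn n) R) :=
  Measure.addHaar_closedBall_center _ _ _

theorem lt_top_of_LN_weight_lt_top {r s : ℝ} (hr : 1 ≤ r) {b : (Fin n → ℤ) → ℝ≥0∞}
    (h : LN r Measure.count (fun k => wt s (latticePoint k) * b k) < ∞) (k : Fin n → ℤ) :
    b k < ∞ := by
  rw [LN_lt_top_iff hr, lintegral_count] at h
  have h1 := ENNReal.ne_top_of_tsum_ne_top h.ne k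
  rw [ne_eq, ENNReal.rpow_eq_top_iff_of_pos (by linarith)] at h1
  exact ENNReal.lt_top_of_mul_ne_top_right h1 (wt_ne_zero _ _)

end Lattice

/-- The conditions on the exponent `r` and the order `s ≥ 0` under which `L^r_s(ℝⁿ)` embeds into
`L¹(ℝⁿ)`. -/
structure Admissible (n : ℕ) (r s : ℝ) : Prop where
  one_le : 1 ≤ r
  nonneg : 0 ≤ s
  embedding : ∃ K : ℝ≥0∞, K ≠ ∞ ∧ ∀ f : Rn n → ℝ≥0∞, AEMeasurable f →
    ∫⁻ ξ, f ξ ≤ K * LN r volume (fun ξ => wt s ξ * f ξ)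

theorem admissible_one {n : ℕ} {s : ℝ} (hs : 0 ≤ s) : Admissible n 1 s := by
  refine ⟨le_rfl, hs, 1, ENNReal.one_ne_top, fun f _ => ?_⟩
  rw [LN_one, one_mul]
  exact lintegral_mono fun ξ => le_mul_of_one_le_left' (one_le_wt hs ξ)

/-- For `s > n / r'` the weight `⟨ξ⟩^{-s}` is in `L^{r'}`, and Hölder's inequality applies. -/
theorem admissible_of_lt {n : ℕ} {r r' s : ℝ} (h : r.HolderConjugate r') (hs : n / r' < s) :
    Admissible n r s := by
  have hr' := h.symm.pos
  have hs0 : 0 ≤ s := (div_nonneg n.cast_nonneg hr'.le).trans hs.le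
  refine ⟨h.lt.le, hs0,
    (∫⁻ ξ : Rn n, (wt s ξ)⁻¹ ^ r') ^ (1 / r'), ?_, fun f hf => ?_⟩
  · refine (ENNReal.rpow_lt_top_of_nonneg (by positivity) ?_).ne
    have hint : Integrable (fun ξ : Rn n => ((1 : ℝ) + ‖ξ‖ ^ 2) ^ (-(s * r') / 2)) := by
      apply integrable_rpow_neg_one_add_norm_sq
      rw [finrank_euclideanSpace_fin]
      rwa [div_lt_iff₀ hr'] at hs
    have := hint.lintegral_lt_top.ne
    convert this using 3 with ξ
    rw [wt, ← ENNReal.ofReal_inv_of_pos (Real.rpow_pos_of_pos (bracket_pos ξ) s),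
      ENNReal.ofReal_rpow_of_nonneg (by have := bracket_pos ξ; positivity) hr'.le]
    congr 1
    have hb : (0 : ℝ) ≤ 1 + ‖ξ‖ ^ 2 := by positivity
    rw [← Real.rpow_neg (bracket_pos ξ).le, ← Real.rpow_mul (bracket_pos ξ).le, bracket,
      Real.sqrt_eq_rpow, ← Real.rpow_mul hb]
    congr 1
    ring
  · have h1 := ENNReal.lintegral_mul_le_Lp_mul_Lq volume h.symm
      (measurable_wt (n := n) s).inv.aemeasurable ((measurable_wt s).aemeasurable.mul hf)
    refine le_trans (le_of_eq ?_) h1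
    refine lintegral_congr fun ξ => ?_
    simp only [Pi.mul_apply, Pi.inv_apply]
    rw [← mul_assoc, ENNReal.inv_mul_cancel (wt_ne_zero s ξ) (wt_ne_top s ξ), one_mul]

/-- Comparison with a sum of indicator functions of balls carries the embedding
`L^r_s(ℝⁿ) ⊆ L¹(ℝⁿ)` over to sequences on `ℤⁿ`. -/
theorem Admissible.tsum_le {n : ℕ} {r s : ℝ} (h : Admissible n r s) :
    ∃ K : ℝ≥0∞, K ≠ ∞ ∧ ∀ b : (Fin n → ℤ) → ℝ≥0∞,
      ∑' k, b k ≤ K * LN r Measure.count (fun k => wt s (latticePoint k) * b k) := by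
  obtain ⟨K, hK, hemb⟩ := h.embedding
  obtain ⟨C, hC, hwt⟩ := exists_wt_le (n := n) h.nonneg 1
  set V := volume (Metric.closedBall (0 : Rn n) 1) with hV
  have hV0 : V ≠ 0 := (Metric.measure_closedBall_pos volume 0 one_pos).ne'
  have hVt : V ≠ ∞ := measure_closedBall_lt_top.ne
  have hr := h.one_le
  have hr0 : 0 < r := by linarith
  refine ⟨V⁻¹ * (K * (overlap n 1 ^ (r - 1) * V * C ^ r) ^ (1 / r)), ?_, fun b => ?_⟩
  · have := overlap_ne_top (n := n) 1
    have : 0 ≤ r - 1 := by linarith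
    have : V⁻¹ ≠ ∞ := ENNReal.inv_ne_top.2 hV0
    finiteness
  -- the function with value `b k` on the unit ball around the lattice point `k`
  let B : Rn n → ℝ≥0∞ := fun ξ =>
    ∑' k, (Metric.closedBall (latticePoint k) 1).indicator (fun _ => b k) ξ
  have hBm : Measurable B := Measurable.tsum fun k =>
    measurable_const.indicator Metric.isClosed_closedBall.measurableSet
  have hB1 : ∫⁻ ξ, B ξ = V * ∑' k, b k := by
    rw [lintegral_tsum fun k =>
      (measurable_const.indicator Metric.isClosed_closedBall.measurableSet).aemeasurable]
    simp_rw [lintegral_indicator_const Metric.isClosed_closedBall.measurableSet,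
      volume_closedBall_latticePoint]
    rw [ENNReal.tsum_mul_right, mul_comm]
  have hB2 : LN r volume (fun ξ => wt s ξ * B ξ) ≤
      (overlap n 1 ^ (r - 1) * V * C ^ r) ^ (1 / r) *
        LN r Measure.count (fun k => wt s (latticePoint k) * b k) := by
    unfold LN
    rw [← ENNReal.mul_rpow_of_nonneg _ _ (by positivity), lintegral_count]
    refine ENNReal.rpow_le_rpow ?_ (by positivity)
    have hpt : ∀ ξ, (wt s ξ * B ξ) ^ r ≤ overlap n 1 ^ (r - 1) * ∑' k,
        (Metric.closedBall (latticePoint k) 1).indicator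
          (fun _ => C ^ r * (wt s (latticePoint k) * b k) ^ r) ξ := by
      intro ξ
      have e1 : wt s ξ * B ξ =
          ∑' k, (Metric.closedBall (latticePoint k) 1).indicator (fun _ => wt s ξ * b k) ξ := by
        rw [← ENNReal.tsum_mul_left]
        refine tsum_congr fun k => ?_
        by_cases hk : ξ ∈ Metric.closedBall (latticePoint k) 1
        · simp [Set.indicator_of_mem hk]
        · simp [Set.indicator_of_notMem hk]
      rw [e1]
      refine (tsum_rpow_le_of_near hr 1 ξ fun k hk => ?_).trans ?_
      · have := Set.mem_of_indicator_ne_zero hk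
        rwa [mem_closedBall_iff_norm] at this
      · gcongr with k
        by_cases hk : ξ ∈ Metric.closedBall (latticePoint k) 1
        · rw [Set.indicator_of_mem hk, Set.indicator_of_mem hk,
            ← ENNReal.mul_rpow_of_nonneg _ _ hr0.le, ← mul_assoc]
          gcongr
          exact hwt _ _ (by rwa [mem_closedBall_iff_norm] at hk)
        · simp [Set.indicator_of_notMem hk, hr0]
    refine (lintegral_mono hpt).trans ?_
    rw [lintegral_const_mul' _ _ (ENNReal.rpow_ne_top_of_nonneg (by linarith) (overlap_ne_top 1)),
      lintegral_tsum fun k =>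
      (measurable_const.indicator Metric.isClosed_closedBall.measurableSet).aemeasurable]
    simp_rw [lintegral_indicator_const Metric.isClosed_closedBall.measurableSet,
      volume_closedBall_latticePoint]
    rw [ENNReal.tsum_mul_right, ENNReal.tsum_mul_left]
    apply le_of_eq
    ring
  calc ∑' k, b k = V⁻¹ * ∫⁻ ξ, B ξ := by
        rw [hB1, ← mul_assoc, ENNReal.inv_mul_cancel hV0 hVt, one_mul]
    _ ≤ V⁻¹ * (K * LN r volume (fun ξ => wt s ξ * B ξ)) := by
        gcongr
        exact hemb B hBm.aemeasurable
    _ ≤ V⁻¹ * (K * ((overlap n 1 ^ (r - 1) * V * C ^ r) ^ (1 / r) *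
        LN r Measure.count (fun k => wt s (latticePoint k) * b k))) := by gcongr
    _ = _ := by ring

end ModulationIdeals

namespace ModulationIdeals

/-! ### Tempered distributions given by functions -/

section GivenBy

variable {n : ℕ}

open scoped ContDiff in
/-- A Schwartz function with compact support that equals `1` on the ball of radius `R`. -/
theorem exists_schwartz_cutoff (n : ℕ) (R : ℝ) :
    ∃ χ : 𝓢(Rn n, ℂ), HasCompactSupport χ ∧ (∀ x, ‖x‖ ≤ R → χ x = 1) ∧
      (∀ x, χ x ≠ 0 → ‖x‖ ≤ |R| + 2) ∧ ∀ x, ‖χ x‖ ≤ 1 := by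
  let f : ContDiffBump (0 : Rn n) := ⟨|R| + 1, |R| + 2, by positivity, by linarith⟩
  have h1 : HasCompactSupport (fun x => (f x : ℂ)) :=
    f.hasCompactSupport.comp_left (g := Complex.ofReal) Complex.ofReal_zero
  have h2 : ContDiff ℝ ∞ (fun x => (f x : ℂ)) := by
    have : ContDiff ℝ ∞ f := f.contDiff
    exact Complex.ofRealCLM.contDiff.comp this
  refine ⟨h1.toSchwartzMap h2, h1, fun x hx => ?_, fun x hx => ?_, fun x => ?_⟩
  · have : f x = 1 := f.one_of_mem_closedBall (by
      rw [mem_closedBall_zero_iff]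
      have := le_abs_self R
      change ‖x‖ ≤ |R| + 1
      linarith)
    change ((f x : ℝ) : ℂ) = 1
    simp [this]
  · by_contra! h
    apply hx
    have : f x = 0 := f.zero_of_le_dist (by simpa using h.le)
    change ((f x : ℝ) : ℂ) = 0
    simp [this]
  · change ‖((f x : ℝ) : ℂ)‖ ≤ 1
    rw [Complex.norm_real, Real.norm_of_nonneg f.nonneg]
    exact f.le_one

theorem IsGivenBy.congr_ae {T : 𝓢'(Rn n, ℂ)} {g g' : Rn n → ℂ} (h : IsGivenBy T g)
    (hg : g =ᵐ[volume] g') : IsGivenBy T g' := by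
  refine ⟨h.1.congr hg, fun φ => ?_⟩
  have h1 : (fun x => g x * φ x) =ᵐ[volume] fun x => g' x * φ x := by
    filter_upwards [hg] with x hx
    rw [hx]
  exact ⟨(h.2 φ).1.congr h1, (h.2 φ).2.trans (integral_congr_ae h1)⟩

theorem IsGivenBy.locallyIntegrable {T : 𝓢'(Rn n, ℂ)} {g : Rn n → ℂ} (h : IsGivenBy T g) :
    LocallyIntegrable g := by
  rw [locallyIntegrable_iff]
  intro K hK
  obtain ⟨R, hR⟩ := hK.isBounded.exists_norm_le
  obtain ⟨χ, -, hχ, -⟩ := exists_schwartz_cutoff n R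
  refine ((h.2 χ).1.integrableOn (s := K)).congr_fun (fun x hx => ?_) hK.measurableSet
  simp [hχ x (hR x hx)]

open scoped ContDiff in
theorem IsGivenBy.ae_eq {T : 𝓢'(Rn n, ℂ)} {g g' : Rn n → ℂ} (h : IsGivenBy T g)
    (h' : IsGivenBy T g') : g =ᵐ[volume] g' := by
  refine ae_eq_of_integral_contDiff_smul_eq h.locallyIntegrable h'.locallyIntegrable
    fun u hu hc => ?_
  have h1 : HasCompactSupport (fun x => (u x : ℂ)) :=
    hc.comp_left (g := Complex.ofReal) Complex.ofReal_zero
  have h2 : ContDiff ℝ ∞ (fun x => (u x : ℂ)) := Complex.ofRealCLM.contDiff.comp hu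
  have h3 := (h.2 (h1.toSchwartzMap h2)).2.symm.trans (h'.2 (h1.toSchwartzMap h2)).2
  simpa [mul_comm] using h3

theorem IsGivenBy.ext {T S : 𝓢'(Rn n, ℂ)} {g : Rn n → ℂ} (h : IsGivenBy T g)
    (h' : IsGivenBy S g) : T = S := by
  ext φ
  rw [(h.2 φ).2, (h'.2 φ).2]

theorem IsGivenBy.add {T S : 𝓢'(Rn n, ℂ)} {f g : Rn n → ℂ} (hf : IsGivenBy T f)
    (hg : IsGivenBy S g) : IsGivenBy (T + S) (fun x => f x + g x) := by
  refine ⟨hf.1.add hg.1, fun φ => ?_⟩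
  simp_rw [add_mul]
  refine ⟨(hf.2 φ).1.add (hg.2 φ).1, ?_⟩
  rw [integral_add (hf.2 φ).1 (hg.2 φ).1, ← (hf.2 φ).2, ← (hg.2 φ).2]
  rfl

theorem IsGivenBy.smul {T : 𝓢'(Rn n, ℂ)} {f : Rn n → ℂ} (c : ℂ) (hf : IsGivenBy T f) :
    IsGivenBy (c • T) (fun x => c * f x) := by
  refine ⟨hf.1.const_mul c, fun φ => ?_⟩
  simp_rw [mul_assoc]
  refine ⟨(hf.2 φ).1.const_mul c, ?_⟩
  rw [integral_const_mul, ← (hf.2 φ).2]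
  rfl

theorem IsGivenBy.sub {T S : 𝓢'(Rn n, ℂ)} {f g : Rn n → ℂ} (hf : IsGivenBy T f)
    (hg : IsGivenBy S g) : IsGivenBy (T - S) (fun x => f x - g x) := by
  have h := hf.add (hg.smul (-1))
  rw [neg_one_smul ℂ S, ← sub_eq_add_neg] at h
  simpa [← sub_eq_add_neg] using h

theorem isGivenBy_zero : IsGivenBy (0 : 𝓢'(Rn n, ℂ)) (fun _ => 0) := by
  refine ⟨aestronglyMeasurable_const, fun φ => ?_⟩
  simp

theorem IsGivenBy.smulLeft {T : 𝓢'(Rn n, ℂ)} {f : Rn n → ℂ} (hf : IsGivenBy T f) {m : Rn n → ℂ}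
    (hm : m.HasTemperateGrowth) :
    IsGivenBy (TemperedDistribution.smulLeftCLM ℂ m T) (fun x => m x * f x) := by
  refine ⟨hm.1.continuous.aestronglyMeasurable.mul hf.1, fun φ => ?_⟩
  have h := hf.2 (SchwartzMap.smulLeftCLM ℂ m φ)
  have e : (fun x => f x * SchwartzMap.smulLeftCLM ℂ m φ x) = fun x => m x * f x * φ x := by
    ext x
    rw [SchwartzMap.smulLeftCLM_apply_apply hm]
    simp only [smul_eq_mul]
    ring
  rw [e] at h
  exact h

/-- Every element of `L^p` gives a tempered distribution. -/
theorem exists_isGivenBy {p : ℝ≥0∞} (hp : 1 ≤ p) {g : Rn n → ℂ} (hg : MemLp g p) :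
    ∃ T : 𝓢'(Rn n, ℂ), IsGivenBy T g := by
  have : Fact (1 ≤ p) := ⟨hp⟩
  refine ⟨(hg.toLp g : Lp ℂ p), hg.1, fun φ => ⟨?_, ?_⟩⟩
  · have := ENNReal.HolderConjugate.inv_one_sub_inv' hp
    exact hg.integrable_mul (q := (1 - p⁻¹)⁻¹) (φ.memLp _)
  · rw [Lp.toTemperedDistribution_apply]
    refine integral_congr_ae ?_
    filter_upwards [hg.coeFn_toLp] with x hx
    rw [hx, smul_eq_mul, mul_comm]

theorem schwartzFourier_schwartzFourierInv (ψ : 𝓢(Rn n, ℂ)) :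
    schwartzFourier n (schwartzFourierInv n ψ) = ψ := by
  ext x
  have h : schwartzFourier n (schwartzFourierInv n ψ) x =
      (𝓕 (𝓕⁻ (SchwartzMap.compCLMOfContinuousLinearEquiv ℂ (dilation n twoPi) ψ)))
        (dilation n twoPi⁻¹ x) := rfl
  have h2 : dilation n twoPi (dilation n twoPi⁻¹ x) = x := smul_inv_smul twoPi x
  rw [h, FourierTransform.fourier_fourierInv_eq,
    SchwartzMap.compCLMOfContinuousLinearEquiv_apply, Function.comp_apply, h2]

theorem schwartzFourierInv_schwartzFourier (ψ : 𝓢(Rn n, ℂ)) :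
    schwartzFourierInv n (schwartzFourier n ψ) = ψ := by
  have h : schwartzFourierInv n (schwartzFourier n ψ) =
      𝓕⁻ (SchwartzMap.compCLMOfContinuousLinearEquiv ℂ (dilation n twoPi)
        (SchwartzMap.compCLMOfContinuousLinearEquiv ℂ (dilation n twoPi⁻¹) (𝓕 ψ))) := rfl
  have h2 : SchwartzMap.compCLMOfContinuousLinearEquiv ℂ (dilation n twoPi)
        (SchwartzMap.compCLMOfContinuousLinearEquiv ℂ (dilation n twoPi⁻¹) (𝓕 ψ)) = 𝓕 ψ := by
    ext x
    have h3 : dilation n twoPi⁻¹ (dilation n twoPi x) = x := inv_smul_smul twoPi x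
    simp only [SchwartzMap.compCLMOfContinuousLinearEquiv_apply, Function.comp_apply, h3]
  rw [h, h2, FourierTransform.fourierInv_fourier_eq]

theorem distFourier_apply (T : 𝓢'(Rn n, ℂ)) (ψ : 𝓢(Rn n, ℂ)) :
    distFourier T ψ = T (schwartzFourier n ψ) := rfl

theorem distFourierInv_apply (T : 𝓢'(Rn n, ℂ)) (ψ : 𝓢(Rn n, ℂ)) :
    distFourierInv T ψ = T (schwartzFourierInv n ψ) := rfl

theorem distFourierInv_distFourier (T : 𝓢'(Rn n, ℂ)) : distFourierInv (distFourier T) = T := by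
  ext ψ
  rw [distFourierInv_apply, distFourier_apply, schwartzFourier_schwartzFourierInv]

theorem distFourier_distFourierInv (T : 𝓢'(Rn n, ℂ)) : distFourier (distFourierInv T) = T := by
  ext ψ
  rw [distFourier_apply, distFourierInv_apply, schwartzFourierInv_schwartzFourier]

/-! ### The inverse Fourier transform of integrable functions -/

/-- The inverse Fourier transform `(2π)⁻ⁿ ∫ F(ξ) e^{i x·ξ} dξ` of an integrable function. -/
noncomputable def invFT (F : Rn n → ℂ) (x : Rn n) : ℂ :=
  ((2 * Real.pi : ℝ) ^ n : ℝ)⁻¹ • ∫ ξ, Complex.exp (Complex.I * (⟪x, ξ⟫_ℝ : ℂ)) * F ξ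

theorem norm_exp_I_mul (t : ℝ) : ‖Complex.exp (Complex.I * (t : ℂ))‖ = 1 := by
  rw [mul_comm, Complex.norm_exp_ofReal_mul_I]

theorem integrable_exp_mul {F : Rn n → ℂ} (hF : Integrable F) (x : Rn n) :
    Integrable (fun ξ => Complex.exp (Complex.I * (⟪x, ξ⟫_ℝ : ℂ)) * F ξ) := by
  refine hF.bdd_mul (c := 1) (Continuous.aestronglyMeasurable (by fun_prop))
    (.of_forall fun ξ => ?_)
  rw [norm_exp_I_mul]

theorem invFT_schwartz (F : 𝓢(Rn n, ℂ)) : invFT F = schwartzFourierInv n F := by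
  ext x
  rw [schwartzFourierInv_apply, invFT]

/-- The constant `(2π)⁻ⁿ`. -/
noncomputable def fc (n : ℕ) : ℝ≥0∞ := ENNReal.ofReal (((2 * Real.pi : ℝ) ^ n : ℝ)⁻¹)

theorem fc_ne_top (n : ℕ) : fc n ≠ ∞ := ENNReal.ofReal_ne_top

theorem enorm_two_pi_pow_inv (n : ℕ) : ‖((2 * Real.pi : ℝ) ^ n : ℝ)⁻¹‖ₑ = fc n := by
  rw [Real.enorm_of_nonneg (by positivity), fc]

theorem enorm_invFT_le (F : Rn n → ℂ) (x : Rn n) : ‖invFT F x‖ₑ ≤ fc n * ∫⁻ ξ, ‖F ξ‖ₑ := by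
  rw [invFT, enorm_smul, enorm_two_pi_pow_inv]
  gcongr
  refine (enorm_integral_le_lintegral_enorm _).trans_eq (lintegral_congr fun ξ => ?_)
  rw [enorm_mul, ← ofReal_norm (Complex.exp _), norm_exp_I_mul]
  simp

theorem invFT_eq_fourier (F : Rn n → ℂ) (x : Rn n) :
    invFT F x = ((2 * Real.pi : ℝ) ^ n : ℝ)⁻¹ • 𝓕 F (-(2 * Real.pi)⁻¹ • x) := by
  rw [invFT, Real.fourier_eq']
  congr 1
  refine integral_congr_ae (.of_forall fun ξ => ?_)
  simp only [inner_smul_right, smul_eq_mul, real_inner_comm ξ x]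
  congr 2
  have : (Real.pi : ℂ) ≠ 0 := by exact_mod_cast Real.pi_ne_zero
  push_cast
  field_simp

theorem continuous_invFT {F : Rn n → ℂ} (hF : Integrable F) : Continuous (invFT F) := by
  have h : Continuous (𝓕 F) :=
    VectorFourier.fourierIntegral_continuous Real.continuous_fourierChar
      (by exact continuous_inner) hF
  simp_rw [funext (invFT_eq_fourier F)]
  fun_prop

theorem invFT_sub {F G : Rn n → ℂ} (hF : Integrable F) (hG : Integrable G) (x : Rn n) :
    invFT (fun ξ => F ξ - G ξ) x = invFT F x - invFT G x := by
  simp only [invFT, mul_sub]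
  rw [integral_sub (integrable_exp_mul hF x) (integrable_exp_mul hG x), smul_sub]

theorem invFT_sum {ι : Type*} (s : Finset ι) {F : ι → Rn n → ℂ}
    (hF : ∀ i ∈ s, Integrable (F i)) (x : Rn n) :
    invFT (fun ξ => ∑ i ∈ s, F i ξ) x = ∑ i ∈ s, invFT (F i) x := by
  simp only [invFT, Finset.mul_sum]
  rw [integral_finsetSum _ fun i hi => integrable_exp_mul (hF i hi) x, Finset.smul_sum]

/-- Fubini's theorem for the Fourier kernel: the Fourier transform may be moved from one factor of
a pairing to the other. -/
theorem integral_mul_integral_exp {F G : Rn n → ℂ} (hF : Integrable F) (hG : Integrable G) :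
    ∫ ξ, F ξ * ∫ x, Complex.exp (Complex.I * (⟪ξ, x⟫_ℝ : ℂ)) * G x =
      ∫ x, (∫ ξ, Complex.exp (Complex.I * (⟪x, ξ⟫_ℝ : ℂ)) * F ξ) * G x := by
  simp_rw [← integral_const_mul, ← integral_mul_const]
  rw [integral_integral_swap]
  · refine integral_congr_ae (.of_forall fun x => integral_congr_ae (.of_forall fun ξ => ?_))
    simp only [real_inner_comm ξ x]
    ring
  · have h := (hF.mul_prod hG).bdd_mul (c := 1)
      (f := fun z : Rn n × Rn n => Complex.exp (Complex.I * (⟪z.1, z.2⟫_ℝ : ℂ)))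
      (Continuous.aestronglyMeasurable (by fun_prop)) (.of_forall fun ξ => (norm_exp_I_mul _).le)
    refine h.congr (.of_forall fun z => ?_)
    simp only [Function.uncurry]
    ring

theorem isGivenBy_invFT {S : 𝓢'(Rn n, ℂ)} {F : Rn n → ℂ} (hF : Integrable F)
    (h : IsGivenBy S F) : IsGivenBy (distFourierInv S) (invFT F) := by
  have hc := continuous_invFT hF
  refine ⟨hc.aestronglyMeasurable, fun ψ => ⟨?_, ?_⟩⟩
  · have hb : ∀ x, ‖invFT F x‖ ≤ (fc n * ∫⁻ ξ, ‖F ξ‖ₑ).toReal := fun x => by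
      rw [← toReal_enorm]
      exact ENNReal.toReal_mono (ENNReal.mul_ne_top (fc_ne_top n) hF.2.ne) (enorm_invFT_le F x)
    exact ψ.integrable.bdd_mul hc.aestronglyMeasurable (.of_forall hb)
  · rw [distFourierInv_apply, (h.2 _).2]
    simp_rw [schwartzFourierInv_apply, mul_smul_comm]
    rw [integral_smul, integral_mul_integral_exp hF ψ.integrable, ← integral_smul]
    simp_rw [invFT, smul_mul_assoc]

theorem isGivenBy_invFT_of_distFourier {T : 𝓢'(Rn n, ℂ)} {F : Rn n → ℂ} (hF : Integrable F)
    (h : IsGivenBy (distFourier T) F) : IsGivenBy T (invFT F) := by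
  have := isGivenBy_invFT hF h
  rwa [distFourierInv_distFourier] at this

/-- An integrable function is the Fourier transform of a tempered distribution. -/
theorem exists_distFourier_isGivenBy {F : Rn n → ℂ} (hF : Integrable F) :
    ∃ T : 𝓢'(Rn n, ℂ), IsGivenBy (distFourier T) F := by
  obtain ⟨S, hS⟩ := exists_isGivenBy le_rfl (memLp_one_iff_integrable.2 hF)
  exact ⟨distFourierInv S, by rwa [distFourier_distFourierInv]⟩

/-! ### The weighted norms of a tempered distribution -/

theorem weightedLpNorm_eq {p : ℝ≥0∞} {s : ℝ} {T : 𝓢'(Rn n, ℂ)} {g : Rn n → ℂ}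
    (h : IsGivenBy T g) :
    weightedLpNorm p s T = eLpNorm (fun x => (bracket x ^ s : ℝ) • g x) p volume := by
  refine le_antisymm (iInf₂_le g h) (le_iInf₂ fun g' hg' => le_of_eq (eLpNorm_congr_ae ?_))
  filter_upwards [h.ae_eq hg'] with x hx
  rw [hx]

theorem weightedLpNorm_zero_eq {p : ℝ≥0∞} {T : 𝓢'(Rn n, ℂ)} {g : Rn n → ℂ}
    (h : IsGivenBy T g) : weightedLpNorm p 0 T = eLpNorm g p volume := by
  rw [weightedLpNorm_eq h]
  simp

theorem exists_isGivenBy_of_weightedLpNorm {p : ℝ≥0∞} {s : ℝ} {T : 𝓢'(Rn n, ℂ)}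
    (h : weightedLpNorm p s T < ∞) : ∃ g, IsGivenBy T g := by
  by_contra! hc
  simp [weightedLpNorm, hc] at h

theorem weightedLpNorm_add_le {p : ℝ≥0∞} (hp : 1 ≤ p) {s : ℝ} (T S : 𝓢'(Rn n, ℂ)) :
    weightedLpNorm p s (T + S) ≤ weightedLpNorm p s T + weightedLpNorm p s S := by
  by_cases hT : weightedLpNorm p s T < ∞
  swap
  · simp [not_lt_top_iff.1 hT]
  by_cases hS : weightedLpNorm p s S < ∞
  swap
  · simp [not_lt_top_iff.1 hS]
  obtain ⟨f, hf⟩ := exists_isGivenBy_of_weightedLpNorm hT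
  obtain ⟨g, hg⟩ := exists_isGivenBy_of_weightedLpNorm hS
  rw [weightedLpNorm_eq (hf.add hg), weightedLpNorm_eq hf, weightedLpNorm_eq hg]
  simp_rw [smul_add]
  have hw := (continuous_bracket_rpow (n := n) s).aestronglyMeasurable (μ := volume)
  exact eLpNorm_add_le (hw.smul hf.1) (hw.smul hg.1) hp

theorem weightedLpNorm_smul_le {p : ℝ≥0∞} {s : ℝ} (c : ℂ) (T : 𝓢'(Rn n, ℂ))
    (hT : weightedLpNorm p s T < ∞) :
    weightedLpNorm p s (c • T) ≤ ‖c‖ₑ * weightedLpNorm p s T := by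
  obtain ⟨f, hf⟩ := exists_isGivenBy_of_weightedLpNorm hT
  rw [weightedLpNorm_eq (hf.smul c), weightedLpNorm_eq hf]
  refine le_trans (le_of_eq ?_) (eLpNorm_const_smul_le (c := c))
  congr 1
  ext x
  simp only [Pi.smul_apply, smul_eq_mul, Complex.real_smul]
  ring

/-- The weighted Lebesgue norm with a finite exponent as an integral. -/
theorem weightedLpNorm_eq_LN {q : ℝ≥0∞} (h1 : 1 ≤ q) (h2 : q ≠ ∞) {s : ℝ} {T : 𝓢'(Rn n, ℂ)}
    {g : Rn n → ℂ} (h : IsGivenBy T g) :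
    weightedLpNorm q s T = LN q.toReal volume (fun ξ => wt s ξ * ‖g ξ‖ₑ) := by
  rw [weightedLpNorm_eq h, eLpNorm_eq_LN h1 h2]
  congr 1
  ext ξ
  rw [enorm_smul, Real.enorm_of_nonneg (Real.rpow_nonneg (bracket_pos ξ).le s), wt]

end GivenBy

end ModulationIdeals

namespace ModulationIdeals

/-! ### The Hausdorff–Young inequality -/

section Interpolation

variable {α β : Type*} [MeasurableSpace α] [MeasurableSpace β] {μ : Measure α} {ν : Measure β}

/-- The integral over the heights `l` in the Marcinkiewicz argument: a value `u` of the function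
belongs to the low part of the splitting at the height `l` precisely if `l u^{a-1} ≤ 2`. -/
theorem setLIntegral_indicator_rpow_le {a b : ℝ} (h : a.HolderConjugate b) (ha : a < 2) {u : ℝ}
    (hu : 0 ≤ u) :
    ∫⁻ l in Set.Ioi (0 : ℝ), {l : ℝ | l * u ^ (a - 1) ≤ 2}.indicator
        (fun l => ENNReal.ofReal (u ^ 2) * ENNReal.ofReal (l ^ (b - 3))) l ≤
      ENNReal.ofReal (2 ^ (b - 2) / (b - 2)) * ENNReal.ofReal (u ^ a) := by
  rcases hu.eq_or_lt with rfl | hu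
  · simp
  have ha1 := h.lt
  have hb1 := h.symm.lt
  have hab : a * b = a + b := h.mul_eq_add
  have hb2 : 2 < b := by nlinarith
  set v : ℝ := 2 * u ^ (1 - a) with hv
  have hv0 : 0 < v := by positivity
  have hsub : ∀ l : ℝ, l * u ^ (a - 1) ≤ 2 → l ≤ v := by
    intro l hl
    have h1 : u ^ (a - 1) * u ^ (1 - a) = 1 := by
      rw [← Real.rpow_add hu]; simp
    calc l = l * u ^ (a - 1) * u ^ (1 - a) := by rw [mul_assoc, h1, mul_one]
      _ ≤ _ := by rw [hv]; gcongr
  have hint : IntegrableOn (fun l : ℝ => l ^ (b - 3)) (Set.Ioc 0 v) := by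
    rw [← intervalIntegrable_iff_integrableOn_Ioc_of_le hv0.le]
    exact intervalIntegral.intervalIntegrable_rpow' (by linarith)
  calc _ ≤ ∫⁻ l in Set.Ioi (0 : ℝ), (Set.Ioc 0 v).indicator
        (fun l => ENNReal.ofReal (u ^ 2) * ENNReal.ofReal (l ^ (b - 3))) l := by
        refine setLIntegral_mono' measurableSet_Ioi fun l hl => ?_
        by_cases h1 : l * u ^ (a - 1) ≤ 2
        · rw [Set.indicator_of_mem (by exact h1),
            Set.indicator_of_mem (Set.mem_Ioc.2 ⟨hl, hsub l h1⟩)]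
        · rw [Set.indicator_of_notMem (by exact h1)]
          exact zero_le
    _ ≤ ∫⁻ l in Set.Ioc 0 v, ENNReal.ofReal (u ^ 2) * ENNReal.ofReal (l ^ (b - 3)) := by
        rw [← lintegral_indicator measurableSet_Ioc]
        exact setLIntegral_le_lintegral _ _
    _ = ENNReal.ofReal (u ^ 2) * ENNReal.ofReal (v ^ (b - 2) / (b - 2)) := by
        rw [lintegral_const_mul' _ _ ENNReal.ofReal_ne_top,
          ← ofReal_integral_eq_lintegral_ofReal hint]
        · rw [← intervalIntegral.integral_of_le hv0.le, integral_rpow (Or.inl (by linarith))]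
          congr 3
          · rw [Real.zero_rpow (by linarith), sub_zero]
            ring_nf
          · ring
        · refine (ae_restrict_iff' measurableSet_Ioc).2 (.of_forall fun l hl => ?_)
          exact Real.rpow_nonneg hl.1.le _
    _ = _ := by
        have : 0 ≤ b - 2 := by linarith
        rw [← ENNReal.ofReal_mul (by positivity), ← ENNReal.ofReal_mul (by positivity)]
        congr 1
        have e : u ^ (2 : ℕ) * (u ^ (1 - a)) ^ (b - 2) = u ^ a := by
          rw [← Real.rpow_natCast, ← Real.rpow_mul hu.le, ← Real.rpow_add hu]
          congr 1
          push_cast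
          linarith
        rw [hv, Real.mul_rpow (by norm_num) (by positivity), ← e]
        ring

/-- Marcinkiewicz interpolation between `L¹ → L^∞` and `L² → L²`, for one fixed function `G` with
image `H`: the splittings of `G` at all heights `t` control the distribution function of `H`. -/
theorem lintegral_rpow_le_of_splitting [SFinite μ] {a b : ℝ} (h : a.HolderConjugate b)
    (ha : a < 2) {K : ℝ≥0∞} (hK : K ≠ ∞) {G : α → ℝ} (hG : Measurable G) (hG0 : ∀ x, 0 ≤ G x)
    (hG1 : ∫⁻ x, ENNReal.ofReal (G x ^ a) ∂μ ≤ 1) {H : β → ℝ} (hH : AEMeasurable H ν)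
    (hH0 : ∀ x, 0 ≤ H x)
    (hsplit : ∀ t : ℝ, 0 < t → ∃ H₁ H₂ : β → ℝ, AEMeasurable H₂ ν ∧
      (∀ᵐ y ∂ν, H y ≤ H₁ y + H₂ y) ∧
      (∀ᵐ y ∂ν, ENNReal.ofReal (H₁ y) ≤ ∫⁻ x in {x | t < G x}, ENNReal.ofReal (G x) ∂μ) ∧
      ∫⁻ y, ENNReal.ofReal (H₂ y ^ 2) ∂ν ≤
        K * ∫⁻ x in {x | G x ≤ t}, ENNReal.ofReal (G x ^ 2) ∂μ) :
    ∫⁻ y, ENNReal.ofReal (H y ^ b) ∂ν ≤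
      ENNReal.ofReal b * (4 * K * ENNReal.ofReal (2 ^ (b - 2) / (b - 2))) := by
  have ha1 := h.lt
  have hb1 := h.symm.lt
  have hab : a * b = a + b := h.mul_eq_add
  rw [lintegral_rpow_eq_lintegral_meas_lt_mul ν (.of_forall hH0) hH h.symm.pos]
  gcongr
  have hdist : ∀ l ∈ Set.Ioi (0 : ℝ), ν {y | l < H y} * ENNReal.ofReal (l ^ (b - 1)) ≤
      4 * K * ∫⁻ x, {l : ℝ | l * G x ^ (a - 1) ≤ 2}.indicator
        (fun l => ENNReal.ofReal (G x ^ 2) * ENNReal.ofReal (l ^ (b - 3))) l ∂μ := by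
    intro l hl
    replace hl : 0 < l := hl
    -- the height at which the bounded part of `H` is at most `l / 2`
    set t : ℝ := (2 / l) ^ (1 / (a - 1)) with ht
    have ht0 : 0 < t := by positivity
    have hta : t ^ (a - 1) = 2 / l := by
      rw [ht, ← Real.rpow_mul (by positivity), one_div_mul_cancel (by linarith), Real.rpow_one]
    obtain ⟨H₁, H₂, hm, hle, h1, h2⟩ := hsplit t ht0
    have hhigh : ∫⁻ x in {x | t < G x}, ENNReal.ofReal (G x) ∂μ ≤ ENNReal.ofReal (l / 2) := by
      calc _ ≤ ∫⁻ x in {x | t < G x}, ENNReal.ofReal (l / 2) * ENNReal.ofReal (G x ^ a) ∂μ := by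
            refine setLIntegral_mono' (measurableSet_lt measurable_const hG) fun x hx => ?_
            rw [← ENNReal.ofReal_mul (by positivity)]
            apply ENNReal.ofReal_le_ofReal
            have hx0 : 0 < G x := ht0.trans hx
            have h3 : 2 / l ≤ G x ^ (a - 1) := by
              rw [← hta]
              exact Real.rpow_le_rpow ht0.le (le_of_lt hx) (by linarith)
            have h4 : G x ^ a = G x ^ (a - 1) * G x := by
              rw [← Real.rpow_add_one hx0.ne']; simp
            rw [h4]
            calc G x = l / 2 * (2 / l * G x) := by field_simp
              _ ≤ _ := by gcongr
        _ ≤ ENNReal.ofReal (l / 2) * 1 := by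
            rw [lintegral_const_mul' _ _ ENNReal.ofReal_ne_top]
            gcongr
            exact (setLIntegral_le_lintegral _ _).trans hG1
        _ = _ := mul_one _
    -- where `H > l`, the other part of `H` exceeds `l / 2`, and Chebyshev's inequality applies
    have hmeas : ν {y | l < H y} ≤ ν {y | ENNReal.ofReal ((l / 2) ^ 2) ≤
        ENNReal.ofReal (H₂ y ^ 2)} := by
      refine measure_mono_ae ?_
      filter_upwards [hle, h1] with y hy1 hy2 hy3
      have h5 : H₁ y ≤ l / 2 := (ENNReal.ofReal_le_ofReal_iff (by positivity)).1 (hy2.trans hhigh)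
      replace hy3 : l < H y := hy3
      have : l / 2 ≤ H₂ y := by linarith
      exact ENNReal.ofReal_le_ofReal (by gcongr)
    have hcheb := mul_meas_ge_le_lintegral₀ (μ := ν) (f := fun y => ENNReal.ofReal (H₂ y ^ 2))
      (hm.pow_const 2).ennreal_ofReal (ENNReal.ofReal ((l / 2) ^ 2))
    have hlow : ∫⁻ x in {x | G x ≤ t}, ENNReal.ofReal (G x ^ 2) ∂μ ≤
        ∫⁻ x, {l : ℝ | l * G x ^ (a - 1) ≤ 2}.indicator
          (fun _ => ENNReal.ofReal (G x ^ 2)) l ∂μ := by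
      rw [← lintegral_indicator (measurableSet_le hG measurable_const)]
      refine lintegral_mono fun x => ?_
      by_cases hx : G x ≤ t
      · rw [Set.indicator_of_mem (by exact hx), Set.indicator_of_mem]
        have h6 : G x ^ (a - 1) ≤ 2 / l := by
          rw [← hta]
          exact Real.rpow_le_rpow (hG0 x) hx (by linarith)
        rw [le_div_iff₀ hl] at h6
        change l * G x ^ (a - 1) ≤ 2
        linarith
      · rw [Set.indicator_of_notMem (by exact hx)]
        exact zero_le
    have e1 : ENNReal.ofReal (l ^ (b - 1)) =
        4 * ENNReal.ofReal (l ^ (b - 3)) * ENNReal.ofReal ((l / 2) ^ 2) := by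
      rw [show (4 : ℝ≥0∞) = ENNReal.ofReal 4 by norm_num, ← ENNReal.ofReal_mul (by norm_num),
        ← ENNReal.ofReal_mul (by positivity)]
      congr 1
      have : l ^ (b - 1) = l ^ (b - 3) * l ^ (2 : ℕ) := by
        rw [← Real.rpow_natCast, ← Real.rpow_add hl]
        congr 1
        push_cast
        ring
      rw [this]
      ring
    calc ν {y | l < H y} * ENNReal.ofReal (l ^ (b - 1))
        ≤ 4 * ENNReal.ofReal (l ^ (b - 3)) * (ENNReal.ofReal ((l / 2) ^ 2) *
            ν {y | ENNReal.ofReal ((l / 2) ^ 2) ≤ ENNReal.ofReal (H₂ y ^ 2)}) := by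
          rw [e1, mul_comm, mul_assoc (4 * ENNReal.ofReal (l ^ (b - 3)))]
          gcongr
      _ ≤ 4 * ENNReal.ofReal (l ^ (b - 3)) * (K * ∫⁻ x, {l : ℝ | l * G x ^ (a - 1) ≤ 2}.indicator
            (fun _ => ENNReal.ofReal (G x ^ 2)) l ∂μ) := by
          exact mul_le_mul' le_rfl (hcheb.trans (h2.trans (mul_le_mul' le_rfl hlow)))
      _ = 4 * K * (ENNReal.ofReal (l ^ (b - 3)) * ∫⁻ x, {l : ℝ | l * G x ^ (a - 1) ≤ 2}.indicator
            (fun _ => ENNReal.ofReal (G x ^ 2)) l ∂μ) := by ring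
      _ = _ := by
          rw [← lintegral_const_mul' _ _ ENNReal.ofReal_ne_top]
          congr 1
          refine lintegral_congr fun x => ?_
          by_cases hx : l * G x ^ (a - 1) ≤ 2
          · rw [Set.indicator_of_mem (by exact hx), Set.indicator_of_mem (by exact hx), mul_comm]
          · rw [Set.indicator_of_notMem (by exact hx), Set.indicator_of_notMem (by exact hx),
              mul_zero]
  refine (setLIntegral_mono' measurableSet_Ioi hdist).trans ?_
  rw [lintegral_const_mul' _ _ (by finiteness)]
  gcongr
  rw [lintegral_lintegral_swap]
  · calc _ ≤ ∫⁻ x, ENNReal.ofReal (2 ^ (b - 2) / (b - 2)) * ENNReal.ofReal (G x ^ a) ∂μ :=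
          lintegral_mono fun x => setLIntegral_indicator_rpow_le h ha (hG0 x)
      _ ≤ ENNReal.ofReal (2 ^ (b - 2) / (b - 2)) * 1 := by
          rw [lintegral_const_mul' _ _ ENNReal.ofReal_ne_top]
          gcongr
      _ = _ := mul_one _
  · apply Measurable.aemeasurable
    have hs : MeasurableSet {z : ℝ × α | z.1 * G z.2 ^ (a - 1) ≤ 2} :=
      measurableSet_le (by fun_prop) measurable_const
    exact Measurable.indicator (f := fun z : ℝ × α =>
      ENNReal.ofReal (G z.2 ^ 2) * ENNReal.ofReal (z.1 ^ (b - 3))) (by fun_prop) hs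

end Interpolation

end ModulationIdeals

namespace ModulationIdeals

section HausdorffYoung

variable {n : ℕ}

/-- The endpoint `L¹ → L^∞` of the Hausdorff–Young inequality. -/
theorem exists_distFourier_of_integrable {T : 𝓢'(Rn n, ℂ)} {g : Rn n → ℂ} (hT : IsGivenBy T g)
    (hg : Integrable g) :
    ∃ h, IsGivenBy (distFourier T) h ∧ ∀ ξ, ‖h ξ‖ₑ ≤ ∫⁻ x, ‖g x‖ₑ := by
  set h : Rn n → ℂ := fun ξ => ∫ x, Complex.exp (Complex.I * (⟪-ξ, x⟫_ℝ : ℂ)) * g x with hh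
  have hb : ∀ ξ, ‖h ξ‖ₑ ≤ ∫⁻ x, ‖g x‖ₑ := fun ξ => by
    refine (enorm_integral_le_lintegral_enorm _).trans_eq (lintegral_congr fun x => ?_)
    rw [enorm_mul, ← ofReal_norm (Complex.exp _), norm_exp_I_mul]
    simp
  have hcont : Continuous h := by
    have e : h = fun ξ => ((2 * Real.pi : ℝ) ^ n : ℝ) • invFT g (-ξ) := by
      ext ξ
      rw [invFT, smul_smul, mul_inv_cancel₀ (by positivity), one_smul]
    rw [e]
    have := continuous_invFT hg
    fun_prop
  refine ⟨h, ⟨hcont.aestronglyMeasurable, fun ψ => ⟨?_, ?_⟩⟩, hb⟩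
  · refine ψ.integrable.bdd_mul (c := (∫⁻ x, ‖g x‖ₑ).toReal) hcont.aestronglyMeasurable
      (.of_forall fun ξ => ?_)
    rw [← toReal_enorm]
    exact ENNReal.toReal_mono hg.2.ne (hb ξ)
  · rw [distFourier_apply, (hT.2 _).2]
    have e1 : ∀ ξ, schwartzFourier n ψ ξ =
        ∫ x, Complex.exp (Complex.I * (⟪ξ, x⟫_ℝ : ℂ)) * ψ (-x) := by
      intro ξ
      rw [schwartzFourier_apply, ← integral_neg_eq_self]
      refine integral_congr_ae (.of_forall fun x => ?_)
      simp only [inner_neg_left, real_inner_comm ξ x]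
      push_cast
      ring_nf
    simp_rw [e1]
    rw [integral_mul_integral_exp hg ψ.integrable.comp_neg, ← integral_neg_eq_self]
    simp_rw [neg_neg, hh]

/-- The endpoint `L² → L²` of the Hausdorff–Young inequality, from Plancherel's theorem. -/
theorem exists_distFourier_of_memLp_two (n : ℕ) :
    ∃ C : ℝ≥0∞, C ≠ ∞ ∧ ∀ (T : 𝓢'(Rn n, ℂ)) (g : Rn n → ℂ), IsGivenBy T g → MemLp g 2 →
      ∃ h, IsGivenBy (distFourier T) h ∧ eLpNorm h 2 volume ≤ C * eLpNorm g 2 volume := by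
  set d : ℝ := (2 * Real.pi) ^ n with hd
  have hd0 : 0 < d := by positivity
  set D : Rn n → Rn n := fun x => (2 * Real.pi) • x with hD
  have hDe : MeasurableEmbedding D :=
    (Homeomorph.smulOfNeZero (2 * Real.pi) (by positivity)).measurableEmbedding
  have hmap : Measure.map D volume = ENNReal.ofReal |d⁻¹| • (volume : Measure (Rn n)) := by
    rw [hD, Measure.map_addHaar_smul volume (by positivity), finrank_euclideanSpace_fin]
  refine ⟨‖(d : ℂ)‖ₑ * ENNReal.ofReal |d⁻¹| ^ ((1 : ℝ≥0∞) / 2).toReal, by finiteness,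
    fun T g hT hg => ?_⟩
  have hnorm : eLpNorm (g ∘ D) 2 volume =
      ENNReal.ofReal |d⁻¹| ^ ((1 : ℝ≥0∞) / 2).toReal * eLpNorm g 2 volume := by
    rw [← hDe.eLpNorm_map_measure, hmap, eLpNorm_smul_measure_of_ne_top (by simp), smul_eq_mul]
  have hg2 : MemLp (g ∘ D) 2 := by
    refine ⟨?_, ?_⟩
    · refine hg.1.comp_quasiMeasurePreserving ⟨hDe.measurable, ?_⟩
      rw [hmap]
      exact Measure.smul_absolutelyContinuous
    · rw [hnorm]
      have := hg.2.ne
      finiteness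
  set S := hg2.toLp (g ∘ D) with hS
  have hF : distFourier T = (d : ℂ) • ((𝓕 S : Lp ℂ 2 (volume : Measure (Rn n))) : 𝓢'(Rn n, ℂ)) := by
    rw [← Lp.fourier_toTemperedDistribution_eq]
    ext ψ
    have e1 : distFourier T ψ = ∫ x, g x * 𝓕 ψ ((2 * Real.pi)⁻¹ • x) := (hT.2 _).2
    have e2 := Measure.integral_comp_smul (volume : Measure (Rn n))
      (fun x => g x * 𝓕 ψ ((2 * Real.pi)⁻¹ • x)) (2 * Real.pi)
    rw [finrank_euclideanSpace_fin, abs_of_pos (inv_pos.2 hd0)] at e2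
    have e3 : ((d : ℂ) • 𝓕 (S : 𝓢'(Rn n, ℂ))) ψ = (d : ℂ) * ∫ x, 𝓕 ψ x * g (D x) := by
      change (d : ℂ) * (S : 𝓢'(Rn n, ℂ)) (𝓕 ψ) = _
      rw [Lp.toTemperedDistribution_apply]
      congr 1
      refine integral_congr_ae ?_
      filter_upwards [hg2.coeFn_toLp] with x hx
      rw [hS, hx, smul_eq_mul, Function.comp_apply]
    rw [e1, e3]
    have e4 : ∫ x, 𝓕 ψ x * g (D x) = d⁻¹ • ∫ x, g x * 𝓕 ψ ((2 * Real.pi)⁻¹ • x) := by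
      rw [← e2]
      refine integral_congr_ae (.of_forall fun x => ?_)
      simp only [hD]
      rw [inv_smul_smul₀ (by positivity), mul_comm]
    rw [e4, Complex.real_smul, ← mul_assoc, Complex.ofReal_inv,
      mul_inv_cancel₀ (by exact_mod_cast hd0.ne'), one_mul]
  have hgiven : IsGivenBy ((𝓕 S : Lp ℂ 2 (volume : Measure (Rn n))) : 𝓢'(Rn n, ℂ))
      (𝓕 S : Lp ℂ 2 (volume : Measure (Rn n))) := by
    refine ⟨(Lp.memLp _).1, fun φ => ⟨?_, ?_⟩⟩
    · exact (Lp.memLp (𝓕 S)).integrable_mul (φ.memLp 2)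
    · rw [Lp.toTemperedDistribution_apply]
      simp_rw [smul_eq_mul, mul_comm]
  refine ⟨_, by rw [hF]; exact hgiven.smul (d : ℂ), ?_⟩
  refine (eLpNorm_const_smul_le (c := (d : ℂ))
    (f := ((𝓕 S : Lp ℂ 2 (volume : Measure (Rn n))) : Rn n → ℂ))).trans ?_
  have hP : ‖𝓕 S‖ₑ = ‖S‖ₑ := by rw [← ofReal_norm (𝓕 S), Lp.norm_fourier_eq, ofReal_norm]
  rw [← Lp.enorm_def, hP, Lp.enorm_def, eLpNorm_congr_ae hg2.coeFn_toLp, hnorm, mul_assoc]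

end HausdorffYoung

end ModulationIdeals

namespace ModulationIdeals

section HausdorffYoung

variable {n : ℕ}

theorem lintegral_enorm_rpow_eq {α : Type*} [MeasurableSpace α] {μ : Measure α} {f : α → ℂ}
    {a : ℝ} (ha : 0 ≤ a) :
    ∫⁻ x, ‖f x‖ₑ ^ a ∂μ = ∫⁻ x, ENNReal.ofReal (‖f x‖ ^ a) ∂μ := by
  refine lintegral_congr fun x => ?_
  rw [← ENNReal.ofReal_rpow_of_nonneg (norm_nonneg _) ha, ofReal_norm]

theorem lintegral_enorm_rpow_eq_eLpNorm {α : Type*} [MeasurableSpace α] {μ : Measure α}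
    {f : α → ℂ} {p : ℝ≥0∞} (h1 : 1 ≤ p) (h2 : p ≠ ∞) :
    ∫⁻ x, ‖f x‖ₑ ^ p.toReal ∂μ = eLpNorm f p μ ^ p.toReal := by
  rw [eLpNorm_eq_LN h1 h2, LN_rpow]
  rwa [← ENNReal.toReal_one, ENNReal.toReal_le_toReal ENNReal.one_ne_top h2]

/-- The Hausdorff–Young inequality for `1 < p < 2` and functions of norm at most one. -/
theorem exists_distFourier_of_one_lt (n : ℕ) {p : ℝ≥0∞} (hp1 : 1 < p) (hp2 : p < 2) :
    ∃ C : ℝ≥0∞, C ≠ ∞ ∧ ∀ (T : 𝓢'(Rn n, ℂ)) (g : Rn n → ℂ), IsGivenBy T g → Measurable g →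
      eLpNorm g p volume ≤ 1 →
      ∃ h, IsGivenBy (distFourier T) h ∧ eLpNorm h p.conjExponent volume ≤ C := by
  obtain ⟨K, hK, hL2⟩ := exists_distFourier_of_memLp_two n
  have hpt : p ≠ ∞ := (hp2.trans_le le_top).ne
  have hconj : p.HolderConjugate p.conjExponent := .conjExponent hp1.le
  set a := p.toReal with ha
  set b := p.conjExponent.toReal with hb
  have hc : a.HolderConjugate b := hconj.toReal_of_ne_top hpt
    ((ENNReal.HolderConjugate.lt_top_iff_one_lt p.conjExponent p).2 hp1).ne
  have ha2 : a < 2 := by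
    have := (ENNReal.toReal_lt_toReal hpt (by simp)).2 hp2
    simpa using this
  have hb2 : (0 : ℝ) ≤ b := hc.symm.nonneg
  have ha1 : 1 < a := hc.lt
  refine ⟨(ENNReal.ofReal b * (4 * K ^ 2 * ENNReal.ofReal (2 ^ (b - 2) / (b - 2)))) ^ (1 / b),
    by finiteness, fun T g hT hg hg1 => ?_⟩
  have hga : ∫⁻ x, ENNReal.ofReal (‖g x‖ ^ a) ≤ 1 := by
    rw [← lintegral_enorm_rpow_eq (by linarith), ha, lintegral_enorm_rpow_eq_eLpNorm hp1.le hpt]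
    exact ENNReal.rpow_le_one hg1 (by linarith)
  -- the Fourier transform of the splitting of `g` into its parts above and below the height `t`
  have hsplit : ∀ t : ℝ, 0 < t → ∃ h₁ h₂ : Rn n → ℂ,
      IsGivenBy (distFourier T) (fun ξ => h₁ ξ + h₂ ξ) ∧
      AEStronglyMeasurable h₂ ∧
      (∀ ξ, ‖h₁ ξ‖ₑ ≤ ∫⁻ x in {x | t < ‖g x‖}, ENNReal.ofReal ‖g x‖) ∧
      ∫⁻ ξ, ENNReal.ofReal (‖h₂ ξ‖ ^ 2) ≤
        K ^ 2 * ∫⁻ x in {x | ‖g x‖ ≤ t}, ENNReal.ofReal (‖g x‖ ^ 2) := by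
    intro t ht
    have hsh : MeasurableSet {x | t < ‖g x‖} := measurableSet_lt measurable_const hg.norm
    have hsl : MeasurableSet {x | ‖g x‖ ≤ t} := measurableSet_le hg.norm measurable_const
    set hi := {x | t < ‖g x‖}.indicator g
    set lo := {x | ‖g x‖ ≤ t}.indicator g
    have hadd : (fun x => hi x + lo x) = g := by
      ext x
      by_cases hx : t < ‖g x‖
      · simp only [hi, lo]
        rw [Set.indicator_of_mem (by exact hx), Set.indicator_of_notMem (by simpa using hx),
          add_zero]
      · simp only [hi, lo]
        rw [Set.indicator_of_notMem (by exact hx), Set.indicator_of_mem (by simpa using hx),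
          zero_add]
    have e1 : ∫⁻ x, ‖hi x‖ₑ = ∫⁻ x in {x | t < ‖g x‖}, ENNReal.ofReal ‖g x‖ := by
      rw [← lintegral_indicator hsh]
      refine lintegral_congr fun x => ?_
      rw [enorm_indicator_eq_indicator_enorm]
      simp_rw [ofReal_norm]
    have e2 : ∫⁻ x, ‖lo x‖ₑ ^ (2 : ℝ) =
        ∫⁻ x in {x | ‖g x‖ ≤ t}, ENNReal.ofReal (‖g x‖ ^ 2) := by
      rw [← lintegral_indicator hsl]
      refine lintegral_congr fun x => ?_
      by_cases hx : ‖g x‖ ≤ t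
      · simp only [lo]
        rw [Set.indicator_of_mem (by exact hx), Set.indicator_of_mem (by exact hx),
          ENNReal.ofReal_pow (norm_nonneg _), ofReal_norm]
        exact ENNReal.rpow_natCast _ 2
      · simp only [lo]
        rw [Set.indicator_of_notMem (by exact hx), Set.indicator_of_notMem (by exact hx)]
        simp
    have hhi : Integrable hi := by
      refine ⟨(hg.indicator hsh).aestronglyMeasurable, ?_⟩
      rw [hasFiniteIntegral_iff_enorm, e1]
      refine lt_of_le_of_lt ?_ (ENNReal.mul_lt_top
        (ENNReal.ofReal_lt_top (r := t ^ (1 - a))) (hga.trans_lt ENNReal.one_lt_top))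
      rw [← lintegral_const_mul' _ _ ENNReal.ofReal_ne_top]
      refine (setLIntegral_mono' hsh fun x hx => ?_).trans (setLIntegral_le_lintegral _ _)
      replace hx : t < ‖g x‖ := hx
      have hx0 := ht.trans hx
      rw [← ENNReal.ofReal_mul (by positivity)]
      apply ENNReal.ofReal_le_ofReal
      calc ‖g x‖ = ‖g x‖ ^ (1 - a) * ‖g x‖ ^ a := by rw [← Real.rpow_add hx0]; simp
        _ ≤ _ := by
          gcongr ?_ * _
          exact Real.rpow_le_rpow_of_nonpos ht hx.le (by linarith)
    have hlo : MemLp lo 2 := by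
      refine ⟨(hg.indicator hsl).aestronglyMeasurable, ?_⟩
      rw [eLpNorm_eq_LN (by norm_num) (by simp), ENNReal.toReal_ofNat,
        LN_lt_top_iff (by norm_num), e2]
      refine lt_of_le_of_lt ?_ (ENNReal.mul_lt_top
        (ENNReal.ofReal_lt_top (r := t ^ (2 - a))) (hga.trans_lt ENNReal.one_lt_top))
      rw [← lintegral_const_mul' _ _ ENNReal.ofReal_ne_top]
      refine (setLIntegral_mono' hsl fun x hx => ?_).trans (setLIntegral_le_lintegral _ _)
      replace hx : ‖g x‖ ≤ t := hx
      rw [← ENNReal.ofReal_mul (by positivity)]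
      apply ENNReal.ofReal_le_ofReal
      rcases (norm_nonneg (g x)).eq_or_lt with h0 | h0
      · rw [← h0]
        have : 0 ≤ t ^ (2 - a) * (0 : ℝ) ^ a := by positivity
        simpa using this
      calc ‖g x‖ ^ 2 = ‖g x‖ ^ (2 - a) * ‖g x‖ ^ a := by
            rw [← Real.rpow_add h0, ← Real.rpow_natCast]
            congr 1
            push_cast
            ring
        _ ≤ _ := by
          gcongr ?_ * _
          exact Real.rpow_le_rpow h0.le hx (by linarith)
    obtain ⟨Thi, hThi⟩ := exists_isGivenBy le_rfl (memLp_one_iff_integrable.2 hhi)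
    obtain ⟨Tlo, hTlo⟩ := exists_isGivenBy (by norm_num) hlo
    obtain ⟨h₁, hh₁, hb₁⟩ := exists_distFourier_of_integrable hThi hhi
    obtain ⟨h₂, hh₂, hb₂⟩ := hL2 Tlo lo hTlo hlo
    have hTadd : T = Thi + Tlo := by
      have := hThi.add hTlo
      rw [hadd] at this
      exact hT.ext this
    refine ⟨h₁, h₂, ?_, hh₂.1, fun ξ => e1 ▸ hb₁ ξ, ?_⟩
    · rw [hTadd, map_add]
      exact hh₁.add hh₂
    · have e3 := lintegral_enorm_rpow_eq_eLpNorm (μ := (volume : Measure (Rn n))) (f := h₂)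
        (p := 2) (by norm_num) (by simp)
      have e4 := lintegral_enorm_rpow_eq_eLpNorm (μ := (volume : Measure (Rn n))) (f := lo)
        (p := 2) (by norm_num) (by simp)
      rw [ENNReal.toReal_ofNat] at e3 e4
      rw [lintegral_enorm_rpow_eq (by norm_num)] at e3
      rw [e2] at e4
      have e5 : ∫⁻ ξ, ENNReal.ofReal (‖h₂ ξ‖ ^ 2) = eLpNorm h₂ 2 volume ^ (2 : ℝ) := by
        rw [← e3]
        simp
      rw [e5, e4, ← ENNReal.rpow_two, ← ENNReal.mul_rpow_of_nonneg _ _ (by norm_num)]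
      exact ENNReal.rpow_le_rpow hb₂ (by norm_num)
  obtain ⟨h₁, h₂, hh, -⟩ := hsplit 1 one_pos
  refine ⟨_, hh, ?_⟩
  set h := fun ξ => h₁ ξ + h₂ ξ with hdef
  have hmain := lintegral_rpow_le_of_splitting (μ := (volume : Measure (Rn n)))
    (ν := (volume : Measure (Rn n))) hc ha2 (K := K ^ 2) (by finiteness) hg.norm
    (fun x => norm_nonneg _) hga (H := fun ξ => ‖h ξ‖) hh.1.norm.aemeasurable
    (fun ξ => norm_nonneg _) (fun t ht => by
      obtain ⟨k₁, k₂, hk, hk2, hb1, hb2⟩ := hsplit t ht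
      refine ⟨fun ξ => ‖k₁ ξ‖, fun ξ => ‖k₂ ξ‖, hk2.norm.aemeasurable, ?_,
        .of_forall fun ξ => ?_, hb2⟩
      · filter_upwards [hh.ae_eq hk] with ξ hξ
        rw [hξ]
        exact norm_add_le _ _
      · rw [ofReal_norm]
        exact hb1 ξ)
  rw [← lintegral_enorm_rpow_eq hb2] at hmain
  have hb1 : 1 ≤ p.conjExponent := by
    rw [ENNReal.conjExponent]
    exact le_self_add
  have hbt : p.conjExponent ≠ ∞ :=
    ((ENNReal.HolderConjugate.lt_top_iff_one_lt p.conjExponent p).2 hp1).ne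
  rw [eLpNorm_eq_LN hb1 hbt]
  exact ENNReal.rpow_le_rpow hmain (by positivity)

/-- The Hausdorff–Young inequality: the Fourier transform maps `L^p(ℝⁿ)` boundedly to
`L^{p'}(ℝⁿ)` for `1 ≤ p ≤ 2`. -/
theorem hausdorffYoung (n : ℕ) {p : ℝ≥0∞} (hp1 : 1 ≤ p) (hp2 : p ≤ 2) :
    ∃ C : ℝ≥0∞, C ≠ ∞ ∧ ∀ (T : 𝓢'(Rn n, ℂ)) (g : Rn n → ℂ), IsGivenBy T g →
      eLpNorm g p volume < ∞ → ∃ h, IsGivenBy (distFourier T) h ∧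
        eLpNorm h p.conjExponent volume ≤ C * eLpNorm g p volume := by
  rcases hp1.eq_or_lt with rfl | hp1
  · refine ⟨1, ENNReal.one_ne_top, fun T g hT hg => ?_⟩
    obtain ⟨h, hh, hb⟩ := exists_distFourier_of_integrable hT
      (memLp_one_iff_integrable.1 ⟨hT.1, hg⟩)
    refine ⟨h, hh, ?_⟩
    have e : (1 : ℝ≥0∞).conjExponent = ∞ := by simp [ENNReal.conjExponent]
    rw [e, one_mul, eLpNorm_exponent_top, eLpNorm_one_eq_lintegral_enorm]
    exact eLpNormEssSup_le_of_ae_enorm_bound (.of_forall hb)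
  rcases hp2.eq_or_lt with rfl | hp2
  · obtain ⟨C, hC, h⟩ := exists_distFourier_of_memLp_two n
    refine ⟨C, hC, fun T g hT hg => ?_⟩
    have e : (2 : ℝ≥0∞).conjExponent = 2 := by
      have : (2 : ℝ≥0∞) - 1 = 1 := by
        rw [show (2 : ℝ≥0∞) = 1 + 1 by norm_num, ENNReal.add_sub_cancel_left ENNReal.one_ne_top]
      rw [ENNReal.conjExponent, this, inv_one]
      norm_num
    rw [e]
    exact h T g hT ⟨hT.1, hg⟩
  obtain ⟨C, hC, h⟩ := exists_distFourier_of_one_lt n hp1 hp2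
  refine ⟨C, hC, fun T g hT hg => ?_⟩
  rcases eq_or_ne (eLpNorm g p volume) 0 with h0 | h0
  · have hg0 : g =ᵐ[volume] fun _ => 0 :=
      (eLpNorm_eq_zero_iff hT.1 (zero_lt_one.trans hp1).ne').1 h0
    have hT0 : T = 0 := (hT.congr_ae hg0).ext isGivenBy_zero
    refine ⟨fun _ => 0, by rw [hT0, map_zero]; exact isGivenBy_zero, by simp⟩
  -- the general case by homogeneity
  set N := (eLpNorm g p volume).toReal with hN
  have hN0 : 0 < N := ENNReal.toReal_pos h0 hg.ne
  have hNe : ‖(N : ℂ)‖ₑ = eLpNorm g p volume := by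
    rw [← ofReal_norm, Complex.norm_real, Real.norm_of_nonneg hN0.le, hN,
      ENNReal.ofReal_toReal hg.ne]
  have hNi : ‖((N : ℂ)⁻¹)‖ₑ = (eLpNorm g p volume)⁻¹ := by
    rw [enorm_inv (by exact_mod_cast hN0.ne'), hNe]
  have hT2 := (hT.congr_ae hT.1.ae_eq_mk).smul (N : ℂ)⁻¹
  obtain ⟨k, hk, hkb⟩ := h _ _ hT2 (hT.1.stronglyMeasurable_mk.measurable.const_mul _) (by
    refine (eLpNorm_const_smul_le (c := (N : ℂ)⁻¹) (f := hT.1.mk g)).trans_eq ?_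
    rw [← eLpNorm_congr_ae hT.1.ae_eq_mk, hNi, ENNReal.inv_mul_cancel h0 hg.ne])
  refine ⟨fun ξ => (N : ℂ) * k ξ, ?_, ?_⟩
  · have := hk.smul (N : ℂ)
    rwa [map_smul, smul_inv_smul₀ (by exact_mod_cast hN0.ne')] at this
  · refine (eLpNorm_const_smul_le (c := (N : ℂ)) (f := k)).trans ?_
    rw [hNe, mul_comm]
    gcongr

end HausdorffYoung

end ModulationIdeals

namespace ModulationIdeals

/-! ### Density of compactly supported Schwartz functions -/

section Density

variable {n : ℕ}

open Filter Topology

open scoped ContDiff in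
/-- The cut-offs `χ(x / (N + 1)) ψ(x)` converge to `ψ` in the Schwartz space: the derivatives of
`χ(x / (N + 1)) - 1` are bounded and vanish for `‖x‖ < N + 1`, so that one additional power of `‖x‖`
in the seminorm of `ψ` yields a factor `1 / (N + 1)`. -/
theorem tendsto_cutoff_smul (ψ : 𝓢(Rn n, ℂ)) {χ : 𝓢(Rn n, ℂ)} (h1 : ∀ x, ‖x‖ ≤ 1 → χ x = 1)
    {Ψ : ℕ → 𝓢(Rn n, ℂ)} (hΨ : ∀ N x, Ψ N x = χ (((N : ℝ) + 1)⁻¹ • x) * ψ x) :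
    Tendsto Ψ atTop (𝓝 ψ) := by
  rw [(schwartz_withSeminorms ℂ (Rn n) ℂ).tendsto_nhds]
  rintro ⟨k, m⟩ ε hε
  -- the derivatives of `χ - 1` are bounded
  set θ : Rn n → ℂ := fun x => χ x - 1 with hθ
  have hθs : ContDiff ℝ ∞ θ := (χ.smooth ⊤).sub contDiff_const
  have hθb : ∀ i, ∃ M : ℝ, 0 ≤ M ∧ ∀ x, ‖iteratedFDeriv ℝ i θ x‖ ≤ M := by
    intro i
    refine ⟨SchwartzMap.seminorm ℝ 0 i χ + 1, by positivity, fun x => ?_⟩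
    have e : iteratedFDeriv ℝ i θ x = iteratedFDeriv ℝ i χ x -
        iteratedFDeriv ℝ i (fun _ : Rn n => (1 : ℂ)) x :=
      iteratedFDeriv_sub_apply (χ.smooth i).contDiffAt contDiffAt_const
    rw [e]
    refine (norm_sub_le _ _).trans
      (add_le_add (SchwartzMap.norm_iteratedFDeriv_le_seminorm ℝ χ i x) ?_)
    rcases eq_or_ne i 0 with rfl | hi
    · simp
    · simp [iteratedFDeriv_const_of_ne hi]
  choose M hM0 hM using hθb
  set B : ℝ := ∑ i ∈ Finset.range (m + 1),
    (m.choose i : ℝ) * M i * SchwartzMap.seminorm ℝ (k + 1) (m - i) ψ with hB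
  have hB0 : 0 ≤ B := Finset.sum_nonneg fun i _ =>
    mul_nonneg (mul_nonneg (by positivity) (hM0 i)) (apply_nonneg _ _)
  have key : ∀ N : ℕ, SchwartzMap.seminorm ℂ k m (Ψ N - ψ) ≤ B * ((N : ℝ) + 1)⁻¹ := by
    intro N
    set c : ℝ := ((N : ℝ) + 1)⁻¹ with hc
    have hc0 : 0 < c := by positivity
    have hc1 : c ≤ 1 := inv_le_one_of_one_le₀ (by linarith [N.cast_nonneg (α := ℝ)])
    set L : Rn n →L[ℝ] Rn n := c • ContinuousLinearMap.id ℝ (Rn n) with hL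
    have hLx : ∀ y, ‖L y‖ = c * ‖y‖ := fun y => by
      change ‖c • y‖ = _
      rw [norm_smul, Real.norm_of_nonneg hc0.le]
    have hLn : ‖L‖ ≤ 1 := by
      refine L.opNorm_le_bound zero_le_one fun x => ?_
      rw [hLx]
      gcongr
    have hfun : (Ψ N - ψ : 𝓢(Rn n, ℂ)) = fun x => (θ ∘ L) x * ψ x := by
      ext x
      simp [hΨ, hθ, hL, hc, sub_mul]
    refine SchwartzMap.seminorm_le_bound ℂ k m _ (by positivity) fun x => ?_
    rw [hfun]
    have hθL : ContDiff ℝ ∞ (θ ∘ L) := hθs.comp L.contDiff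
    have hprod := norm_iteratedFDeriv_mul_le (n := m) hθL (ψ.smooth ⊤) x (by exact_mod_cast le_top)
    have hbd : ∀ i, ‖x‖ ^ k * (‖iteratedFDeriv ℝ i (θ ∘ L) x‖ * ‖iteratedFDeriv ℝ (m - i) ψ x‖) ≤
        M i * (SchwartzMap.seminorm ℝ (k + 1) (m - i) ψ * c) := by
      intro i
      have hs0 : 0 ≤ SchwartzMap.seminorm ℝ (k + 1) (m - i) ψ := apply_nonneg _ _
      by_cases hx : ‖x‖ < (N : ℝ) + 1
      · -- near the origin the cutoff is constant
        have : θ ∘ L =ᶠ[𝓝 x] fun _ => 0 := by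
          filter_upwards [(continuous_norm.isOpen_preimage _ isOpen_Iio).mem_nhds hx] with y hy
          have : ‖L y‖ ≤ 1 := by
            rw [hLx, hc, inv_mul_le_iff₀ (by positivity), mul_one]
            exact le_of_lt hy
          simp [hθ, h1 _ this]
        have e0 : iteratedFDeriv ℝ i (θ ∘ L) x = 0 := by
          rw [(this.iteratedFDeriv (𝕜 := ℝ) i).eq_of_nhds]
          simp [iteratedFDeriv_fun_zero]
        rw [e0, norm_zero, zero_mul, mul_zero]
        exact mul_nonneg (hM0 i) (by positivity)
      · push Not at hx
        have e1 : ‖iteratedFDeriv ℝ i (θ ∘ L) x‖ ≤ M i := by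
          rw [L.iteratedFDeriv_comp_right hθs x (by exact_mod_cast le_top)]
          refine (ContinuousMultilinearMap.norm_compContinuousLinearMap_le _ _).trans ?_
          calc _ ≤ M i * 1 := by
                gcongr
                · exact hM0 i
                · exact hM i _
                · exact Finset.prod_le_one (fun _ _ => norm_nonneg _) fun _ _ => hLn
            _ = M i := mul_one _
        have e2 : ‖x‖ ^ k ≤ ‖x‖ ^ (k + 1) * c := by
          have : 1 ≤ ‖x‖ * c := by
            rw [hc, ← div_eq_mul_inv, le_div_iff₀ (by positivity), one_mul]
            exact hx
          rw [pow_succ, mul_assoc]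
          exact le_mul_of_one_le_right (by positivity) this
        have e3 := SchwartzMap.le_seminorm ℝ (k + 1) (m - i) ψ x
        calc _ ≤ ‖x‖ ^ (k + 1) * c * (M i * ‖iteratedFDeriv ℝ (m - i) ψ x‖) := by gcongr
          _ = M i * (‖x‖ ^ (k + 1) * ‖iteratedFDeriv ℝ (m - i) ψ x‖ * c) := by ring
          _ ≤ _ := by
            have := hM0 i
            gcongr
    calc _ ≤ ‖x‖ ^ k * ∑ i ∈ Finset.range (m + 1),
          (m.choose i : ℝ) * ‖iteratedFDeriv ℝ i (θ ∘ L) x‖ * ‖iteratedFDeriv ℝ (m - i) ψ x‖ := by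
          gcongr
      _ ≤ ∑ i ∈ Finset.range (m + 1),
          (m.choose i : ℝ) * (M i * (SchwartzMap.seminorm ℝ (k + 1) (m - i) ψ * c)) := by
          rw [Finset.mul_sum]
          refine Finset.sum_le_sum fun i _ => ?_
          calc _ = (m.choose i : ℝ) * (‖x‖ ^ k * (‖iteratedFDeriv ℝ i (θ ∘ L) x‖ *
                ‖iteratedFDeriv ℝ (m - i) ψ x‖)) := by ring
            _ ≤ _ := by
              exact mul_le_mul_of_nonneg_left (hbd i) (by positivity)
      _ = B * c := by
          rw [hB, Finset.sum_mul]
          refine Finset.sum_congr rfl fun i _ => ?_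
          ring
  have hlim : Tendsto (fun N : ℕ => B * ((N : ℝ) + 1)⁻¹) atTop (𝓝 0) := by
    have := (tendsto_one_div_add_atTop_nhds_zero_nat (𝕜 := ℝ)).const_mul B
    simpa [one_div] using this
  filter_upwards [hlim.eventually (gt_mem_nhds hε)] with N hN
  exact (key N).trans_lt hN

/-- Compactly supported Schwartz functions determine a tempered distribution. -/
theorem eq_of_forall_hasCompactSupport {S T : 𝓢'(Rn n, ℂ)}
    (h : ∀ ψ : 𝓢(Rn n, ℂ), HasCompactSupport ψ → S ψ = T ψ) : S = T := by
  ext ψ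
  obtain ⟨χ, hχc, hχ1, -⟩ := exists_schwartz_cutoff n 1
  have hgrow : ∀ N : ℕ, (fun x : Rn n => χ (((N : ℝ) + 1)⁻¹ • x)).HasTemperateGrowth := fun N =>
    χ.hasTemperateGrowth.comp (((N : ℝ) + 1)⁻¹ • ContinuousLinearMap.id ℝ (Rn n)).hasTemperateGrowth
  set Ψ : ℕ → 𝓢(Rn n, ℂ) := fun N =>
    SchwartzMap.smulLeftCLM ℂ (fun x : Rn n => χ (((N : ℝ) + 1)⁻¹ • x)) ψ with hΨ
  have hΨa : ∀ N x, Ψ N x = χ (((N : ℝ) + 1)⁻¹ • x) * ψ x := fun N x => by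
    rw [hΨ, SchwartzMap.smulLeftCLM_apply_apply (hgrow N), smul_eq_mul]
  have hlim := tendsto_cutoff_smul ψ hχ1 hΨa
  have hcomp : ∀ N, HasCompactSupport (Ψ N) := fun N => by
    have h1 : HasCompactSupport (fun x : Rn n => χ (((N : ℝ) + 1)⁻¹ • x)) :=
      hχc.comp_homeomorph (Homeomorph.smulOfNeZero (((N : ℝ) + 1)⁻¹) (by positivity))
    have h2 : (Ψ N : Rn n → ℂ) = fun x => χ (((N : ℝ) + 1)⁻¹ • x) * ψ x := funext (hΨa N)
    rw [h2]
    exact h1.mul_right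
  refine tendsto_nhds_unique ((S.continuous.tendsto ψ).comp hlim) ?_
  refine ((T.continuous.tendsto ψ).comp hlim).congr fun N => ?_
  exact (h _ (hcomp N)).symm

end Density

end ModulationIdeals

namespace ModulationIdeals

/-! ### Frequency localisation and the embedding of `M^{p,q}_s` into `𝓕L^q_s` -/

section Window

variable {n : ℕ}

open Filter Topology

/-- The window translated to the lattice point `k`. -/
noncomputable def win (φ : 𝓢(Rn n, ℂ)) (k : Fin n → ℤ) : 𝓢(Rn n, ℂ) :=
  SchwartzMap.compSubConstCLM ℂ (latticePoint k) φ

theorem win_apply (φ : 𝓢(Rn n, ℂ)) (k : Fin n → ℤ) (ξ : Rn n) :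
    win φ k ξ = φ (ξ - latticePoint k) := rfl

theorem IsWindow.norm_le {φ : 𝓢(Rn n, ℂ)} (hφ : IsWindow φ) {ξ : Rn n} (h : φ ξ ≠ 0) :
    ‖ξ‖ ≤ Real.sqrt n := by
  have h1 := hφ.tsupport_subset (subset_tsupport φ h)
  rw [EuclideanSpace.norm_eq]
  apply Real.sqrt_le_sqrt
  calc _ ≤ ∑ _i : Fin n, (1 : ℝ) := by
        refine Finset.sum_le_sum fun i _ => ?_
        rw [Real.norm_eq_abs, sq_abs]
        nlinarith [(h1 i).1, (h1 i).2]
    _ = n := by simp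

theorem IsWindow.win_near {φ : 𝓢(Rn n, ℂ)} (hφ : IsWindow φ) {k : Fin n → ℤ} {ξ : Rn n}
    (h : win φ k ξ ≠ 0) : ‖ξ - latticePoint k‖ ≤ Real.sqrt n :=
  hφ.norm_le h

theorem IsWindow.sum_win {φ : 𝓢(Rn n, ℂ)} (hφ : IsWindow φ) {ξ : Rn n} {s : Finset (Fin n → ℤ)}
    (hs : ∀ k, ‖ξ - latticePoint k‖ ≤ Real.sqrt n → k ∈ s) : ∑ k ∈ s, win φ k ξ = 1 := by
  refine HasSum.unique (hasSum_sum_of_ne_finset_zero fun k hk => ?_) (hφ.hasSum_one ξ)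
  by_contra h
  exact hk (hs k (hφ.win_near h))

theorem exists_enorm_schwartz_le (φ : 𝓢(Rn n, ℂ)) : ∃ B : ℝ≥0∞, B ≠ ∞ ∧ ∀ ξ, ‖φ ξ‖ₑ ≤ B := by
  refine ⟨ENNReal.ofReal (SchwartzMap.seminorm ℝ 0 0 φ), ENNReal.ofReal_ne_top, fun ξ => ?_⟩
  rw [← ofReal_norm]
  exact ENNReal.ofReal_le_ofReal (SchwartzMap.norm_le_seminorm ℝ φ ξ)

theorem tendsto_latticeBox (n : ℕ) :
    Tendsto (fun m : ℕ => latticeBox n m) atTop (atTop : Filter (Finset (Fin n → ℤ))) := by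
  refine tendsto_atTop_finset_of_monotone (fun a b hab => ?_) fun k => ?_
  · have : (a : ℤ) ≤ b := by exact_mod_cast hab
    intro k
    simp only [latticeBox, Fintype.mem_piFinset, Finset.mem_Icc, Int.ceil_natCast]
    exact fun h i => ⟨by linarith [(h i).1], by linarith [(h i).2]⟩
  · obtain ⟨m, hm⟩ := exists_nat_ge ‖latticePoint k‖
    exact ⟨m, mem_latticeBox hm⟩

/-- The `L^p` norm of the frequency localisation of `T` at the lattice point `k`. -/
noncomputable def locNorm (φ : 𝓢(Rn n, ℂ)) (p : ℝ≥0∞) (T : 𝓢'(Rn n, ℂ)) (k : Fin n → ℤ) : ℝ≥0∞ :=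
  weightedLpNorm p 0 (freqLocal φ k T)

theorem modNorm_eq_LN (φ : 𝓢(Rn n, ℂ)) {p q : ℝ≥0∞} (hq : q ≠ ∞) (s : ℝ) (T : 𝓢'(Rn n, ℂ)) :
    modNorm φ p q s T =
      LN q.toReal Measure.count (fun k => wt s (latticePoint k) * locNorm φ p T k) := by
  rw [modNorm, if_neg hq, LN, lintegral_count]
  congr 1
  refine tsum_congr fun k => ?_
  rw [ENNReal.mul_rpow_of_nonneg _ _ ENNReal.toReal_nonneg, wt,
    ENNReal.ofReal_rpow_of_nonneg (Real.rpow_nonneg (bracket_pos _).le s) ENNReal.toReal_nonneg,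
    ← Real.rpow_mul (bracket_pos _).le, locNorm]

theorem locNorm_lt_top {φ : 𝓢(Rn n, ℂ)} {p q : ℝ≥0∞} (hqt : q ≠ ∞) (hr : 1 ≤ q.toReal) {s : ℝ}
    {T : 𝓢'(Rn n, ℂ)} (hT : modNorm φ p q s T < ∞) (k : Fin n → ℤ) : locNorm φ p T k < ∞ := by
  rw [modNorm_eq_LN φ hqt] at hT
  exact lt_top_of_LN_weight_lt_top hr hT k

theorem distFourier_freqLocal (φ : 𝓢(Rn n, ℂ)) (k : Fin n → ℤ) (T : 𝓢'(Rn n, ℂ)) :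
    distFourier (freqLocal φ k T) =
      TemperedDistribution.smulLeftCLM ℂ (win φ k) (distFourier T) := by
  rw [freqLocal, distFourier_distFourierInv]
  rfl

theorem integrable_schwartz_mul (φ : 𝓢(Rn n, ℂ)) {F : Rn n → ℂ} (hF : Integrable F) :
    Integrable (fun ξ => φ ξ * F ξ) :=
  hF.bdd_mul (c := SchwartzMap.seminorm ℝ 0 0 φ) φ.continuous.aestronglyMeasurable
    (.of_forall fun ξ => SchwartzMap.norm_le_seminorm ℝ φ ξ)

theorem isGivenBy_freqLocal (φ : 𝓢(Rn n, ℂ)) (k : Fin n → ℤ) {T : 𝓢'(Rn n, ℂ)} {F : Rn n → ℂ}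
    (hF : Integrable F) (h : IsGivenBy (distFourier T) F) :
    IsGivenBy (freqLocal φ k T) (invFT fun ξ => win φ k ξ * F ξ) :=
  isGivenBy_invFT (integrable_schwartz_mul (win φ k) hF)
    (h.smulLeft (win φ k).hasTemperateGrowth)

theorem locNorm_eq (φ : 𝓢(Rn n, ℂ)) {p : ℝ≥0∞} (k : Fin n → ℤ) {T : 𝓢'(Rn n, ℂ)} {F : Rn n → ℂ}
    (hF : Integrable F) (h : IsGivenBy (distFourier T) F) :
    locNorm φ p T k = eLpNorm (invFT fun ξ => win φ k ξ * F ξ) p volume :=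
  weightedLpNorm_zero_eq (isGivenBy_freqLocal φ k hF h)

/-- The Hausdorff–Young inequality for a frequency localised distribution. The localisation to a
ball allows to lower the exponent from `p'` to `q`. -/
theorem exists_localised_fourier {φ : 𝓢(Rn n, ℂ)} (hφ : IsWindow φ) {p q : ℝ≥0∞} (hp1 : 1 ≤ p)
    (hp2 : p ≤ 2) (hq : q ≤ p.conjExponent) :
    ∃ C : ℝ≥0∞, C ≠ ∞ ∧ ∀ (T : 𝓢'(Rn n, ℂ)) (k : Fin n → ℤ), locNorm φ p T k < ∞ →
      ∃ h, IsGivenBy (TemperedDistribution.smulLeftCLM ℂ (win φ k) (distFourier T)) h ∧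
        (∀ ξ, h ξ ≠ 0 → ‖ξ - latticePoint k‖ ≤ Real.sqrt n + 2) ∧
        eLpNorm h q volume ≤ C * locNorm φ p T k := by
  obtain ⟨C, hC, hHY⟩ := hausdorffYoung n hp1 hp2
  obtain ⟨χ, -, hχ1, hχs, hχb⟩ := exists_schwartz_cutoff n (Real.sqrt n)
  rw [abs_of_nonneg (Real.sqrt_nonneg _)] at hχs
  set V := volume (Metric.closedBall (0 : Rn n) (Real.sqrt n + 2)) with hV
  have hV0 : V ≠ 0 := (Metric.measure_closedBall_pos volume 0 (by positivity)).ne'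
  have hVt : V ≠ ∞ := measure_closedBall_lt_top.ne
  refine ⟨C * V ^ (1 / q.toReal - 1 / p.conjExponent.toReal),
    ENNReal.mul_ne_top hC (ENNReal.rpow_ne_top_of_ne_zero hV0 hVt), fun T k hT => ?_⟩
  obtain ⟨g, hg⟩ := exists_isGivenBy_of_weightedLpNorm hT
  have hgn : locNorm φ p T k = eLpNorm g p volume := weightedLpNorm_zero_eq hg
  rw [hgn] at hT ⊢
  obtain ⟨h, hh, hhb⟩ := hHY _ g hg hT
  rw [distFourier_freqLocal] at hh
  have hmul : (win φ k : Rn n → ℂ) * (win χ k : Rn n → ℂ) = win φ k := by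
    ext ξ
    by_cases hξ : win φ k ξ = 0
    · simp [hξ]
    · have : win χ k ξ = 1 := hχ1 _ (hφ.win_near hξ)
      simp [this]
  have h1 := hh.smulLeft (win χ k).hasTemperateGrowth
  rw [TemperedDistribution.smulLeftCLM_smulLeftCLM_apply (win φ k).hasTemperateGrowth
    (win χ k).hasTemperateGrowth, hmul] at h1
  have hsupp : ∀ ξ, win χ k ξ * h ξ ≠ 0 → ‖ξ - latticePoint k‖ ≤ Real.sqrt n + 2 :=
    fun ξ hξ => hχs _ (left_ne_zero_of_mul hξ)
  refine ⟨_, h1, hsupp, ?_⟩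
  have hsub : Function.support (fun ξ => win χ k ξ * h ξ) ⊆
      Metric.closedBall (latticePoint k) (Real.sqrt n + 2) := fun ξ hξ => by
    rw [mem_closedBall_iff_norm]
    exact hsupp ξ hξ
  rw [← eLpNorm_restrict_eq_of_support_subset hsub]
  calc _ ≤ eLpNorm (fun ξ => win χ k ξ * h ξ) p.conjExponent
          (volume.restrict (Metric.closedBall (latticePoint k) (Real.sqrt n + 2))) *
        V ^ (1 / q.toReal - 1 / p.conjExponent.toReal) := by
        have := eLpNorm_le_eLpNorm_mul_rpow_measure_univ hq
          (h1.1.restrict (s := Metric.closedBall (latticePoint k) (Real.sqrt n + 2)))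
        rwa [Measure.restrict_apply_univ, volume_closedBall_latticePoint] at this
    _ ≤ eLpNorm h p.conjExponent volume * V ^ (1 / q.toReal - 1 / p.conjExponent.toReal) := by
        gcongr
        refine (eLpNorm_mono fun ξ => ?_).trans (eLpNorm_mono_measure h Measure.restrict_le_self)
        rw [norm_mul]
        exact mul_le_of_le_one_left (norm_nonneg _) (hχb _)
    _ ≤ C * eLpNorm g p volume * V ^ (1 / q.toReal - 1 / p.conjExponent.toReal) := by gcongr
    _ = _ := by ring

/-- The Fourier transform of an element of `M^{p,q}_s` is the locally finite sum of its
localisations. Hence it is a function, with weighted norm bounded by the modulation norm. -/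
theorem exists_fourier_of_modNorm {φ : 𝓢(Rn n, ℂ)} (hφ : IsWindow φ) {p q : ℝ≥0∞} {s : ℝ}
    (hp1 : 1 ≤ p) (hp2 : p ≤ 2) (hq1 : 1 ≤ q) (hqt : q ≠ ∞) (hqp : q ≤ p.conjExponent)
    (hadm : Admissible n q.toReal s) :
    ∃ C : ℝ≥0∞, C ≠ ∞ ∧ ∀ T : 𝓢'(Rn n, ℂ), modNorm φ p q s T < ∞ →
      ∃ F, IsGivenBy (distFourier T) F ∧
        LN q.toReal volume (fun ξ => wt s ξ * ‖F ξ‖ₑ) ≤ C * modNorm φ p q s T := by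
  obtain ⟨C, hC, hloc⟩ := exists_localised_fourier hφ hp1 hp2 hqp
  set R := Real.sqrt n + 2 with hR
  have hRn : Real.sqrt n ≤ R := by linarith
  obtain ⟨W, hW, hwt⟩ := exists_wt_le (n := n) hadm.nonneg R
  set r := q.toReal with hr
  have hr1 : 1 ≤ r := hadm.one_le
  have hr0 : 0 < r := by linarith
  refine ⟨(overlap n R ^ (r - 1)) ^ (1 / r) * (W * C), ?_, fun T hT => ?_⟩
  · have := overlap_ne_top (n := n) R
    have : 0 ≤ r - 1 := by linarith
    finiteness
  have hlocT := locNorm_lt_top hqt hr1 hT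
  choose h hgiv hsupp hbd using fun k => hloc T k (hlocT k)
  -- locally, only finitely many localisations contribute
  have hbox : ∀ (M : ℝ) (ξ : Rn n), ‖ξ‖ ≤ M → ∀ k, ‖ξ - latticePoint k‖ ≤ R →
      k ∈ latticeBox n (M + R) := by
    intro M ξ hξ k hk
    apply mem_latticeBox
    have := norm_sub_le ξ (ξ - latticePoint k)
    rw [sub_sub_cancel] at this
    linarith
  have hsum : ∀ (M : ℝ) (ξ : Rn n), ‖ξ‖ ≤ M →
      HasSum (fun k => h k ξ) (∑ k ∈ latticeBox n (M + R), h k ξ) := by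
    intro M ξ hξ
    refine hasSum_sum_of_ne_finset_zero fun k hk => ?_
    by_contra h0
    exact hk (hbox M ξ hξ k (hsupp k ξ h0))
  set F : Rn n → ℂ := fun ξ => ∑' k, h k ξ with hF
  have hFm : AEStronglyMeasurable F := by
    refine aestronglyMeasurable_of_tendsto_ae atTop
      (f := fun m : ℕ => fun ξ => ∑ k ∈ latticeBox n m, h k ξ)
      (fun m => Finset.aestronglyMeasurable_fun_sum _ fun k _ => (hgiv k).1)
      (.of_forall fun ξ => ?_)
    exact ((hsum ‖ξ‖ ξ le_rfl).summable.hasSum).comp (tendsto_latticeBox n)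
  have hFle : ∀ ξ, ‖F ξ‖ₑ ≤ ∑' k, ‖h k ξ‖ₑ := fun ξ => enorm_tsum_le_tsum_enorm
  have hnorm : LN r volume (fun ξ => wt s ξ * ‖F ξ‖ₑ) ≤
      (overlap n R ^ (r - 1)) ^ (1 / r) * (W * C) * modNorm φ p q s T := by
    have hpt : ∀ ξ, (wt s ξ * ‖F ξ‖ₑ) ^ r ≤
        overlap n R ^ (r - 1) * ∑' k, (W * wt s (latticePoint k)) ^ r * ‖h k ξ‖ₑ ^ r := by
      intro ξ
      calc _ ≤ (∑' k, wt s ξ * ‖h k ξ‖ₑ) ^ r := by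
            rw [ENNReal.tsum_mul_left]
            gcongr
            exact hFle ξ
        _ ≤ overlap n R ^ (r - 1) * ∑' k, (wt s ξ * ‖h k ξ‖ₑ) ^ r := by
            refine tsum_rpow_le_of_near hr1 R ξ fun k hk => hsupp k ξ fun h0 => hk ?_
            simp [h0]
        _ ≤ _ := by
            gcongr with k
            rw [← ENNReal.mul_rpow_of_nonneg _ _ hr0.le]
            rcases eq_or_ne (h k ξ) 0 with h0 | h0
            · simp [h0]
            gcongr
            exact hwt _ _ (hsupp k ξ h0)
    have hint : ∫⁻ ξ, (wt s ξ * ‖F ξ‖ₑ) ^ r ≤ overlap n R ^ (r - 1) *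
        ∑' k, (W * C * (wt s (latticePoint k) * locNorm φ p T k)) ^ r := by
      refine (lintegral_mono hpt).trans ?_
      rw [lintegral_const_mul' _ _ (ENNReal.rpow_ne_top_of_nonneg (by linarith) (overlap_ne_top R)),
        lintegral_tsum fun k => ((hgiv k).1.enorm.pow_const r).const_mul _]
      gcongr with k
      rw [lintegral_const_mul' _ _ (ENNReal.rpow_ne_top_of_nonneg hr0.le
        (ENNReal.mul_ne_top hW (wt_ne_top _ _))), hr, lintegral_enorm_rpow_eq_eLpNorm hq1 hqt, ← hr,
        ← ENNReal.mul_rpow_of_nonneg _ _ hr0.le]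
      refine ENNReal.rpow_le_rpow ?_ hr0.le
      calc _ ≤ W * wt s (latticePoint k) * (C * locNorm φ p T k) := by
            gcongr
            exact hbd k
        _ = _ := by ring
    calc _ ≤ (overlap n R ^ (r - 1) *
          ∑' k, (W * C * (wt s (latticePoint k) * locNorm φ p T k)) ^ r) ^ (1 / r) :=
          ENNReal.rpow_le_rpow hint (by positivity)
      _ = _ := by
          rw [ENNReal.mul_rpow_of_nonneg _ _ (by positivity), modNorm_eq_LN φ hqt, mul_assoc,
            ← LN_const_mul hr1 (ENNReal.mul_ne_top hW hC), LN, lintegral_count]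
  obtain ⟨K, hK, hemb⟩ := hadm.embedding
  have hFi : Integrable F := by
    refine ⟨hFm, ?_⟩
    rw [hasFiniteIntegral_iff_enorm]
    refine (hemb _ hFm.enorm).trans_lt (ENNReal.mul_lt_top hK.lt_top (hnorm.trans_lt ?_))
    have := overlap_ne_top (n := n) R
    have : 0 ≤ r - 1 := by linarith
    have := hT.ne
    finiteness
  refine ⟨F, ?_, hnorm⟩
  obtain ⟨S, hS⟩ := exists_isGivenBy le_rfl (memLp_one_iff_integrable.2 hFi)
  suffices hTS : distFourier T = S by rwa [hTS]
  refine eq_of_forall_hasCompactSupport fun ψ hψ => ?_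
  obtain ⟨M, hM⟩ := hψ.isBounded.exists_norm_le
  have hψM : ∀ ξ, ψ ξ ≠ 0 → ‖ξ‖ ≤ M := fun ξ hξ => hM ξ (subset_tsupport ψ hξ)
  have e1 : ψ = ∑ k ∈ latticeBox n (M + R), SchwartzMap.smulLeftCLM ℂ (win φ k) ψ := by
    ext ξ
    rw [sum_apply]
    simp_rw [SchwartzMap.smulLeftCLM_apply_apply (win φ _).hasTemperateGrowth, smul_eq_mul]
    rw [← Finset.sum_mul]
    rcases eq_or_ne (ψ ξ) 0 with h0 | h0
    · simp [h0]
    rw [hφ.sum_win fun k hk => hbox M ξ (hψM ξ h0) k (hk.trans hRn), one_mul]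
  -- by local finiteness both sides are the same finite sum of integrals
  rw [e1, map_sum, ← e1, (hS.2 ψ).2]
  have e2 : ∀ k, distFourier T (SchwartzMap.smulLeftCLM ℂ (win φ k) ψ) = ∫ ξ, h k ξ * ψ ξ :=
    fun k => ((hgiv k).2 ψ).2
  simp_rw [e2]
  rw [← integral_finsetSum _ fun k _ => ((hgiv k).2 ψ).1]
  refine integral_congr_ae (.of_forall fun ξ => ?_)
  simp only
  rw [← Finset.sum_mul]
  rcases eq_or_ne (ψ ξ) 0 with h0 | h0
  · simp [h0]
  rw [← (hsum M ξ (hψM ξ h0)).tsum_eq]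

end Window

end ModulationIdeals

namespace ModulationIdeals

/-! ### Convolution on the Fourier side -/

section Convolution

variable {n : ℕ}

open Filter Topology

/-- The convolution of two functions on `ℝⁿ`. -/
noncomputable def conv (F G : Rn n → ℂ) : Rn n → ℂ :=
  convolution F G (ContinuousLinearMap.mul ℂ ℂ) volume

theorem conv_apply (F G : Rn n → ℂ) (ξ : Rn n) : conv F G ξ = ∫ η, F η * G (ξ - η) := rfl

theorem integrable_conv {F G : Rn n → ℂ} (hF : Integrable F) (hG : Integrable G) :
    Integrable (conv F G) :=
  hF.integrable_convolution _ hG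

theorem enorm_conv_le (F G : Rn n → ℂ) (ξ : Rn n) :
    ‖conv F G ξ‖ₑ ≤ ∫⁻ η, ‖F η‖ₑ * ‖G (ξ - η)‖ₑ := by
  rw [conv_apply]
  refine (enorm_integral_le_lintegral_enorm _).trans_eq (lintegral_congr fun η => ?_)
  rw [enorm_mul]

theorem invFT_conv {F G : Rn n → ℂ} (hF : Integrable F) (hG : Integrable G) (x : Rn n) :
    invFT (conv F G) x = ((2 * Real.pi : ℝ) ^ n : ℝ) * (invFT F x * invFT G x) := by
  simp_rw [invFT_eq_fourier]
  rw [conv, Real.fourier_mul_convolution_eq hF hG]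
  simp only [Complex.real_smul]
  have : ((2 * Real.pi) ^ n : ℂ) ≠ 0 := by
    have : (Real.pi : ℂ) ≠ 0 := by exact_mod_cast Real.pi_ne_zero
    exact pow_ne_zero _ (mul_ne_zero two_ne_zero this)
  push_cast
  field_simp

theorem enorm_invFT_conv_le {F G : Rn n → ℂ} (hF : Integrable F) (hG : Integrable G) (x : Rn n) :
    ‖invFT (conv F G) x‖ₑ ≤ (∫⁻ ξ, ‖F ξ‖ₑ) * ‖invFT G x‖ₑ := by
  rw [invFT_conv hF hG, enorm_mul, enorm_mul, ← mul_assoc]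
  gcongr
  refine (mul_le_mul' le_rfl (enorm_invFT_le F x)).trans_eq ?_
  rw [← mul_assoc, fc, ← ofReal_norm, Complex.norm_real, Real.norm_of_nonneg (by positivity),
    ← ENNReal.ofReal_mul (by positivity), mul_inv_cancel₀ (by positivity), ENNReal.ofReal_one,
    one_mul]

theorem eLpNorm_invFT_conv_le {F G : Rn n → ℂ} (hF : Integrable F) (hG : Integrable G)
    (p : ℝ≥0∞) :
    eLpNorm (invFT (conv F G)) p volume ≤ (∫⁻ ξ, ‖F ξ‖ₑ) * eLpNorm (invFT G) p volume := by
  have h := eLpNorm_le_mul_eLpNorm_of_ae_le_mul' (μ := (volume : Measure (Rn n)))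
    (f := invFT (conv F G)) (g := invFT G) (c := (∫⁻ ξ, ‖F ξ‖ₑ).toNNReal) (p := p)
    (.of_forall fun x => by
      rw [ENNReal.coe_toNNReal (by exact hF.2.ne)]
      exact enorm_invFT_conv_le hF hG x)
  rwa [ENNReal.coe_toNNReal (by exact hF.2.ne)] at h

theorem lintegral_enorm_conv_le {F G : Rn n → ℂ} (hF : Integrable F) (hG : Integrable G) :
    ∫⁻ ξ, ‖conv F G ξ‖ₑ ≤ (∫⁻ ξ, ‖F ξ‖ₑ) * ∫⁻ ξ, ‖G ξ‖ₑ := by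
  have h := LN_conv_le (μ := (volume : Measure (Rn n))) le_rfl hF.1.enorm hG.1.enorm
  simp_rw [LN_one] at h
  exact (lintegral_mono (enorm_conv_le F G)).trans h

/-- A Fourier multiplier with Schwartz symbol is convolution with an integrable kernel. -/
theorem invFT_schwartz_mul (θ : 𝓢(Rn n, ℂ)) {H : Rn n → ℂ} (hH : Integrable H) (x : Rn n) :
    invFT (fun ξ => θ ξ * H ξ) x = ∫ y, invFT θ y * invFT H (x - y) := by
  set κ := schwartzFourierInv n θ with hκ
  have e1 : ∀ ξ, ∫ y, Complex.exp (Complex.I * (⟪ξ, y⟫_ℝ : ℂ)) * κ (-y) = θ ξ := by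
    intro ξ
    rw [← schwartzFourier_schwartzFourierInv θ, schwartzFourier_apply, ← integral_neg_eq_self]
    refine integral_congr_ae (.of_forall fun y => ?_)
    simp only [inner_neg_right, real_inner_comm ξ y, neg_neg, hκ]
    push_cast
    ring_nf
  have hHx := integrable_exp_mul hH x
  have h := integral_mul_integral_exp κ.integrable.comp_neg hHx
  simp_rw [e1] at h
  rw [invFT_schwartz, ← hκ, ← integral_neg_eq_self]
  have e2 : ∀ y, κ (-y) * invFT H (x - -y) = ((2 * Real.pi : ℝ) ^ n : ℝ)⁻¹ •
      (κ (-y) * ∫ ξ, Complex.exp (Complex.I * (⟪y, ξ⟫_ℝ : ℂ)) *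
        (Complex.exp (Complex.I * (⟪x, ξ⟫_ℝ : ℂ)) * H ξ)) := by
    intro y
    rw [invFT, mul_smul_comm]
    congr 3
    ext ξ
    rw [sub_neg_eq_add, inner_add_left, ← mul_assoc, ← Complex.exp_add]
    congr 2
    push_cast
    ring
  simp_rw [e2]
  rw [integral_smul, h, invFT]
  congr 1
  refine integral_congr_ae (.of_forall fun ξ => ?_)
  simp only
  ring

theorem invFT_schwartz_mul_congr (θ : 𝓢(Rn n, ℂ)) {H H' : Rn n → ℂ} (hH : Integrable H)
    (hH' : Integrable H') (h : ∀ x, invFT H x = invFT H' x) :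
    invFT (fun ξ => θ ξ * H ξ) = invFT (fun ξ => θ ξ * H' ξ) := by
  ext x
  rw [invFT_schwartz_mul θ hH, invFT_schwartz_mul θ hH']
  simp_rw [h]

theorem enorm_invFT_win (φ : 𝓢(Rn n, ℂ)) (k : Fin n → ℤ) (x : Rn n) :
    ‖invFT (win φ k) x‖ₑ = ‖invFT φ x‖ₑ := by
  have e : invFT (win φ k) x =
      Complex.exp (Complex.I * (⟪x, latticePoint k⟫_ℝ : ℂ)) * invFT φ x := by
    rw [invFT, invFT, ← integral_add_right_eq_self _ (latticePoint k), mul_smul_comm,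
      ← integral_const_mul]
    congr 2
    ext ξ
    rw [win_apply, add_sub_cancel_right, inner_add_right, ← mul_assoc, ← Complex.exp_add]
    congr 2
    push_cast
    ring
  rw [e, enorm_mul, ← ofReal_norm (Complex.exp _), norm_exp_I_mul, ENNReal.ofReal_one, one_mul]

/-- Frequency localisation is bounded on `L^p`, uniformly in the lattice point. -/
theorem exists_eLpNorm_win_mul_le (φ : 𝓢(Rn n, ℂ)) {p : ℝ≥0∞} (hp1 : 1 ≤ p) (hpt : p ≠ ∞) :
    ∃ C : ℝ≥0∞, C ≠ ∞ ∧ ∀ (k : Fin n → ℤ) (H : Rn n → ℂ), Integrable H →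
      eLpNorm (invFT fun ξ => win φ k ξ * H ξ) p volume ≤ C * eLpNorm (invFT H) p volume := by
  have hi : Integrable (invFT φ) := by
    rw [invFT_schwartz]
    exact (schwartzFourierInv n φ).integrable
  refine ⟨∫⁻ x, ‖invFT φ x‖ₑ, hi.2.ne, fun k H hH => ?_⟩
  have hp : 1 ≤ p.toReal := by
    rwa [← ENNReal.toReal_one, ENNReal.toReal_le_toReal ENNReal.one_ne_top hpt]
  rw [eLpNorm_eq_LN hp1 hpt, eLpNorm_eq_LN hp1 hpt]
  refine le_trans (LN_mono hp fun x => ?_) (LN_conv_le (μ := (volume : Measure (Rn n))) hp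
    hi.1.enorm (continuous_invFT hH).aestronglyMeasurable.enorm)
  rw [invFT_schwartz_mul _ hH]
  refine (enorm_integral_le_lintegral_enorm _).trans_eq (lintegral_congr fun y => ?_)
  rw [enorm_mul, enorm_invFT_win]

/-- The mass of `F` near the lattice point `j`. The radius `2√n` is chosen such that the ball around
`k - l` contains all differences between points in the supports of the windows at `k` and at `l`. -/
noncomputable def mass (F : Rn n → ℂ) (j : Fin n → ℤ) : ℝ≥0∞ :=
  ∫⁻ ξ in Metric.closedBall (latticePoint j) (2 * Real.sqrt n), ‖F ξ‖ₑ

/-- The localisation at `k` of the product of a function `f` with the localisation of `g` at `l`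
involves only the frequencies of `f` near `k - l`. -/
theorem win_mul_conv_win {φ : 𝓢(Rn n, ℂ)} (hφ : IsWindow φ) (F G : Rn n → ℂ) (k l : Fin n → ℤ)
    (ξ : Rn n) :
    win φ k ξ * conv F (fun η => win φ l η * G η) ξ =
      win φ k ξ * conv ((Metric.closedBall (latticePoint (k - l)) (2 * Real.sqrt n)).indicator F)
        (fun η => win φ l η * G η) ξ := by
  by_cases h : win φ k ξ = 0
  · simp [h]
  congr 1
  rw [conv_apply, conv_apply]
  refine integral_congr_ae (.of_forall fun η => ?_)
  simp only
  by_cases h2 : win φ l (ξ - η) = 0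
  · simp [h2]
  rw [Set.indicator_of_mem]
  rw [mem_closedBall_iff_norm, latticePoint_sub]
  have h3 := hφ.win_near h
  have h4 := hφ.win_near h2
  have e : η - (latticePoint k - latticePoint l) =
      (ξ - latticePoint k) - (ξ - η - latticePoint l) := by abel
  rw [e]
  linarith [norm_sub_le (ξ - latticePoint k) (ξ - η - latticePoint l)]

/-- The localisations of a product are controlled by a discrete convolution. The second factor is
decomposed into its localisations; the bound for finite partial sums passes to the limit by Fatou's
lemma, as their convergence in `L¹` implies pointwise convergence after the inverse Fourier
transform. -/
theorem exists_eLpNorm_win_conv_le {φ : 𝓢(Rn n, ℂ)} (hφ : IsWindow φ) {p : ℝ≥0∞} (hp1 : 1 ≤ p)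
    (hpt : p ≠ ∞) :
    ∃ C : ℝ≥0∞, C ≠ ∞ ∧ ∀ F G : Rn n → ℂ, Integrable F → Integrable G → ∀ k : Fin n → ℤ,
      eLpNorm (invFT fun ξ => win φ k ξ * conv F G ξ) p volume ≤
        C * ∑' l, eLpNorm (invFT fun ξ => win φ l ξ * G ξ) p volume * mass F (k - l) := by
  obtain ⟨C, hC, hmult⟩ := exists_eLpNorm_win_mul_le φ hp1 hpt
  obtain ⟨B, hB, hφB⟩ := exists_enorm_schwartz_le φ
  refine ⟨C, hC, fun F G hF hG k => ?_⟩
  have hwin : ∀ l, Integrable fun ξ => win φ l ξ * G ξ :=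
    fun l => integrable_schwartz_mul (win φ l) hG
  have hcw : ∀ l, Integrable (conv F fun ξ => win φ l ξ * G ξ) :=
    fun l => integrable_conv hF (hwin l)
  have hpiece : ∀ l, eLpNorm (invFT fun ξ => win φ k ξ * conv F (fun η => win φ l η * G η) ξ) p
      volume ≤ C * (eLpNorm (invFT fun ξ => win φ l ξ * G ξ) p volume * mass F (k - l)) := by
    intro l
    simp_rw [win_mul_conv_win hφ F G k l]
    have hms : MeasurableSet (Metric.closedBall (latticePoint (k - l)) (2 * Real.sqrt n)) :=
      Metric.isClosed_closedBall.measurableSet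
    have hFi := hF.indicator hms
    refine (hmult k _ (integrable_conv hFi (hwin l))).trans ?_
    gcongr
    refine (eLpNorm_invFT_conv_le hFi (hwin l) p).trans_eq ?_
    rw [mul_comm, mass, ← lintegral_indicator hms]
    simp_rw [enorm_indicator_eq_indicator_enorm]
  set Gm : ℕ → Rn n → ℂ := fun m ξ => ∑ l ∈ latticeBox n m, win φ l ξ * G ξ with hGm
  have hGmi : ∀ m, Integrable (Gm m) := fun m => integrable_finsetSum _ fun l _ => hwin l
  -- the finite partial sums
  have hsplit : ∀ m, invFT (fun ξ => win φ k ξ * conv F (Gm m) ξ) = fun x =>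
      ∑ l ∈ latticeBox n m, invFT (fun ξ => win φ k ξ * conv F (fun η => win φ l η * G η) ξ) x := by
    intro m
    rw [invFT_schwartz_mul_congr (win φ k) (integrable_conv hF (hGmi m))
      (integrable_finsetSum (latticeBox n m) fun l _ => hcw l) fun x => ?_]
    · ext x
      simp_rw [Finset.mul_sum]
      rw [invFT_sum _ fun l _ => integrable_schwartz_mul (win φ k) (hcw l)]
    · rw [invFT_conv hF (hGmi m), hGm, invFT_sum _ fun l _ => hwin l,
        invFT_sum _ fun l _ => hcw l]
      simp_rw [invFT_conv hF (hwin _), Finset.mul_sum]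
  have hbound : ∀ m, eLpNorm (invFT fun ξ => win φ k ξ * conv F (Gm m) ξ) p volume ≤
      C * ∑' l, eLpNorm (invFT fun ξ => win φ l ξ * G ξ) p volume * mass F (k - l) := by
    intro m
    rw [hsplit m, ← ENNReal.tsum_mul_left]
    have e : (fun x => ∑ l ∈ latticeBox n m,
        invFT (fun ξ => win φ k ξ * conv F (fun η => win φ l η * G η) ξ) x) =
        ∑ l ∈ latticeBox n m, invFT (fun ξ => win φ k ξ * conv F (fun η => win φ l η * G η) ξ) := by
      ext x
      simp
    rw [e]
    refine (eLpNorm_sum_le (fun l _ => (continuous_invFT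
      (integrable_schwartz_mul (win φ k) (hcw l))).aestronglyMeasurable) hp1).trans ?_
    exact (Finset.sum_le_sum fun l _ => hpiece l).trans (ENNReal.sum_le_tsum _)
  -- the partial sums converge to `G` in `L¹`
  have hL1 : Tendsto (fun m => ∫⁻ ξ, ‖G ξ - Gm m ξ‖ₑ) atTop (𝓝 0) := by
    have hone : ∀ (m : ℕ) ξ, ‖G ξ - Gm m ξ‖ₑ ≤ (1 + overlap n (Real.sqrt n) * B) * ‖G ξ‖ₑ := by
      intro m ξ
      have e : G ξ - Gm m ξ = (1 - ∑ l ∈ latticeBox n m, win φ l ξ) * G ξ := by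
        rw [hGm, sub_mul, one_mul, Finset.sum_mul]
      rw [e, enorm_mul]
      gcongr
      refine enorm_sub_le.trans ?_
      rw [enorm_one]
      gcongr
      refine (enorm_sum_le _ _).trans ((ENNReal.sum_le_tsum _).trans ?_)
      refine le_trans (ENNReal.tsum_le_tsum fun l => ?_)
        (tsum_indicator_closedBall_le (Real.sqrt n) ξ B)
      by_cases hl : win φ l ξ = 0
      · simp [hl]
      · rw [Set.indicator_of_mem (by rw [mem_closedBall_iff_norm]; exact hφ.win_near hl)]
        exact hφB _
    have hlim := tendsto_lintegral_of_dominated_convergence' (μ := (volume : Measure (Rn n)))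
      (F := fun m ξ => ‖G ξ - Gm m ξ‖ₑ) (f := fun _ => 0)
      (fun ξ => (1 + overlap n (Real.sqrt n) * B) * ‖G ξ‖ₑ)
      (fun m => (hG.sub (hGmi m)).1.enorm) (fun m => .of_forall (hone m)) ?_
      (.of_forall fun ξ => ?_)
    · simpa using hlim
    · rw [lintegral_const_mul'' _ hG.1.enorm]
      have := overlap_ne_top (n := n) (Real.sqrt n)
      have : ∫⁻ ξ, ‖G ξ‖ₑ ≠ ∞ := hG.2.ne
      finiteness
    · refine tendsto_const_nhds.congr' ?_
      obtain ⟨M, hM⟩ := exists_nat_ge (‖ξ‖ + Real.sqrt n)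
      filter_upwards [eventually_ge_atTop M] with m hm
      have : ∑ l ∈ latticeBox n m, win φ l ξ = 1 := by
        refine hφ.sum_win fun l hl => mem_latticeBox ?_
        have h1 := norm_sub_le ξ (ξ - latticePoint l)
        rw [sub_sub_cancel] at h1
        have h2 : (M : ℝ) ≤ m := by exact_mod_cast hm
        linarith
      simp only [hGm]
      rw [← Finset.sum_mul, this]
      simp
  have hconv : ∀ x, Tendsto (fun m => invFT (fun ξ => win φ k ξ * conv F (Gm m) ξ) x) atTop
      (𝓝 (invFT (fun ξ => win φ k ξ * conv F G ξ) x)) := by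
    intro x
    rw [tendsto_iff_edist_tendsto_0]
    have hle : ∀ m, edist (invFT (fun ξ => win φ k ξ * conv F (Gm m) ξ) x)
        (invFT (fun ξ => win φ k ξ * conv F G ξ) x) ≤
        fc n * B * (∫⁻ ξ, ‖F ξ‖ₑ) * ∫⁻ ξ, ‖G ξ - Gm m ξ‖ₑ := by
      intro m
      have hD : Integrable (fun ξ => G ξ - Gm m ξ) := hG.sub (hGmi m)
      have h1 := integrable_conv hF hG
      have h2 := integrable_conv hF (hGmi m)
      have e : invFT (fun ξ => win φ k ξ * conv F G ξ) x -
          invFT (fun ξ => win φ k ξ * conv F (Gm m) ξ) x =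
          invFT (fun ξ => win φ k ξ * conv F (fun η => G η - Gm m η) ξ) x := by
        rw [← invFT_sub (integrable_schwartz_mul _ h1) (integrable_schwartz_mul _ h2)]
        simp_rw [← mul_sub]
        refine congrFun (invFT_schwartz_mul_congr (win φ k) (h1.sub h2)
          (integrable_conv hF hD) fun y => ?_) x
        refine (invFT_sub h1 h2 y).trans ?_
        rw [invFT_conv hF hG, invFT_conv hF (hGmi m), invFT_conv hF hD, invFT_sub hG (hGmi m)]
        ring
      rw [edist_comm, edist_eq_enorm_sub, e]
      refine (enorm_invFT_le _ _).trans ?_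
      rw [mul_assoc, mul_assoc]
      gcongr
      calc _ ≤ ∫⁻ ξ, B * ‖conv F (fun η => G η - Gm m η) ξ‖ₑ := by
            refine lintegral_mono fun ξ => ?_
            rw [enorm_mul]
            gcongr
            exact hφB _
        _ ≤ _ := by
            rw [lintegral_const_mul' _ _ hB]
            gcongr
            exact lintegral_enorm_conv_le hF hD
    refine tendsto_of_tendsto_of_tendsto_of_le_of_le tendsto_const_nhds ?_
      (fun m => zero_le) hle
    have := ENNReal.Tendsto.const_mul (a := fc n * B * ∫⁻ ξ, ‖F ξ‖ₑ) hL1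
      (Or.inr (ENNReal.mul_ne_top (ENNReal.mul_ne_top (fc_ne_top n) hB) hF.2.ne))
    simpa using this
  refine (Lp.eLpNorm_lim_le_liminf_eLpNorm (fun m => (continuous_invFT
    (integrable_schwartz_mul (win φ k) (integrable_conv hF (hGmi m)))).aestronglyMeasurable) _
    (.of_forall hconv)).trans ?_
  exact liminf_le_of_le (by isBoundedDefault) fun b hb => by
    obtain ⟨m, hm⟩ := hb.exists
    exact hm.trans (hbound m)

end Convolution

end ModulationIdeals

namespace ModulationIdeals

/-! ### Norm estimates for products -/

section Product

variable {n : ℕ}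

open Filter Topology

/-- `𝓕L^q_s` is a convolution algebra on the Fourier side. -/
theorem exists_LN_conv_le {r s : ℝ} (h : Admissible n r s) :
    ∃ C : ℝ≥0∞, C ≠ ∞ ∧ ∀ F G : Rn n → ℂ, AEStronglyMeasurable F → AEStronglyMeasurable G →
      LN r volume (fun ξ => wt s ξ * ‖conv F G ξ‖ₑ) ≤
        C * (LN r volume (fun ξ => wt s ξ * ‖F ξ‖ₑ) * LN r volume (fun ξ => wt s ξ * ‖G ξ‖ₑ)) := by
  obtain ⟨K, hK, hemb⟩ := h.embedding
  refine ⟨ENNReal.ofReal (2 ^ s) * (2 * K), by finiteness, fun F G hF hG => ?_⟩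
  calc _ ≤ LN r volume (fun ξ => wt s ξ * ∫⁻ η, ‖F η‖ₑ * ‖G (ξ - η)‖ₑ) :=
        LN_mono h.one_le fun ξ => mul_le_mul' le_rfl (enorm_conv_le F G ξ)
    _ ≤ _ := LN_weight_conv_le h.one_le ENNReal.ofReal_ne_top (wt_add_le h.nonneg)
        (measurable_wt s) (wt_ne_top s) hF.enorm hG.enorm
    _ ≤ ENNReal.ofReal (2 ^ s) *
        (LN r volume (fun ξ => wt s ξ * ‖F ξ‖ₑ) * (K * LN r volume (fun ξ => wt s ξ * ‖G ξ‖ₑ)) +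
          K * LN r volume (fun ξ => wt s ξ * ‖F ξ‖ₑ) * LN r volume (fun ξ => wt s ξ * ‖G ξ‖ₑ)) := by
        gcongr
        · exact hemb _ hG.enorm
        · exact hemb _ hF.enorm
    _ = _ := by ring

/-- The weighted `ℓ^r` norm of the masses near lattice points is bounded by the weighted `L^r`
norm. -/
theorem exists_LN_mass_le {r s : ℝ} (h : Admissible n r s) :
    ∃ C : ℝ≥0∞, C ≠ ∞ ∧ ∀ F : Rn n → ℂ, AEStronglyMeasurable F →
      LN r Measure.count (fun k => wt s (latticePoint k) * mass F k) ≤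
        C * LN r volume (fun ξ => wt s ξ * ‖F ξ‖ₑ) := by
  have hr := h.one_le
  have hr0 : 0 < r := by linarith
  set R := 2 * Real.sqrt n with hR
  obtain ⟨W, hW, hwt⟩ := exists_wt_le (n := n) h.nonneg R
  set V := volume (Metric.closedBall (0 : Rn n) R) with hV
  have hVt : V ≠ ∞ := measure_closedBall_lt_top.ne
  have hrs : 0 ≤ r - 1 := by linarith
  have hov := overlap_ne_top (n := n) R
  refine ⟨(V ^ (r - 1) * W ^ r * overlap n R) ^ (1 / r), by finiteness, fun F hF => ?_⟩
  have hpt : ∀ k : Fin n → ℤ, (wt s (latticePoint k) * mass F k) ^ r ≤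
      V ^ (r - 1) * W ^ r *
        ∫⁻ ξ in Metric.closedBall (latticePoint k) R, (wt s ξ * ‖F ξ‖ₑ) ^ r := by
    intro k
    have h1 := lintegral_rpow_le hr
      (hF.enorm.restrict (s := Metric.closedBall (latticePoint k) R))
    rw [Measure.restrict_apply_univ, volume_closedBall_latticePoint] at h1
    rw [ENNReal.mul_rpow_of_nonneg _ _ hr0.le]
    calc _ ≤ wt s (latticePoint k) ^ r *
          (V ^ (r - 1) * ∫⁻ ξ in Metric.closedBall (latticePoint k) R, ‖F ξ‖ₑ ^ r) :=
          mul_le_mul' le_rfl h1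
      _ = V ^ (r - 1) * ∫⁻ ξ in Metric.closedBall (latticePoint k) R,
          (wt s (latticePoint k) * ‖F ξ‖ₑ) ^ r := by
          simp_rw [ENNReal.mul_rpow_of_nonneg _ _ hr0.le]
          have := wt_ne_top s (latticePoint k)
          rw [lintegral_const_mul' _ _ (by finiteness)]
          ring
      _ ≤ V ^ (r - 1) * ∫⁻ ξ in Metric.closedBall (latticePoint k) R,
          W ^ r * (wt s ξ * ‖F ξ‖ₑ) ^ r := by
          refine mul_le_mul' le_rfl (setLIntegral_mono' Metric.isClosed_closedBall.measurableSet
            fun ξ hξ => ?_)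
          rw [← ENNReal.mul_rpow_of_nonneg _ _ hr0.le, ← mul_assoc]
          refine ENNReal.rpow_le_rpow (mul_le_mul' (hwt _ _ ?_) le_rfl) hr0.le
          rwa [mem_closedBall_iff_norm, norm_sub_rev] at hξ
      _ = _ := by
          rw [lintegral_const_mul' _ _ (by finiteness), mul_assoc]
  rw [LN, LN, ← ENNReal.mul_rpow_of_nonneg _ _ (by positivity), lintegral_count]
  refine ENNReal.rpow_le_rpow ?_ (by positivity)
  refine (ENNReal.tsum_le_tsum hpt).trans ?_
  rw [ENNReal.tsum_mul_left, mul_assoc (V ^ (r - 1) * W ^ r)]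
  exact mul_le_mul' le_rfl (tsum_setLIntegral_closedBall_le R
    (((measurable_wt s).aemeasurable.mul hF.enorm).pow_const r))

theorem tsum_mass_le {F : Rn n → ℂ} (hF : AEStronglyMeasurable F) :
    ∑' k : Fin n → ℤ, mass F k ≤ overlap n (2 * Real.sqrt n) * ∫⁻ ξ, ‖F ξ‖ₑ :=
  tsum_setLIntegral_closedBall_le _ hF.enorm

/-- The modulation norm, computed on the Fourier side. -/
noncomputable def modNormHat (φ : 𝓢(Rn n, ℂ)) (p : ℝ≥0∞) (r s : ℝ) (F : Rn n → ℂ) : ℝ≥0∞ :=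
  LN r Measure.count fun k =>
    wt s (latticePoint k) * eLpNorm (invFT fun ξ => win φ k ξ * F ξ) p volume

theorem modNorm_eq_modNormHat (φ : 𝓢(Rn n, ℂ)) {p q : ℝ≥0∞} (hq : q ≠ ∞) (s : ℝ)
    {T : 𝓢'(Rn n, ℂ)} {F : Rn n → ℂ} (hF : Integrable F) (h : IsGivenBy (distFourier T) F) :
    modNorm φ p q s T = modNormHat φ p q.toReal s F := by
  rw [modNorm_eq_LN φ hq, modNormHat]
  simp_rw [locNorm_eq φ _ hF h]

/-- `M^{p,q}_s` is a module over `𝓕L^q_s`. -/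
theorem exists_modNormHat_conv_le {φ : 𝓢(Rn n, ℂ)} (hφ : IsWindow φ) {p : ℝ≥0∞} (hp1 : 1 ≤ p)
    (hpt : p ≠ ∞) {r s : ℝ} (h : Admissible n r s) :
    ∃ C : ℝ≥0∞, C ≠ ∞ ∧ ∀ F G : Rn n → ℂ, Integrable F → Integrable G →
      modNormHat φ p r s (conv F G) ≤
        C * (LN r volume (fun ξ => wt s ξ * ‖F ξ‖ₑ) * modNormHat φ p r s G) := by
  obtain ⟨C, hC, hloc⟩ := exists_eLpNorm_win_conv_le hφ hp1 hpt
  obtain ⟨K, hK, hemb⟩ := h.embedding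
  obtain ⟨K', hK', hemb'⟩ := h.tsum_le
  obtain ⟨A, hA, hmass⟩ := exists_LN_mass_le h
  have hov := overlap_ne_top (n := n) (2 * Real.sqrt n)
  refine ⟨C * (ENNReal.ofReal (2 ^ s) * (overlap n (2 * Real.sqrt n) * K + K' * A)),
    by finiteness, fun F G hF hG => ?_⟩
  set f := LN r volume (fun ξ => wt s ξ * ‖F ξ‖ₑ) with hf
  set b : (Fin n → ℤ) → ℝ≥0∞ := fun l => eLpNorm (invFT fun ξ => win φ l ξ * G ξ) p volume with hb
  have hbG : modNormHat φ p r s G = LN r Measure.count (fun k => wt s (latticePoint k) * b k) := rfl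
  have hW : ∀ j k : Fin n → ℤ, wt s (latticePoint (j + k)) ≤
      ENNReal.ofReal (2 ^ s) * (wt s (latticePoint j) + wt s (latticePoint k)) := fun j k => by
    rw [latticePoint_add]
    exact wt_add_le h.nonneg _ _
  have hcv := LN_weight_conv_le (μ := (Measure.count : Measure (Fin n → ℤ))) h.one_le
    ENNReal.ofReal_ne_top hW Measurable.of_discrete (fun _ => wt_ne_top s _)
    (f := b) (g := mass F) Measurable.of_discrete.aemeasurable Measurable.of_discrete.aemeasurable
  simp_rw [lintegral_count] at hcv
  calc modNormHat φ p r s (conv F G)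
      ≤ LN r Measure.count (fun k => C * (wt s (latticePoint k) * ∑' l, b l * mass F (k - l))) := by
        refine LN_mono h.one_le fun k => ?_
        rw [mul_left_comm]
        exact mul_le_mul' le_rfl (hloc F G hF hG k)
    _ = C * LN r Measure.count (fun k => wt s (latticePoint k) * ∑' l, b l * mass F (k - l)) :=
        LN_const_mul h.one_le hC _
    _ ≤ C * (ENNReal.ofReal (2 ^ s) * (modNormHat φ p r s G *
          (overlap n (2 * Real.sqrt n) * (K * f)) + K' * modNormHat φ p r s G * (A * f))) := by
        refine mul_le_mul' le_rfl (hcv.trans ?_)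
        rw [hbG]
        gcongr
        · refine (tsum_mass_le hF.1).trans ?_
          gcongr
          exact hemb _ hF.1.enorm
        · exact hemb' b
        · exact hmass F hF.1
    _ = _ := by ring

/-! ### Approximate units -/

/-- Smooth mollifiers, supported in shrinking balls around the origin. -/
theorem exists_mollifier (n : ℕ) : ∃ κ : ℕ → 𝓢(Rn n, ℂ), ∀ m, HasCompactSupport (κ m) ∧
    (∀ ξ, κ m ξ ≠ 0 → ‖ξ‖ ≤ 1 / ((m : ℝ) + 1)) ∧ ∫⁻ ξ, ‖κ m ξ‖ₑ = 1 ∧ ∫ ξ, κ m ξ = 1 := by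
  suffices h : ∀ m : ℕ, ∃ κ : 𝓢(Rn n, ℂ), HasCompactSupport κ ∧
      (∀ ξ, κ ξ ≠ 0 → ‖ξ‖ ≤ 1 / ((m : ℝ) + 1)) ∧ ∫⁻ ξ, ‖κ ξ‖ₑ = 1 ∧ ∫ ξ, κ ξ = 1 by
    choose κ hκ using h
    exact ⟨κ, hκ⟩
  intro m
  have hδ : (0 : ℝ) < 1 / ((m : ℝ) + 1) := by positivity
  let f : ContDiffBump (0 : Rn n) := ⟨1 / ((m : ℝ) + 1) / 2, 1 / ((m : ℝ) + 1), by positivity,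
    by linarith⟩
  have h1 : HasCompactSupport (fun x => (f.normed volume x : ℂ)) :=
    f.hasCompactSupport_normed.comp_left (g := Complex.ofReal) Complex.ofReal_zero
  have h2 : ContDiff ℝ ((⊤ : ℕ∞) : WithTop ℕ∞) (fun x => (f.normed volume x : ℂ)) :=
    Complex.ofRealCLM.contDiff.comp f.contDiff_normed
  have hint : ∫ ξ, f.normed volume ξ = 1 := f.integral_normed
  refine ⟨h1.toSchwartzMap h2, h1, fun ξ hξ => ?_, ?_, ?_⟩
  · have h3 : f.normed volume ξ ≠ 0 := fun h0 => hξ (by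
      change ((f.normed volume ξ : ℝ) : ℂ) = 0
      rw [h0, Complex.ofReal_zero])
    have h4 : ξ ∈ Function.support (f.normed volume) := h3
    rw [f.support_normed_eq, mem_ball_zero_iff] at h4
    exact h4.le
  · calc ∫⁻ ξ, ‖((f.normed volume ξ : ℝ) : ℂ)‖ₑ = ∫⁻ ξ, ENNReal.ofReal (f.normed volume ξ) := by
          refine lintegral_congr fun ξ => ?_
          rw [← ofReal_norm, Complex.norm_real, Real.norm_of_nonneg (f.nonneg_normed ξ)]
      _ = 1 := by
          rw [← ofReal_integral_eq_lintegral_ofReal f.integrable_normed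
            (.of_forall fun ξ => f.nonneg_normed ξ), hint, ENNReal.ofReal_one]
  · change ∫ ξ, ((f.normed volume ξ : ℝ) : ℂ) = 1
    exact (integral_ofReal (𝕜 := ℂ) (f := f.normed volume)).trans
      (by rw [hint]; exact Complex.ofReal_one)

/-- Convolution with the mollifiers is uniformly bounded on the weighted space. -/
theorem exists_LN_mollifier_le {r s : ℝ} (h : Admissible n r s) :
    ∃ C : ℝ≥0∞, C ≠ ∞ ∧ ∀ κ : 𝓢(Rn n, ℂ), (∀ ξ, κ ξ ≠ 0 → ‖ξ‖ ≤ 1) → ∫⁻ ξ, ‖κ ξ‖ₑ = 1 →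
      ∀ F : Rn n → ℂ, AEStronglyMeasurable F →
        LN r volume (fun ξ => wt s ξ * ‖conv κ F ξ‖ₑ) ≤
          C * LN r volume (fun ξ => wt s ξ * ‖F ξ‖ₑ) := by
  obtain ⟨W, hW, hwt⟩ := exists_wt_le (n := n) h.nonneg 1
  refine ⟨W, hW, fun κ hκ hκ1 F hF => ?_⟩
  have hWF : AEMeasurable (fun ξ => wt s ξ * ‖F ξ‖ₑ) := (measurable_wt s).aemeasurable.mul hF.enorm
  have hκm : AEMeasurable (fun ξ => ‖κ ξ‖ₑ) := κ.continuous.aestronglyMeasurable.enorm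
  calc _ ≤ LN r volume
        (fun ξ => W * ∫⁻ η, ‖κ η‖ₑ * (wt s (ξ - η) * ‖F (ξ - η)‖ₑ)) := by
        refine LN_mono h.one_le fun ξ => ?_
        refine (mul_le_mul' le_rfl (enorm_conv_le _ F ξ)).trans ?_
        rw [← lintegral_const_mul' _ _ (wt_ne_top s ξ), ← lintegral_const_mul' _ _ hW]
        refine lintegral_mono fun η => ?_
        by_cases h0 : κ η = 0
        · simp [h0]
        calc wt s ξ * (‖κ η‖ₑ * ‖F (ξ - η)‖ₑ)
            ≤ W * wt s (ξ - η) * (‖κ η‖ₑ * ‖F (ξ - η)‖ₑ) := by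
              refine mul_le_mul' (hwt _ _ ?_) le_rfl
              rw [sub_sub_cancel]
              exact hκ η h0
          _ = _ := by ring
    _ ≤ _ := by
        rw [LN_const_mul h.one_le hW]
        refine mul_le_mul' le_rfl ((LN_conv_le h.one_le hκm hWF).trans_eq ?_)
        rw [hκ1, one_mul]

theorem tendsto_LN_zero {α : Type*} [MeasurableSpace α] {μ : Measure α} {r : ℝ} (hr : 1 ≤ r)
    {f : ℕ → α → ℝ≥0∞} {g : α → ℝ≥0∞} (hf : ∀ m, AEMeasurable (f m) μ) (hle : ∀ m x, f m x ≤ g x)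
    (hg : LN r μ g < ∞) (hlim : ∀ x, Tendsto (fun m => f m x) atTop (𝓝 0)) :
    Tendsto (fun m => LN r μ (f m)) atTop (𝓝 0) := by
  have hr0 : 0 < r := by linarith
  have hpow : ∀ {y : ℝ}, 0 < y → Tendsto (fun x : ℝ≥0∞ => x ^ y) (𝓝 0) (𝓝 0) := fun {y} hy => by
    have := (ENNReal.continuous_rpow_const (y := y)).tendsto 0
    rwa [ENNReal.zero_rpow_of_pos hy] at this
  have h := tendsto_lintegral_of_dominated_convergence' (μ := μ) (F := fun m x => f m x ^ r)
    (f := fun _ => 0) (fun x => g x ^ r) (fun m => (hf m).pow_const _)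
    (fun m => .of_forall fun x => ENNReal.rpow_le_rpow (hle m x) hr0.le)
    ((LN_lt_top_iff hr).1 hg).ne (.of_forall fun x => (hpow hr0).comp (hlim x))
  rw [lintegral_zero] at h
  exact (hpow (by positivity)).comp h

theorem LN_sum_le {α ι : Type*} [MeasurableSpace α] {μ : Measure α} {r : ℝ} (hr : 1 ≤ r)
    (t : Finset ι) {f : ι → α → ℝ≥0∞} (hf : ∀ i, AEMeasurable (f i) μ) :
    LN r μ (fun x => ∑ i ∈ t, f i x) ≤ ∑ i ∈ t, LN r μ (f i) := by
  classical
  induction t using Finset.induction_on with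
  | empty =>
    have : 0 < r := by linarith
    simp [LN, this]
  | insert i t hi ih =>
    simp_rw [Finset.sum_insert hi]
    exact (LN_add_le hr (hf i) (Finset.aemeasurable_fun_sum t fun j _ => hf j)).trans
      (add_le_add le_rfl ih)

theorem LN_count_comp_add (r : ℝ) (f : (Fin n → ℤ) → ℝ≥0∞) (j : Fin n → ℤ) :
    LN r Measure.count (fun k => f (k + j)) = LN r Measure.count f := by
  unfold LN
  rw [lintegral_count, lintegral_count]
  congr 1
  exact (Equiv.addRight j).tsum_eq fun k => f k ^ r

/-- Multiplication by `x ↦ ∫ e^{i x·ξ} κ_m(ξ) dξ` approximates the identity in `L^p`. -/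
theorem tendsto_eLpNorm_mollifier {κ : ℕ → 𝓢(Rn n, ℂ)} (hκ : ∀ m, HasCompactSupport (κ m) ∧
    (∀ ξ, κ m ξ ≠ 0 → ‖ξ‖ ≤ 1 / ((m : ℝ) + 1)) ∧ ∫⁻ ξ, ‖κ m ξ‖ₑ = 1 ∧ ∫ ξ, κ m ξ = 1)
    {p : ℝ≥0∞} (hp1 : 1 ≤ p) (hpt : p ≠ ∞) {F : Rn n → ℂ} (hF : Integrable F)
    (hFp : eLpNorm (invFT F) p volume < ∞) :
    Tendsto (fun m => eLpNorm (invFT fun ξ => conv (κ m) F ξ - F ξ) p volume) atTop (𝓝 0) ∧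
      ∀ m, eLpNorm (invFT fun ξ => conv (κ m) F ξ - F ξ) p volume ≤
        2 * eLpNorm (invFT F) p volume := by
  have hpr : 1 ≤ p.toReal := by
    rwa [← ENNReal.toReal_one, ENNReal.toReal_le_toReal ENNReal.one_ne_top hpt]
  -- convolution with `κ m` is multiplication by `u m` after the inverse Fourier transform
  set u : ℕ → Rn n → ℂ := fun m x => ((2 * Real.pi : ℝ) ^ n : ℝ) * invFT (κ m) x with hu
  have hval : ∀ m x, u m x = ∫ ξ, Complex.exp (Complex.I * (⟪x, ξ⟫_ℝ : ℂ)) * κ m ξ := by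
    intro m x
    have : ((2 * Real.pi : ℝ) ^ n : ℝ) ≠ 0 := by positivity
    simp only [hu, invFT]
    rw [← Complex.real_smul, smul_smul, mul_inv_cancel₀ this, one_smul]
  have hub : ∀ m x, ‖u m x‖ₑ ≤ 1 := by
    intro m x
    rw [hval, ← (hκ m).2.2.1]
    refine (enorm_integral_le_lintegral_enorm _).trans_eq (lintegral_congr fun ξ => ?_)
    rw [enorm_mul, ← ofReal_norm (Complex.exp _), norm_exp_I_mul, ENNReal.ofReal_one, one_mul]
  have hconv : ∀ m x, invFT (fun ξ => conv (κ m) F ξ - F ξ) x = (u m x - 1) * invFT F x := by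
    intro m x
    rw [invFT_sub (integrable_conv (κ m).integrable hF) hF, invFT_conv (κ m).integrable hF, hu]
    ring
  have hle : ∀ m x, ‖invFT (fun ξ => conv (κ m) F ξ - F ξ) x‖ₑ ≤ 2 * ‖invFT F x‖ₑ := by
    intro m x
    rw [hconv, enorm_mul]
    gcongr
    refine enorm_sub_le.trans ?_
    rw [enorm_one, show (2 : ℝ≥0∞) = 1 + 1 by norm_num]
    gcongr
    exact hub m x
  -- since `κ m` has integral `1`, and `|e^{i x·ξ} - 1| ≤ ‖x‖ ‖ξ‖` on its small support
  have hone : ∀ x, Tendsto (fun m => u m x) atTop (𝓝 1) := by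
    intro x
    rw [tendsto_iff_norm_sub_tendsto_zero]
    have hb : ∀ m, ‖u m x - 1‖ ≤ ‖x‖ * (1 / ((m : ℝ) + 1)) := by
      intro m
      have e : u m x - 1 = ∫ ξ, (Complex.exp (Complex.I * (⟪x, ξ⟫_ℝ : ℂ)) - 1) * κ m ξ := by
        rw [hval]
        simp_rw [sub_mul, one_mul]
        rw [integral_sub (integrable_exp_mul (κ m).integrable x) (κ m).integrable, (hκ m).2.2.2]
      rw [e]
      have h1 : ∫ ξ, ‖κ m ξ‖ = 1 := by
        rw [integral_norm_eq_lintegral_enorm (κ m).continuous.aestronglyMeasurable, (hκ m).2.2.1,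
          ENNReal.toReal_one]
      calc _ ≤ ∫ ξ, ‖x‖ * (1 / ((m : ℝ) + 1)) * ‖κ m ξ‖ := by
            refine norm_integral_le_of_norm_le ((κ m).integrable.norm.const_mul _)
              (.of_forall fun ξ => ?_)
            rw [norm_mul]
            rcases eq_or_ne (κ m ξ) 0 with h0 | h0
            · simp [h0]
            gcongr
            refine (Real.norm_exp_I_mul_ofReal_sub_one_le).trans ?_
            refine (norm_inner_le_norm x ξ).trans ?_
            gcongr
            exact (hκ m).2.1 ξ h0
        _ = _ := by rw [integral_const_mul, h1, mul_one]
    refine squeeze_zero (fun m => norm_nonneg _) hb ?_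
    simpa using (tendsto_one_div_add_atTop_nhds_zero_nat (𝕜 := ℝ)).const_mul ‖x‖
  constructor
  · simp_rw [eLpNorm_eq_LN hp1 hpt]
    refine tendsto_LN_zero hpr (fun m => (continuous_invFT
      ((integrable_conv (κ m).integrable hF).sub hF)).aestronglyMeasurable.enorm) hle ?_ fun x => ?_
    · rw [LN_const_mul hpr (by finiteness), ← eLpNorm_eq_LN hp1 hpt]
      exact ENNReal.mul_lt_top (by finiteness) hFp
    · have h1 : Tendsto (fun m => invFT (fun ξ => conv (κ m) F ξ - F ξ) x) atTop (𝓝 0) := by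
        simp_rw [hconv]
        simpa using ((hone x).sub_const 1).mul_const (invFT F x)
      simpa using h1.enorm
  · intro m
    have h := eLpNorm_le_mul_eLpNorm_of_ae_le_mul' (μ := (volume : Measure (Rn n)))
      (f := invFT fun ξ => conv (κ m) F ξ - F ξ) (g := invFT F) (c := 2) (p := p)
      (.of_forall fun x => hle m x)
    exact h

end Product

end ModulationIdeals

namespace ModulationIdeals

section Approximation

variable {n : ℕ}

open Filter Topology

/-- The mollifications `κ_m * F` converge to `F` in the modulation norm. A localisation of
`κ_m * F` depends only on finitely many neighbouring localisations of `F`, so that this follows from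
convergence in `L^p` by dominated convergence over the lattice. -/
theorem tendsto_modNormHat_mollifier {φ : 𝓢(Rn n, ℂ)} (hφ : IsWindow φ) {κ : ℕ → 𝓢(Rn n, ℂ)}
    (hκ : ∀ m, HasCompactSupport (κ m) ∧
      (∀ ξ, κ m ξ ≠ 0 → ‖ξ‖ ≤ 1 / ((m : ℝ) + 1)) ∧ ∫⁻ ξ, ‖κ m ξ‖ₑ = 1 ∧ ∫ ξ, κ m ξ = 1)
    {p : ℝ≥0∞} (hp1 : 1 ≤ p) (hpt : p ≠ ∞) {r s : ℝ} (hr : 1 ≤ r) (hs : 0 ≤ s)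
    {F : Rn n → ℂ} (hF : Integrable F) (hfin : modNormHat φ p r s F < ∞) :
    Tendsto (fun m => modNormHat φ p r s fun ξ => conv (κ m) F ξ - F ξ) atTop (𝓝 0) := by
  have hr0 : 0 < r := by linarith
  obtain ⟨C, hC, hwin⟩ := exists_eLpNorm_win_mul_le φ hp1 hpt
  set t := latticeBox n (2 * Real.sqrt n + 1) with ht
  set b : (Fin n → ℤ) → ℝ≥0∞ := fun k => eLpNorm (invFT fun ξ => win φ k ξ * F ξ) p volume with hb
  have hbt : ∀ k, b k ≠ ∞ := fun k => (lt_top_of_LN_weight_lt_top hr hfin k).ne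
  -- the part of `F` that contributes to the localisation of a mollification at `k`
  set P : (Fin n → ℤ) → Rn n → ℂ := fun k ξ => ∑ j ∈ t, win φ (k + j) ξ * F ξ with hP
  have hPi : ∀ k, Integrable (P k) := fun k =>
    integrable_finsetSum _ fun j _ => integrable_schwartz_mul (win φ (k + j)) hF
  have hPeq : ∀ k ξ, ‖ξ - latticePoint k‖ ≤ Real.sqrt n + 1 → P k ξ = F ξ := by
    intro k ξ hξ
    have h1 : ∑ j ∈ t, win φ (k + j) ξ = 1 := by
      have h2 : ∀ j, win φ (k + j) ξ = win φ j (ξ - latticePoint k) := fun j => by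
        rw [win_apply, win_apply, latticePoint_add, sub_sub]
      simp_rw [h2]
      refine hφ.sum_win fun j hj => mem_latticeBox ?_
      have := norm_sub_le (ξ - latticePoint k) (ξ - latticePoint k - latticePoint j)
      rw [sub_sub_cancel] at this
      linarith
    simp only [hP]
    rw [← Finset.sum_mul, h1, one_mul]
  have hPb : ∀ k, eLpNorm (invFT (P k)) p volume ≤ ∑ j ∈ t, b (k + j) := by
    intro k
    have e : invFT (P k) = ∑ j ∈ t, invFT fun ξ => win φ (k + j) ξ * F ξ := by
      ext x
      rw [Finset.sum_apply]
      exact invFT_sum t (fun j _ => integrable_schwartz_mul (win φ (k + j)) hF) x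
    rw [e]
    exact eLpNorm_sum_le (fun j _ =>
      (continuous_invFT (integrable_schwartz_mul (win φ (k + j)) hF)).aestronglyMeasurable) hp1
  have hPt : ∀ k, eLpNorm (invFT (P k)) p volume < ∞ := fun k =>
    (hPb k).trans_lt (ENNReal.sum_lt_top.2 fun j _ => (hbt _).lt_top)
  set D : ℕ → (Fin n → ℤ) → ℝ≥0∞ := fun m k =>
    eLpNorm (invFT fun ξ => conv (κ m) (P k) ξ - P k ξ) p volume with hD
  have hmoll := fun k => tendsto_eLpNorm_mollifier hκ hp1 hpt (hPi k) (hPt k)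
  have hle : ∀ m k, eLpNorm (invFT fun ξ => win φ k ξ * (conv (κ m) F ξ - F ξ)) p volume ≤
      C * D m k := by
    intro m k
    have e : (fun ξ => win φ k ξ * (conv (κ m) F ξ - F ξ)) =
        fun ξ => win φ k ξ * (conv (κ m) (P k) ξ - P k ξ) := by
      ext ξ
      by_cases h0 : win φ k ξ = 0
      · simp [h0]
      have hξ := hφ.win_near h0
      rw [hPeq k ξ (by linarith)]
      congr 2
      rw [conv_apply, conv_apply]
      refine integral_congr_ae (.of_forall fun η => ?_)
      by_cases h1 : κ m η = 0
      · simp [h1]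
      have hη : ‖η‖ ≤ 1 := ((hκ m).2.1 η h1).trans (by
        rw [div_le_one (by positivity)]
        have : (0 : ℝ) ≤ m := m.cast_nonneg
        linarith)
      simp only
      rw [hPeq k (ξ - η)]
      have := norm_sub_le (ξ - latticePoint k) η
      rw [sub_right_comm] at this
      linarith
    rw [e]
    exact hwin k _ ((integrable_conv (κ m).integrable (hPi k)).sub (hPi k))
  refine tendsto_LN_zero hr (g := fun k => C * 2 * ∑ j ∈ t, wt s (latticePoint k) * b (k + j))
    (fun m => Measurable.of_discrete.aemeasurable) (fun m k => ?_) ?_ fun k => ?_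
  · rw [← Finset.mul_sum]
    calc _ ≤ wt s (latticePoint k) * (C * (2 * ∑ j ∈ t, b (k + j))) :=
          mul_le_mul' le_rfl ((hle m k).trans (mul_le_mul' le_rfl
            (((hmoll k).2 m).trans (mul_le_mul' le_rfl (hPb k)))))
      _ = _ := by ring
  · rw [LN_const_mul hr (by finiteness)]
    refine ENNReal.mul_lt_top (by finiteness) ((LN_sum_le hr t
      fun j => Measurable.of_discrete.aemeasurable).trans_lt (ENNReal.sum_lt_top.2 fun j _ => ?_))
    obtain ⟨W, hW, hwt⟩ := exists_wt_le (n := n) hs ‖(latticePoint j : Rn n)‖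
    refine (LN_mono hr (g := fun k => W * (wt s (latticePoint (k + j)) * b (k + j)))
      fun k => ?_).trans_lt ?_
    · rw [← mul_assoc]
      refine mul_le_mul' (hwt _ _ ?_) le_rfl
      rw [latticePoint_add, sub_add_cancel_left, norm_neg]
    · rw [LN_const_mul hr hW, LN_count_comp_add r (fun k => wt s (latticePoint k) * b k)]
      exact ENNReal.mul_lt_top hW.lt_top hfin
  · have h1 : Tendsto (fun m => wt s (latticePoint k) * (C * D m k)) atTop (𝓝 0) := by
      have h2 := ENNReal.Tendsto.const_mul (a := C) (hmoll k).1 (.inr hC)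
      have h3 := ENNReal.Tendsto.const_mul (a := wt s (latticePoint k)) h2 (.inr (wt_ne_top _ _))
      simpa using h3
    exact tendsto_of_tendsto_of_tendsto_of_le_of_le tendsto_const_nhds h1 (fun _ => zero_le)
      fun m => mul_le_mul' le_rfl (hle m k)

/-- A compactly supported Schwartz function has finite modulation norm. -/
theorem modNormHat_lt_top {φ : 𝓢(Rn n, ℂ)} (hφ : IsWindow φ) (p : ℝ≥0∞) {r : ℝ} (hr : 1 ≤ r)
    (s : ℝ) {G : 𝓢(Rn n, ℂ)} (hG : HasCompactSupport G) : modNormHat φ p r s G < ∞ := by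
  have hr0 : 0 < r := by linarith
  obtain ⟨M, hM⟩ := hG.isBounded.exists_norm_le
  rw [modNormHat, LN_lt_top_iff hr, lintegral_count,
    tsum_eq_sum (s := latticeBox n (M + Real.sqrt n))]
  · refine ENNReal.sum_lt_top.2 fun k _ => ?_
    have e : (fun ξ => win φ k ξ * G ξ) = SchwartzMap.smulLeftCLM ℂ (win φ k) G := by
      ext ξ
      rw [SchwartzMap.smulLeftCLM_apply_apply (win φ k).hasTemperateGrowth, smul_eq_mul]
    rw [e, invFT_schwartz]
    have h1 := ((schwartzFourierInv n (SchwartzMap.smulLeftCLM ℂ (win φ k) G)).memLp p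
      (volume : Measure (Rn n))).eLpNorm_lt_top.ne
    have h2 := wt_ne_top s (latticePoint k)
    finiteness
  · intro k hk
    have e : (fun ξ => win φ k ξ * G ξ) = fun _ => 0 := by
      ext ξ
      by_contra h0
      apply hk
      apply mem_latticeBox
      have h1 := hφ.win_near (left_ne_zero_of_mul h0)
      have h2 := hM ξ (subset_tsupport G (right_ne_zero_of_mul h0))
      have := norm_sub_le ξ (ξ - latticePoint k)
      rw [sub_sub_cancel] at this
      linarith
    have e' : invFT (fun _ : Rn n => (0 : ℂ)) = 0 := by
      ext x
      simp [invFT]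
    rw [e, e', eLpNorm_zero, mul_zero, ENNReal.zero_rpow_of_pos hr0]

open scoped ContDiff in
theorem contDiff_bracket_rpow (s : ℝ) : ContDiff ℝ ∞ fun x : Rn n => bracket x ^ s := by
  refine ContDiff.rpow_const_of_ne ?_ fun x => (bracket_pos x).ne'
  exact ContDiff.sqrt (contDiff_const.add (contDiff_norm_sq ℝ)) fun x => by positivity

/-- Compactly supported Schwartz functions are dense in the weighted Lebesgue space. -/
theorem exists_schwartz_approx {q : ℝ≥0∞} (hq1 : 1 ≤ q) (hqt : q ≠ ∞) {s : ℝ} {F : Rn n → ℂ}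
    (hF : AEStronglyMeasurable F) (hfin : LN q.toReal volume (fun ξ => wt s ξ * ‖F ξ‖ₑ) < ∞)
    {ε : ℝ≥0∞} (hε : 0 < ε) :
    ∃ G : 𝓢(Rn n, ℂ), HasCompactSupport G ∧
      LN q.toReal volume (fun ξ => wt s ξ * ‖F ξ - G ξ‖ₑ) < ε := by
  have hw := (continuous_bracket_rpow (n := n) s).aestronglyMeasurable (μ := volume)
  have hnorm : ∀ H : Rn n → ℂ, eLpNorm (fun x => (bracket x ^ s : ℝ) • H x) q volume =
      LN q.toReal volume (fun ξ => wt s ξ * ‖H ξ‖ₑ) := fun H => by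
    rw [eLpNorm_eq_LN hq1 hqt]
    congr 1
    ext ξ
    rw [enorm_smul, Real.enorm_of_nonneg (Real.rpow_nonneg (bracket_pos ξ).le s), wt]
  have hmem : MemLp (fun x => (bracket x ^ s : ℝ) • F x) q volume :=
    ⟨hw.smul hF, by rwa [hnorm]⟩
  obtain ⟨δ, hδ0, hδ⟩ := ENNReal.lt_iff_exists_real_btwn.1 hε
  obtain ⟨g, hgc, hgs, hg⟩ := hmem.exist_eLpNorm_sub_le hqt hq1 (ε := δ) (by simpa using hδ.1)
  have h1 : HasCompactSupport fun x => (bracket x ^ (-s) : ℝ) • g x :=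
    hgc.mono fun x hx h0 => hx (by simp only [h0, smul_zero])
  have h2 : ContDiff ℝ ((⊤ : ℕ∞) : WithTop ℕ∞) fun x => (bracket x ^ (-s) : ℝ) • g x :=
    (contDiff_bracket_rpow (-s)).smul hgs
  obtain ⟨G, hG⟩ : ∃ G : 𝓢(Rn n, ℂ), ⇑G = fun x => (bracket x ^ (-s) : ℝ) • g x :=
    ⟨h1.toSchwartzMap h2, rfl⟩
  refine ⟨G, by rwa [hG], ?_⟩
  rw [← hnorm]
  have e : (fun x => (bracket x ^ s : ℝ) • (F x - G x)) =
      (fun x => (bracket x ^ s : ℝ) • F x) - g := by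
    ext x
    rw [hG, Pi.sub_apply, smul_sub, smul_smul, ← Real.rpow_add (bracket_pos x), add_neg_cancel,
      Real.rpow_zero, one_smul]
  rw [e]
  exact hg.trans_lt hδ.2

end Approximation

end ModulationIdeals

namespace ModulationIdeals

/-! ### Closed ideals of a normed algebra and of a dense normed submodule -/

section Ideals

variable {n : ℕ}

open Filter Topology

theorem IsPointwiseProduct.symm {f g h : 𝓢'(Rn n, ℂ)} (H : IsPointwiseProduct f g h) :
    IsPointwiseProduct g f h := by
  obtain ⟨a, b, ha, hb, hh⟩ := H
  refine ⟨b, a, hb, ha, ?_⟩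
  simpa only [mul_comm] using hh

theorem IsPointwiseProduct.sub_right {f g g' h h' : 𝓢'(Rn n, ℂ)} (H : IsPointwiseProduct f g h)
    (H' : IsPointwiseProduct f g' h') : IsPointwiseProduct f (g - g') (h - h') := by
  obtain ⟨a, b, ha, hb, hh⟩ := H
  obtain ⟨a', b', ha', hb', hh'⟩ := H'
  refine ⟨a, fun x => b x - b' x, ha, hb.sub hb', (hh.sub hh').congr_ae ?_⟩
  filter_upwards [ha.ae_eq ha'] with x hx
  rw [hx, mul_sub]

theorem IsPointwiseProduct.sub_left {f f' g h h' : 𝓢'(Rn n, ℂ)} (H : IsPointwiseProduct f g h)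
    (H' : IsPointwiseProduct f' g h') : IsPointwiseProduct (f - f') g (h - h') :=
  (H.symm.sub_right H'.symm).symm

theorem IsPointwiseProduct.unique {f g h h' : 𝓢'(Rn n, ℂ)} (H : IsPointwiseProduct f g h)
    (H' : IsPointwiseProduct f g h') : h = h' := by
  obtain ⟨a, b, ha, hb, hh⟩ := H
  obtain ⟨a', b', ha', hb', hh'⟩ := H'
  refine hh.ext (hh'.congr_ae ?_)
  filter_upwards [ha.ae_eq ha', hb.ae_eq hb'] with x hx hx'
  rw [hx, hx']

/-- `N` is an extended norm on the tempered distributions (possibly degenerate). -/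
structure IsExtNorm (N : 𝓢'(Rn n, ℂ) → ℝ≥0∞) : Prop where
  zero : N 0 = 0
  add_le : ∀ f g, N (f + g) ≤ N f + N g
  smul_le : ∀ (c : ℂ) (f), N f < ∞ → N (c • f) ≤ ‖c‖ₑ * N f

variable {N NA NM : 𝓢'(Rn n, ℂ) → ℝ≥0∞}

theorem IsExtNorm.sub_le (h : IsExtNorm N) (f g : 𝓢'(Rn n, ℂ)) : N (f - g) ≤ N f + N g := by
  by_cases hg : N g < ∞
  · rw [sub_eq_add_neg, ← neg_one_smul ℂ g]
    refine (h.add_le _ _).trans (add_le_add le_rfl ((h.smul_le _ _ hg).trans_eq ?_))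
    rw [enorm_neg, enorm_one, one_mul]
  · simp [not_lt_top_iff.1 hg]

/-- The elements of finite norm form a linear subspace. -/
def IsExtNorm.submodule (h : IsExtNorm N) : Submodule ℂ 𝓢'(Rn n, ℂ) where
  carrier := space N
  zero_mem' := by
    change N 0 < ∞
    rw [h.zero]
    exact ENNReal.zero_lt_top
  add_mem' := fun {f g} hf hg => (h.add_le f g).trans_lt (ENNReal.add_lt_top.2 ⟨hf, hg⟩)
  smul_mem' := fun c f hf => (h.smul_le c f hf).trans_lt (ENNReal.mul_lt_top enorm_lt_top hf)

theorem IsExtNorm.sub_mem (h : IsExtNorm N) {f g : 𝓢'(Rn n, ℂ)} (hf : f ∈ space N)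
    (hg : g ∈ space N) : f - g ∈ space N :=
  h.submodule.sub_mem hf hg

/-- Given `C < ∞` and `ε > 0`, numbers `x` close to `0` satisfy `C x < ε`. -/
theorem exists_pos_mul_lt {C ε : ℝ≥0∞} (hC : C ≠ ∞) (hε : 0 < ε) :
    ∃ δ, 0 < δ ∧ ∀ x < δ, C * x < ε := by
  have h : Tendsto (fun x : ℝ≥0∞ => C * x) (𝓝 0) (𝓝 (C * 0)) :=
    ENNReal.Tendsto.const_mul tendsto_id (.inr hC)
  rw [mul_zero] at h
  obtain ⟨δ, hδ, hδ'⟩ := ENNReal.nhds_zero_basis.mem_iff.1 (h (Iio_mem_nhds hε))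
  exact ⟨δ, hδ, fun x hx => hδ' hx⟩

theorem normClosure_mono {S S' : Set 𝓢'(Rn n, ℂ)} (h : S ⊆ S') :
    normClosure N S ⊆ normClosure N S' := fun _ hf =>
  ⟨hf.1, fun ε hε => let ⟨g, hg, hlt⟩ := hf.2 ε hε; ⟨g, h hg, hlt⟩⟩

theorem IsExtNorm.subset_normClosure (h : IsExtNorm N) {S : Set 𝓢'(Rn n, ℂ)} (hS : S ⊆ space N) :
    S ⊆ normClosure N S := fun f hf =>
  ⟨hS hf, fun ε hε => ⟨f, hf, by rwa [sub_self, h.zero]⟩⟩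

theorem IsExtNorm.normClosure_normClosure_subset (h : IsExtNorm N) (S : Set 𝓢'(Rn n, ℂ)) :
    normClosure N (normClosure N S) ⊆ normClosure N S := by
  intro f hf
  refine ⟨hf.1, fun ε hε => ?_⟩
  obtain ⟨g, hg, hfg⟩ := hf.2 (ε / 2) (ENNReal.half_pos hε.ne')
  obtain ⟨k, hk, hgk⟩ := hg.2 (ε / 2) (ENNReal.half_pos hε.ne')
  refine ⟨k, hk, ?_⟩
  rw [← sub_add_sub_cancel f g k, ← ENNReal.add_halves ε]
  exact (h.add_le _ _).trans_lt (ENNReal.add_lt_add hfg hgk)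

/-- The closure of a linear subspace is a linear subspace. -/
def IsExtNorm.closureSubmodule (h : IsExtNorm N) (V : Submodule ℂ 𝓢'(Rn n, ℂ)) :
    Submodule ℂ 𝓢'(Rn n, ℂ) where
  carrier := normClosure N V
  zero_mem' := ⟨h.submodule.zero_mem, fun ε hε => ⟨0, V.zero_mem, by rwa [sub_zero, h.zero]⟩⟩
  add_mem' := fun {f g} hf hg => ⟨h.submodule.add_mem hf.1 hg.1, fun ε hε => by
    obtain ⟨f', hf', hlt⟩ := hf.2 (ε / 2) (ENNReal.half_pos hε.ne')
    obtain ⟨g', hg', hlt'⟩ := hg.2 (ε / 2) (ENNReal.half_pos hε.ne')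
    refine ⟨f' + g', V.add_mem hf' hg', ?_⟩
    rw [add_sub_add_comm, ← ENNReal.add_halves ε]
    exact (h.add_le _ _).trans_lt (ENNReal.add_lt_add hlt hlt')⟩
  smul_mem' := fun c f hf => ⟨h.submodule.smul_mem c hf.1, fun ε hε => by
    obtain ⟨δ, hδ, hδε⟩ := exists_pos_mul_lt (C := ‖c‖ₑ) enorm_ne_top hε
    obtain ⟨f', hf', hlt⟩ := hf.2 (min δ 1) (lt_min hδ one_pos)
    refine ⟨c • f', V.smul_mem c hf', ?_⟩
    rw [← smul_sub]
    exact (h.smul_le _ _ (hlt.trans ((min_le_right _ _).trans_lt ENNReal.one_lt_top))).trans_lt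
      (hδε _ (hlt.trans_le (min_le_left _ _)))⟩

/-- The space normed by `NA` is a normed algebra under pointwise multiplication, the space normed
by `NM` is a dense, continuously embedded submodule of it, and there are elements `u_m` of the
submodule which act as approximate units on the submodule and are bounded multipliers of the
algebra. -/
structure IsSegalPair (NA NM : 𝓢'(Rn n, ℂ) → ℝ≥0∞) : Prop where
  normA : IsExtNorm NA
  normM : IsExtNorm NM
  embedding : ∃ C : ℝ≥0∞, C ≠ ∞ ∧ ∀ f ∈ space NM, NA f ≤ C * NM f
  exists_mul : ∀ f ∈ space NA, ∀ g ∈ space NA, ∃ h, IsPointwiseProduct f g h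
  algebra : ∃ C : ℝ≥0∞, C ≠ ∞ ∧ ∀ f ∈ space NA, ∀ g ∈ space NA, ∀ h, IsPointwiseProduct f g h →
    NA h ≤ C * (NA f * NA g)
  module : ∃ C : ℝ≥0∞, C ≠ ∞ ∧ ∀ f ∈ space NA, ∀ g ∈ space NM, ∀ h, IsPointwiseProduct f g h →
    NM h ≤ C * (NA f * NM g)
  dense : ∀ f ∈ space NA, ∀ ε : ℝ≥0∞, 0 < ε → ∃ g ∈ space NM, NA (f - g) < ε
  approx_unit : ∃ u : ℕ → 𝓢'(Rn n, ℂ), (∀ m, u m ∈ space NM) ∧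
    (∃ C : ℝ≥0∞, C ≠ ∞ ∧ ∀ m, ∀ f ∈ space NA, ∀ h, IsPointwiseProduct (u m) f h →
      NA h ≤ C * NA f) ∧
    ∀ g ∈ space NM, ∀ ε : ℝ≥0∞, 0 < ε → ∃ m, ∀ h, IsPointwiseProduct (u m) g h → NM (h - g) < ε

namespace IsSegalPair

theorem space_subset (P : IsSegalPair NA NM) : space NM ⊆ space NA := by
  obtain ⟨C, hC, h⟩ := P.embedding
  exact fun f hf => (h f hf).trans_lt (ENNReal.mul_lt_top hC.lt_top hf)

theorem mul_mem (P : IsSegalPair NA NM) {f g h : 𝓢'(Rn n, ℂ)} (hf : f ∈ space NA)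
    (hg : g ∈ space NA) (H : IsPointwiseProduct f g h) : h ∈ space NA := by
  obtain ⟨C, hC, hmul⟩ := P.algebra
  exact (hmul f hf g hg h H).trans_lt (ENNReal.mul_lt_top hC.lt_top (ENNReal.mul_lt_top hf hg))

theorem mul_mem_module (P : IsSegalPair NA NM) {f g h : 𝓢'(Rn n, ℂ)} (hf : f ∈ space NA)
    (hg : g ∈ space NM) (H : IsPointwiseProduct f g h) : h ∈ space NM := by
  obtain ⟨C, hC, hmul⟩ := P.module
  exact (hmul f hf g hg h H).trans_lt (ENNReal.mul_lt_top hC.lt_top (ENNReal.mul_lt_top hf hg))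

/-- The intersection of a closed ideal of the algebra with the submodule. -/
theorem inter_mem_closedIdeals (P : IsSegalPair NA NM) {I : Set 𝓢'(Rn n, ℂ)}
    (hI : I ∈ closedIdeals NA) : I ∩ space NM ∈ closedIdeals NM := by
  obtain ⟨⟨hsub, ⟨V, hV⟩, hmul⟩, hcl⟩ := hI
  refine ⟨⟨Set.inter_subset_right, ⟨V ⊓ P.normM.submodule, ?_⟩, ?_⟩, ?_⟩
  · rw [Submodule.coe_inf, hV]
    rfl
  · rintro f hf g ⟨hgI, hgM⟩
    obtain ⟨h, hh, H⟩ := hmul f (P.space_subset hf) g hgI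
    exact ⟨h, ⟨hh, P.mul_mem_module (P.space_subset hf) hgM H⟩, H⟩
  · rintro f ⟨hfM, hf⟩
    obtain ⟨C, hC, hemb⟩ := P.embedding
    refine ⟨hcl ⟨P.space_subset hfM, fun ε hε => ?_⟩, hfM⟩
    obtain ⟨δ, hδ, hδε⟩ := exists_pos_mul_lt hC hε
    obtain ⟨g, hg, hlt⟩ := hf δ hδ
    exact ⟨g, hg.1, (hemb _ (P.normM.sub_mem hfM hg.2)).trans_lt (hδε _ hlt)⟩

/-- The closure of an ideal of the submodule is an ideal of the algebra, since the submodule is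
dense in the algebra. -/
theorem normClosure_mem_closedIdeals (P : IsSegalPair NA NM) {I : Set 𝓢'(Rn n, ℂ)}
    (hI : IsIdealIn (space NM) I) : normClosure NA I ∈ closedIdeals NA := by
  obtain ⟨hsub, ⟨V, rfl⟩, hmul⟩ := hI
  obtain ⟨C, hC, halg⟩ := P.algebra
  refine ⟨⟨fun f hf => hf.1, ⟨P.normA.closureSubmodule V, rfl⟩, fun f hf g hg => ?_⟩,
    P.normA.normClosure_normClosure_subset _⟩
  obtain ⟨h, H⟩ := P.exists_mul f hf g hg.1
  refine ⟨h, ⟨P.mul_mem hf hg.1 H, fun ε hε => ?_⟩, H⟩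
  obtain ⟨δ, hδ, hδε⟩ := exists_pos_mul_lt (ENNReal.mul_ne_top hC hf.ne) (ENNReal.half_pos hε.ne')
  obtain ⟨g', hg', hgg⟩ := hg.2 δ hδ
  have hgA := P.space_subset (hsub hg')
  obtain ⟨δ', hδ', hδε'⟩ := exists_pos_mul_lt (ENNReal.mul_ne_top hC hgA.ne)
    (ENNReal.half_pos hε.ne')
  obtain ⟨f', hf', hff⟩ := P.dense f hf δ' hδ'
  obtain ⟨h', hh', H'⟩ := hmul f' hf' g' hg'
  refine ⟨h', hh', ?_⟩
  obtain ⟨k, K⟩ := P.exists_mul f hf g' hgA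
  -- `f g - f' g' = f (g - g') + (f - f') g'`
  rw [← sub_add_sub_cancel h k h', ← ENNReal.add_halves ε]
  refine (P.normA.add_le _ _).trans_lt (ENNReal.add_lt_add ?_ ?_)
  · refine (halg f hf _ (P.normA.sub_mem hg.1 hgA) _ (H.sub_right K)).trans_lt ?_
    rw [← mul_assoc]
    exact hδε _ hgg
  · refine (halg _ (P.normA.sub_mem hf (P.space_subset hf')) g' hgA _ (K.sub_left H')).trans_lt ?_
    rw [mul_comm (NA _), ← mul_assoc]
    exact hδε' _ hff

/-- A closed ideal of the algebra is recovered from its intersection with the submodule: if `g` in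
the submodule is close to `f`, then `u_m f` is close to `u_m g`, which is close to `g`. -/
theorem normClosure_inter (P : IsSegalPair NA NM) {I : Set 𝓢'(Rn n, ℂ)}
    (hI : I ∈ closedIdeals NA) : normClosure NA (I ∩ space NM) = I := by
  obtain ⟨⟨hsub, -, hmul⟩, hcl⟩ := hI
  refine subset_antisymm ((normClosure_mono Set.inter_subset_left).trans hcl) fun f hf => ?_
  have hfA := hsub hf
  refine ⟨hfA, fun ε hε => ?_⟩
  obtain ⟨u, hu, ⟨C, hC, hbd⟩, hlim⟩ := P.approx_unit
  obtain ⟨E, hE, hemb⟩ := P.embedding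
  have hε2 := ENNReal.half_pos hε.ne'
  obtain ⟨δ, hδ, hδε⟩ := exists_pos_mul_lt (C := 1 + C) (by finiteness) hε2
  obtain ⟨g, hg, hfg⟩ := P.dense f hfA δ hδ
  have hgA := P.space_subset hg
  obtain ⟨δ', hδ', hδε'⟩ := exists_pos_mul_lt hE hε2
  obtain ⟨m, hm⟩ := hlim g hg δ' hδ'
  have huA := P.space_subset (hu m)
  obtain ⟨h, hh, H⟩ := hmul (u m) huA f hf
  obtain ⟨h', H'⟩ := P.exists_mul (u m) huA g hgA
  refine ⟨h, ⟨hh, P.mul_mem_module hfA (hu m) H.symm⟩, ?_⟩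
  have h1 : NA (h - h') ≤ C * NA (f - g) :=
    hbd m _ (P.normA.sub_mem hfA hgA) _ (H.sub_right H')
  have h2 : NA (h' - g) < ε / 2 :=
    (hemb _ (P.normM.sub_mem (P.mul_mem_module huA hg H') hg)).trans_lt (hδε' _ (hm h' H'))
  have e : f - h = ((f - g) - (h - h')) - (h' - g) := by abel
  rw [e, ← ENNReal.add_halves ε]
  refine (P.normA.sub_le _ _).trans_lt (ENNReal.add_lt_add ?_ h2)
  calc _ ≤ NA (f - g) + NA (h - h') := P.normA.sub_le _ _
    _ ≤ (1 + C) * NA (f - g) := by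
      rw [add_mul, one_mul]
      exact add_le_add le_rfl h1
    _ < _ := hδε _ hfg

/-- A closed ideal of the submodule is recovered from its closure in the algebra: if `f` is the
limit of `g` in the algebra, then `u_m f` is the limit of `u_m g` in the submodule. -/
theorem normClosure_inter_space (P : IsSegalPair NA NM) {I : Set 𝓢'(Rn n, ℂ)}
    (hI : I ∈ closedIdeals NM) : I = normClosure NA I ∩ space NM := by
  obtain ⟨⟨hsub, -, hmul⟩, hcl⟩ := hI
  refine subset_antisymm (fun f hf =>
    ⟨P.normA.subset_normClosure (hsub.trans P.space_subset) hf, hsub hf⟩) ?_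
  rintro f ⟨⟨hfA, hf⟩, hfM⟩
  refine hcl ⟨hfM, fun ε hε => ?_⟩
  obtain ⟨u, hu, -, hlim⟩ := P.approx_unit
  obtain ⟨C, hC, hmod⟩ := P.module
  have hε2 := ENNReal.half_pos hε.ne'
  obtain ⟨m, hm⟩ := hlim f hfM (ε / 2) hε2
  have huA := P.space_subset (hu m)
  obtain ⟨h, H⟩ := P.exists_mul (u m) huA f hfA
  obtain ⟨δ, hδ, hδε⟩ := exists_pos_mul_lt (ENNReal.mul_ne_top hC (hu m).ne) hε2
  obtain ⟨g, hg, hfg⟩ := hf δ hδ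
  obtain ⟨k, hk, K⟩ := hmul (u m) (hu m) g hg
  refine ⟨k, hk, ?_⟩
  have e : f - k = (h - k) - (h - f) := by abel
  rw [e, ← ENNReal.add_halves ε]
  refine (P.normM.sub_le _ _).trans_lt (ENNReal.add_lt_add ?_ (hm h H))
  refine (hmod _ (P.normA.sub_mem hfA (P.space_subset (hsub hg))) (u m) (hu m) _
    (H.sub_right K).symm).trans_lt ?_
  rw [mul_comm (NA _), ← mul_assoc]
  exact hδε _ hfg

theorem bijOn (P : IsSegalPair NA NM) :
    Set.BijOn (fun I => I ∩ space NM) (closedIdeals NA) (closedIdeals NM) := by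
  refine ⟨fun I hI => P.inter_mem_closedIdeals hI, fun I hI J hJ h => ?_, fun I hI =>
    ⟨normClosure NA I, P.normClosure_mem_closedIdeals hI.1, (P.normClosure_inter_space hI).symm⟩⟩
  rw [← P.normClosure_inter hI, ← P.normClosure_inter hJ]
  exact congrArg _ h

end IsSegalPair

end Ideals

end ModulationIdeals

namespace ModulationIdeals

/-! ### The pair `𝓕L^q_s`, `M^{p,q}_s` -/

section Pair

variable {n : ℕ}

open Filter Topology

theorem isExtNorm_flNorm {q : ℝ≥0∞} (hq1 : 1 ≤ q) (s : ℝ) :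
    IsExtNorm (flNorm (n := n) q s) where
  zero := by
    rw [flNorm, map_zero, weightedLpNorm_eq isGivenBy_zero]
    simp
  add_le f g := by
    simp only [flNorm, map_add]
    exact weightedLpNorm_add_le hq1 _ _
  smul_le c f hf := by
    simp only [flNorm, map_smul]
    exact weightedLpNorm_smul_le c _ hf

theorem isExtNorm_modNorm (φ : 𝓢(Rn n, ℂ)) {p q : ℝ≥0∞} (hp1 : 1 ≤ p) (hq1 : 1 ≤ q) (hqt : q ≠ ∞)
    (s : ℝ) : IsExtNorm (modNorm φ p q s) := by
  have hr : 1 ≤ q.toReal := by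
    rwa [← ENNReal.toReal_one, ENNReal.toReal_le_toReal ENNReal.one_ne_top hqt]
  have hadd : ∀ k (f g : 𝓢'(Rn n, ℂ)), freqLocal φ k (f + g) = freqLocal φ k f + freqLocal φ k g :=
    fun k f g => by simp only [freqLocal, map_add]
  have hsmul : ∀ k (c : ℂ) (f : 𝓢'(Rn n, ℂ)), freqLocal φ k (c • f) = c • freqLocal φ k f :=
    fun k c f => by simp only [freqLocal, map_smul]
  refine ⟨?_, fun f g => ?_, fun c f hf => ?_⟩
  · have h0 : ∀ k, locNorm φ p 0 k = 0 := fun k => by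
      rw [locNorm, freqLocal, map_zero, map_zero, map_zero, weightedLpNorm_eq isGivenBy_zero]
      simp
    have : 0 < q.toReal := by linarith
    simp [modNorm_eq_LN φ hqt, h0, LN, this]
  · simp_rw [modNorm_eq_LN φ hqt]
    refine le_trans (LN_mono hr fun k => ?_) (LN_add_le hr Measurable.of_discrete.aemeasurable
      Measurable.of_discrete.aemeasurable)
    rw [← mul_add, locNorm, hadd]
    exact mul_le_mul' le_rfl (weightedLpNorm_add_le hp1 _ _)
  · have hk := locNorm_lt_top hqt hr hf
    simp_rw [modNorm_eq_LN φ hqt]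
    rw [← LN_const_mul hr enorm_ne_top]
    refine LN_mono hr fun k => ?_
    rw [mul_left_comm, locNorm, hsmul]
    exact mul_le_mul' le_rfl (weightedLpNorm_smul_le c _ (hk k))

/-- The pointwise product corresponds to the convolution of Fourier transforms. -/
theorem exists_isPointwiseProduct {f g : 𝓢'(Rn n, ℂ)} {F G : Rn n → ℂ} (hF : Integrable F)
    (hG : Integrable G) (hf : IsGivenBy (distFourier f) F) (hg : IsGivenBy (distFourier g) G) :
    ∃ h, IsGivenBy (distFourier h) (conv F G) ∧
      IsPointwiseProduct f g ((((2 * Real.pi : ℝ) ^ n : ℝ)⁻¹ : ℂ) • h) := by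
  have hi := integrable_conv hF hG
  obtain ⟨h, hh⟩ := exists_distFourier_isGivenBy hi
  refine ⟨h, hh, invFT F, invFT G, isGivenBy_invFT_of_distFourier hF hf,
    isGivenBy_invFT_of_distFourier hG hg, ?_⟩
  have h1 := (isGivenBy_invFT_of_distFourier hi hh).smul (((2 * Real.pi : ℝ) ^ n : ℝ)⁻¹ : ℂ)
  have h2 : (((2 * Real.pi : ℝ) ^ n : ℝ) : ℂ) ≠ 0 := by
    rw [Complex.ofReal_ne_zero]
    positivity
  simp_rw [invFT_conv hF hG, inv_mul_cancel_left₀ h2] at h1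
  exact h1

/-- The Fourier transform of an element of `𝓕L^q_s` is an integrable function. -/
theorem exists_fourier_of_flNorm {q : ℝ≥0∞} (hq1 : 1 ≤ q) (hqt : q ≠ ∞) {s : ℝ}
    (hadm : Admissible n q.toReal s) {f : 𝓢'(Rn n, ℂ)} (hf : flNorm q s f < ∞) :
    ∃ F, Integrable F ∧ IsGivenBy (distFourier f) F ∧
      flNorm q s f = LN q.toReal volume (fun ξ => wt s ξ * ‖F ξ‖ₑ) := by
  obtain ⟨F, hF⟩ := exists_isGivenBy_of_weightedLpNorm hf
  obtain ⟨K, hK, hemb⟩ := hadm.embedding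
  have e := weightedLpNorm_eq_LN hq1 hqt (s := s) hF
  refine ⟨F, ⟨hF.1, ?_⟩, hF, e⟩
  rw [hasFiniteIntegral_iff_enorm]
  refine (hemb _ hF.1.enorm).trans_lt (ENNReal.mul_lt_top hK.lt_top ?_)
  rw [← e]
  exact hf

/-- `M^{p,q}_s` is a dense normed submodule of the normed algebra `𝓕L^q_s`, with approximate
units. -/
theorem isSegalPair {φ : 𝓢(Rn n, ℂ)} (hφ : IsWindow φ) {p q : ℝ≥0∞} {s : ℝ} (hp1 : 1 ≤ p)
    (hp2 : p ≤ 2) (hq1 : 1 ≤ q) (hqt : q ≠ ∞) (hqp : q ≤ p.conjExponent)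
    (hadm : Admissible n q.toReal s) : IsSegalPair (flNorm (n := n) q s) (modNorm φ p q s) := by
  have hpt : p ≠ ∞ := (hp2.trans_lt (by finiteness)).ne
  have hr := hadm.one_le
  have hA := isExtNorm_flNorm (n := n) hq1 s
  have hM := isExtNorm_modNorm φ hp1 hq1 hqt s
  have hfl : ∀ {f : 𝓢'(Rn n, ℂ)} {F : Rn n → ℂ}, IsGivenBy (distFourier f) F →
      flNorm q s f = LN q.toReal volume (fun ξ => wt s ξ * ‖F ξ‖ₑ) :=
    fun hF => weightedLpNorm_eq_LN hq1 hqt hF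
  have hmod : ∀ {f : 𝓢'(Rn n, ℂ)} {F : Rn n → ℂ}, Integrable F → IsGivenBy (distFourier f) F →
      modNorm φ p q s f = modNormHat φ p q.toReal s F :=
    fun hi hF => modNorm_eq_modNormHat φ hqt s hi hF
  have hfou := fun {f : 𝓢'(Rn n, ℂ)} (hf : f ∈ space (flNorm q s)) =>
    exists_fourier_of_flNorm hq1 hqt hadm hf
  obtain ⟨E, hE, hemb⟩ := exists_fourier_of_modNorm hφ hp1 hp2 hq1 hqt hqp hadm
  have hle : ∀ f ∈ space (modNorm φ p q s), flNorm q s f ≤ E * modNorm φ p q s f := by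
    intro f hf
    obtain ⟨F, hF, hb⟩ := hemb f hf
    rwa [hfl hF]
  have hsub : ∀ f ∈ space (modNorm φ p q s), f ∈ space (flNorm q s) := fun f hf =>
    (hle f hf).trans_lt (ENNReal.mul_lt_top hE.lt_top hf)
  set c : ℂ := Complex.ofReal ((2 * Real.pi) ^ n) with hc
  have hc0 : c ≠ 0 := by
    rw [hc, Complex.ofReal_ne_zero]
    positivity
  -- a Schwartz function with compact support is the Fourier transform of an element of `M`
  have hschwartz : ∀ G : 𝓢(Rn n, ℂ), HasCompactSupport G →
      ∃ g ∈ space (modNorm φ p q s), IsGivenBy (distFourier g) G := by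
    intro G hG
    obtain ⟨g, hg⟩ := exists_distFourier_isGivenBy G.integrable
    refine ⟨g, ?_, hg⟩
    change modNorm φ p q s g < ∞
    rw [hmod G.integrable hg]
    exact modNormHat_lt_top hφ p hr s hG
  refine ⟨hA, hM, ⟨E, hE, hle⟩, fun f hf g hg => ?_, ?_, ?_, fun f hf ε hε => ?_, ?_⟩
  · obtain ⟨F, hF, hfF, -⟩ := hfou hf
    obtain ⟨G, hG, hgG, -⟩ := hfou hg
    obtain ⟨h, -, H⟩ := exists_isPointwiseProduct hF hG hfF hgG
    exact ⟨_, H⟩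
  · obtain ⟨C, hC, hconv⟩ := exists_LN_conv_le hadm
    refine ⟨‖c⁻¹‖ₑ * C, by finiteness, fun f hf g hg h H => ?_⟩
    obtain ⟨F, hF, hfF, ef⟩ := hfou hf
    obtain ⟨G, hG, hgG, eg⟩ := hfou hg
    obtain ⟨h', hh', H'⟩ := exists_isPointwiseProduct hF hG hfF hgG
    have hb : flNorm q s h' ≤ C * (flNorm q s f * flNorm q s g) := by
      rw [hfl hh', ef, eg]
      exact hconv F G hF.1 hG.1
    rw [H.unique H', mul_assoc]
    exact (hA.smul_le _ _ (hb.trans_lt (ENNReal.mul_lt_top hC.lt_top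
      (ENNReal.mul_lt_top hf hg)))).trans (mul_le_mul' le_rfl hb)
  · obtain ⟨C, hC, hconv⟩ := exists_modNormHat_conv_le hφ hp1 hpt hadm
    refine ⟨‖c⁻¹‖ₑ * C, by finiteness, fun f hf g hg h H => ?_⟩
    obtain ⟨F, hF, hfF, ef⟩ := hfou hf
    obtain ⟨G, hG, hgG, -⟩ := hfou (hsub g hg)
    obtain ⟨h', hh', H'⟩ := exists_isPointwiseProduct hF hG hfF hgG
    have hb : modNorm φ p q s h' ≤ C * (flNorm q s f * modNorm φ p q s g) := by
      rw [hmod (integrable_conv hF hG) hh', ef, hmod hG hgG]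
      exact hconv F G hF hG
    rw [H.unique H', mul_assoc]
    exact (hM.smul_le _ _ (hb.trans_lt (ENNReal.mul_lt_top hC.lt_top
      (ENNReal.mul_lt_top hf hg)))).trans (mul_le_mul' le_rfl hb)
  · obtain ⟨F, hF, hfF, ef⟩ := hfou hf
    obtain ⟨G, hG, hlt⟩ := exists_schwartz_approx hq1 hqt (s := s) hF.1 (ef ▸ hf) hε
    obtain ⟨g, hg, hgG⟩ := hschwartz G hG
    refine ⟨g, hg, ?_⟩
    rwa [hfl (F := fun ξ => F ξ - G ξ) (by rw [map_sub]; exact hfF.sub hgG)]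
  · obtain ⟨κ, hκ⟩ := exists_mollifier n
    -- the factor `c` makes multiplication by `u m` correspond to convolution with `κ m`
    have hu : ∀ m, ∃ g ∈ space (modNorm φ p q s),
        IsGivenBy (distFourier g) (c • κ m : 𝓢(Rn n, ℂ)) :=
      fun m => hschwartz _ ((hκ m).1.mono fun ξ hξ h0 => hξ (by
        rw [smul_apply, h0, smul_zero]))
    choose u huM hu using hu
    have hprod : ∀ m {f h : 𝓢'(Rn n, ℂ)} {F : Rn n → ℂ}, Integrable F →
        IsGivenBy (distFourier f) F → IsPointwiseProduct (u m) f h →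
        IsGivenBy (distFourier h) (conv (κ m) F) := by
      intro m f h F hF hfF H
      obtain ⟨h', hh', H'⟩ := exists_isPointwiseProduct (c • κ m).integrable hF (hu m) hfF
      rw [H.unique H', map_smul]
      have h1 := hh'.smul c⁻¹
      have e : (fun ξ => c⁻¹ * conv (c • κ m : 𝓢(Rn n, ℂ)) F ξ) = conv (κ m) F := by
        ext ξ
        simp_rw [conv_apply, smul_apply, smul_eq_mul, mul_assoc]
        rw [integral_const_mul, inv_mul_cancel_left₀ hc0]
      rwa [e] at h1
    refine ⟨u, huM, ?_, fun g hg ε hε => ?_⟩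
    · obtain ⟨C, hC, hmoll⟩ := exists_LN_mollifier_le hadm
      refine ⟨C, hC, fun m f hf h H => ?_⟩
      obtain ⟨F, hF, hfF, ef⟩ := hfou hf
      rw [hfl (hprod m hF hfF H), ef]
      refine hmoll (κ m) (fun ξ hξ => ((hκ m).2.1 ξ hξ).trans ?_) (hκ m).2.2.1 F hF.1
      rw [div_le_one (by positivity)]
      have : (0 : ℝ) ≤ m := m.cast_nonneg
      linarith
    · obtain ⟨G, hG, hgG, -⟩ := hfou (hsub g hg)
      have hlim := tendsto_modNormHat_mollifier hφ hκ hp1 hpt hr hadm.nonneg hG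
        (hmod hG hgG ▸ hg)
      obtain ⟨m, hm⟩ := (hlim.eventually_lt_const hε).exists
      refine ⟨m, fun h H => ?_⟩
      rwa [hmod (F := fun ξ => conv (κ m) G ξ - G ξ) ((integrable_conv (κ m).integrable hG).sub hG)
        (by rw [map_sub]; exact (hprod m hG hgG H).sub hgG)]

theorem admissible_of_exponents {q : ℝ≥0∞} {s : ℝ} (hqt : q ≠ ∞)
    (h : (q = 1 ∧ 0 ≤ s) ∨ (1 < q ∧ (n : ℝ) / q.conjExponent.toReal < s)) :
    Admissible n q.toReal s := by
  rcases h with ⟨rfl, hs⟩ | ⟨hq, hs⟩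
  · rw [ENNReal.toReal_one]
    exact admissible_one hs
  · have hc : q.conjExponent ≠ ∞ := by
      have : q - 1 ≠ 0 := (tsub_pos_of_lt hq).ne'
      rw [ENNReal.conjExponent]
      finiteness
    have := ENNReal.HolderConjugate.conjExponent hq.le
    exact admissible_of_lt (ENNReal.HolderConjugate.toReal_of_ne_top hqt hc) hs

end Pair

end ModulationIdeals

theorem mainTheorem2 (n : ℕ) (p q : ℝ≥0∞) (s : ℝ) (hp1 : 1 ≤ p) (hp2 : p ≤ 2) (hq : q ≠ ∞)
    (hqs : (q = 1 ∧ 0 ≤ s) ∨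
      (1 < q ∧ q ≤ p.conjExponent ∧ (n : ℝ) / q.conjExponent.toReal < s))
    (φ : 𝓢(ModulationIdeals.Rn n, ℂ)) (hφ : ModulationIdeals.IsWindow φ) :
    -- `I_F ↦ I_F ∩ M` is a bijection from the closed ideals of `𝓕L` onto those of `M`
    Set.BijOn (fun I => I ∩ ModulationIdeals.Mod φ p q s)
      (ModulationIdeals.closedIdeals (ModulationIdeals.flNorm (n := n) q s))
      (ModulationIdeals.closedIdeals (ModulationIdeals.modNorm φ p q s)) ∧
    -- the closure in `𝓕L` of a closed ideal of `M` is a closed ideal of `𝓕L`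
    Set.MapsTo (ModulationIdeals.normClosure (ModulationIdeals.flNorm (n := n) q s))
      (ModulationIdeals.closedIdeals (ModulationIdeals.modNorm φ p q s))
      (ModulationIdeals.closedIdeals (ModulationIdeals.flNorm (n := n) q s)) ∧
    -- and `I_M ↦ closure of I_M in 𝓕L` is the inverse map
    (∀ I ∈ ModulationIdeals.closedIdeals (ModulationIdeals.flNorm (n := n) q s),
      ModulationIdeals.normClosure (ModulationIdeals.flNorm q s)
        (I ∩ ModulationIdeals.Mod φ p q s) = I) ∧
    (∀ I ∈ ModulationIdeals.closedIdeals (ModulationIdeals.modNorm φ p q s),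
      I = ModulationIdeals.normClosure (ModulationIdeals.flNorm q s) I ∩
        ModulationIdeals.Mod φ p q s) := by
  have hq1 : 1 ≤ q := by
    rcases hqs with ⟨rfl, -⟩ | ⟨h, -⟩
    exacts [le_rfl, h.le]
  have hqp : q ≤ p.conjExponent := by
    rcases hqs with ⟨rfl, -⟩ | ⟨-, h, -⟩
    -- `p'` is `1 + (p - 1)⁻¹`
    exacts [le_self_add, h]
  have P := ModulationIdeals.isSegalPair hφ hp1 hp2 hq1 hq hqp
    (ModulationIdeals.admissible_of_exponents hq (hqs.imp_right fun h => ⟨h.1, h.2.2⟩))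
  exact ⟨P.bijOn, fun I hI => P.normClosure_mem_closedIdeals hI.1,
    fun I hI => P.normClosure_inter hI, fun I hI => P.normClosure_inter_space hI⟩
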